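/- A \emph{cut} of an ordered field $F$ is a pair $C=(C^-,C^+)$ of subsets with $F=C^-\cup C^+$ and $a<b$ for all $a\in C^-$, $b\in C^+$. It is a \emph{Dedekind cut} if $C^-$ and $C^+$ are nonempty, $C^-$ has no maximum and $C^+$ has no minimum. It is \emph{symmetric} if the cofinality of $C^-$ equals the coinitiality of $C^+$. An ordered field is called \emph{symmetrically complete} if it has no symmetric Dedekind cut. **Theorem.** (1) An ordered field $F$ is symmetrically complete if and only if for every ordinal $o$ and every decreasing (not necessarily strictly) sequence $\langle [a_i,b_i] : i<o\rangle$ of closed bounded intervals of $F$, with $a_i\le b_i$, the intersection $\bigcap_{i<o}[a_i,b_i]$ is nonempty (the empty intersection being $F$). (2) Let $K$ be an arbitrary ordered field. Then there are a symmetrically complete real closed field $L$ (in which, by (1), every decreasing sequence of closed bounded intervals, of any ordinal length, has nonempty intersection) and an embedding of ordered fields $\iota\colon K\to L$ such that (a) $L$ is prime over $K$: for every symmetrically complete real closed field $M$ and every embedding of ordered fields $\varphi\colon K\to M$ there is an embedding of ordered fields $\psi\colon L\to M$ with $\psi\circ\iota=\varphi$; (b) $|L|\le 2^{|K|^+ +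 \aleph_1}$. -/

import Mathlib

universe u v

open scoped Cardinal

/-- A cut of a linearly ordered set `F`: a partition of `F` into a lower part and an upper part,
every element of the first being less than every element of the second (so that the two parts are
disjoint). Either part may be empty. -/
structure OrderCut (F : Type u) [LinearOrder F] where
  lower : Set F
  upper : Set F
  union_eq : lower ∪ upper = Set.univ
  lower_lt_upper : ∀ a ∈ lower, ∀ b ∈ upper, a < b

namespace OrderCut

variable {F : Type u} [LinearOrder F]

/-- A cut is a Dedekind cut if both parts are nonempty, the lower part has no maximum and the
upper part has no minimum. -/
structure IsDedekind (C : OrderCut F) : Prop where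
  lower_nonempty : C.lower.Nonempty
  upper_nonempty : C.upper.Nonempty
  no_max : ∀ a, ¬ IsGreatest C.lower a
  no_min : ∀ b, ¬ IsLeast C.upper b

/-- The cofinality of the lower part of a cut. -/
noncomputable def lowerCof (C : OrderCut F) : Cardinal.{u} :=
  Order.cof C.lower

/-- The coinitiality of the upper part of a cut, i.e. the cofinality of its order dual. -/
noncomputable def upperCof (C : OrderCut F) : Cardinal.{u} :=
  Order.cof (C.upper)ᵒᵈ

/-- A cut is symmetric if its two cofinalities agree. -/
def IsSymmetric (C : OrderCut F) : Prop :=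
  C.lowerCof = C.upperCof

end OrderCut

/-- `F` has no symmetric Dedekind cut. (In an ordered field every symmetric cut is a Dedekind cut:
for a cut that is not Dedekind one of the cofinalities is `0` or `1` and the other is infinite.) -/
def IsSymmetricallyComplete (F : Type u) [LinearOrder F] : Prop :=
  ∀ C : OrderCut F, C.IsDedekind → ¬ C.IsSymmetric

/-- Every decreasing (not necessarily strictly) sequence of nonempty closed bounded intervals
`[a i, b i]`, indexed by the ordinals `i < o` for an arbitrary ordinal `o`, has nonempty
intersection. -/
def HasNestedIntervalProperty (F : Type u) [LinearOrder F] : Prop :=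
  ∀ (o : Ordinal.{u}) (a b : Set.Iio o → F), (∀ i, a i ≤ b i) →
    (∀ i j, i ≤ j → Set.Icc (a j) (b j) ⊆ Set.Icc (a i) (b i)) →
      (⋂ i, Set.Icc (a i) (b i)).Nonempty

/-! For (1), suppose a decreasing sequence of intervals has empty intersection. The left endpoints
are cofinal in the lower part of a Dedekind cut and the right endpoints coinitial in its upper part;
both are monotone in the same index, so the cut is symmetric (`Order.cof_eq_of_monotone`).
Conversely, strictly monotone sequences of the common cofinality, approaching a symmetric Dedekind
cut from both sides, bound nested intervals without a common point.

For (2), start from a real closure of K inside a very large algebraically closed field Ω and fill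
symmetric Dedekind cuts one at a time: a step adjoins an element x in such a cut of the current
field F and passes to a real closed field algebraic over F(x); unions are taken at limits. The
stages carry no order as data, since the order of a real closed field is given by its squares.

The tower embeds into every symmetrically complete real closed M that receives K. A symmetric
Dedekind cut of F is filled in M, because otherwise its image would determine a symmetric Dedekind
cut of M. Polynomials over F factor into linear ones and sums of two squares, so the cut of x
determines the order of F(x), and the remaining algebraic extension is handled by
`exists_extension_of_isAlgebraic`.

The heart is that the tower stops. Let ν = |K| + ℵ₁. It suffices that every stage has at most 2^ν
elements and that Ω has more: then there is always room in Ω to fill a cut, while the stages,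
indexed by all ordinals, cannot be pairwise distinct. An order without strictly monotone sequences
of length ν⁺ in either direction has at most 2^ν elements (`NoLongChain.mk_le`). Absence of such
sequences passes from the archimedean classes of an ordered group to the group
(`NoLongChain.of_archimedeanClass`). Applied to a field and then to its value group, this reduces
everything to the rank classes, that is, the archimedean classes of the value group.

Filling a cut adds at most one rank class (`exists_rankClass_eq_of_algOver`). If it adds one, the
cut of old rank classes in which it lies can be approached countably from below exactly if it can
from above (`CountablyBalanced.rankClass_iff`). An order obtained from at most ν elements by such
balanced insertions has no long chains (`NoLongChain.of_rank`). -/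

set_option linter.unusedSectionVars false

open Polynomial

/-! ### The order of a real closed field is determined by its squares. -/

namespace IsRealClosed

section SquareOrder

variable (R : Type*) [Field R] [IsRealClosed R]

/-- If -(a² + b²) were a square z² with a ≠ 0, dividing by a² would make -1 a sum of squares. -/
theorem isSquare_add {x y : R} (hx : IsSquare x) (hy : IsSquare y) : IsSquare (x + y) := by
  rcases isSquare_or_isSquare_neg (x + y) with h | ⟨z, hz⟩
  · exact h
  obtain ⟨a, rfl⟩ := hx
  obtain ⟨b, rfl⟩ := hy
  by_cases ha : a = 0
  · simp [ha]
  exfalso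
  have hs : IsSumSq ((b / a) * (b / a) + ((z / a) * (z / a) + 0)) :=
    .sq_add _ (.sq_add _ .zero)
  refine IsSemireal.one_add_ne_zero hs ?_
  field_simp
  linear_combination -hz

theorem eq_zero_of_isSquare_neg {x : R} (hx : IsSquare x) (hy : IsSquare (-x)) : x = 0 := by
  obtain ⟨a, rfl⟩ := hx
  obtain ⟨b, hb⟩ := hy
  by_contra ha
  have ha : a ≠ 0 := by rintro rfl; simp at ha
  have hs : IsSumSq ((b / a) * (b / a) + 0) := .sq_add _ .zero
  refine IsSemireal.one_add_ne_zero hs ?_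
  field_simp
  linear_combination -hb

/-- The cone of squares of a real closed field. -/
def squareCone : RingCone R where
  carrier := {x | IsSquare x}
  mul_mem' := IsSquare.mul
  one_mem' := IsSquare.one
  add_mem' := isSquare_add R
  zero_mem' := IsSquare.zero
  eq_zero_of_mem_of_neg_mem' := eq_zero_of_isSquare_neg R

instance : HasMemOrNegMem (squareCone R) := ⟨fun x => isSquare_or_isSquare_neg x⟩

open Classical in
/-- The unique ordering of a real closed field, whose nonnegative elements are the squares. -/
@[reducible] noncomputable def linearOrder : LinearOrder R :=
  LinearOrder.mkOfAddGroupCone (squareCone R)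

theorem isStrictOrderedRing : @IsStrictOrderedRing R _ (linearOrder R).toPartialOrder :=
  letI := linearOrder R
  haveI : IsOrderedRing R := IsOrderedRing.mkOfCone (squareCone R)
  inferInstance

end SquareOrder

/-- Every ring homomorphism from a real closed field to an ordered field is monotone. -/
theorem strictMono_ringHom {R S : Type*} [Field R] [LinearOrder R] [IsStrictOrderedRing R]
    [IsRealClosed R] [Field S] [LinearOrder S] [IsStrictOrderedRing S] (f : R →+* S) :
    StrictMono f := by
  intro x y hxy
  obtain ⟨z, hz⟩ := nonneg_iff_isSquare.1 (sub_nonneg.2 hxy.le)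
  have h : f y - f x = f z * f z := by rw [← map_sub, hz, map_mul]
  have h0 : f z ≠ 0 := by
    rw [_root_.map_ne_zero]
    rintro rfl
    simp only [mul_zero, sub_eq_zero] at hz
    exact hxy.ne' hz
  have := mul_self_pos.2 h0
  linarith

/-- Real closedness is invariant under isomorphism. -/
theorem of_ringEquiv {R S : Type*} [Field R] [Field S] [IsRealClosed R] (e : R ≃+* S) :
    IsRealClosed S where
  one_add_ne_zero {s} hs h := by
    have hs' : ∀ t, IsSumSq t → IsSumSq (e.symm t) := by
      intro t ht
      induction ht with
      | zero => simp
      | sq_add a _ ih =>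
        rw [map_add, map_mul]
        exact .sq_add _ ih
    exact IsSemireal.one_add_ne_zero (hs' s hs) (by rw [← map_one e.symm, ← map_add, h, map_zero])
  isSquare_or_isSquare_neg x := by
    rcases isSquare_or_isSquare_neg (e.symm x) with h | h
    · left; simpa using h.map e
    · right; simpa using h.map e
  exists_isRoot_of_odd_natDegree {f} hf := by
    obtain ⟨x, hx⟩ := exists_isRoot_of_odd_natDegree (R := R) (f := f.map e.symm.toRingHom)
      (by rwa [natDegree_map])
    refine ⟨e x, ?_⟩
    have := hx.map (f := e.toRingHom)
    rw [Polynomial.map_map] at this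
    simpa using this

end IsRealClosed

/-! ### Degrees of irreducible polynomials over a real closed field. -/

section Degree

variable {E N : Type*} [Field E] [Field N] [Algebra E N]

theorem exists_eq_add_mul_of_mem_adjoin {a : E} {s : N} (hs : s ^ 2 = algebraMap E N a) {x : N}
    (hx : x ∈ IntermediateField.adjoin E {s}) :
    ∃ u v : E, x = algebraMap E N u + algebraMap E N v * s := by
  have hmon : (X ^ 2 - C a : E[X]).Monic := monic_X_pow_sub_C a two_ne_zero
  have halg : IsAlgebraic E s := ⟨_, hmon.ne_zero, by simp [hs]⟩
  rw [← IntermediateField.mem_toSubalgebra,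
    IntermediateField.adjoin_simple_toSubalgebra_of_isAlgebraic halg,
    Algebra.adjoin_singleton_eq_range_aeval] at hx
  obtain ⟨f, rfl⟩ := hx
  have hd : (f %ₘ (X ^ 2 - C a)).natDegree ≤ 1 := by
    have h := natDegree_modByMonic_lt f hmon (by
      intro h
      have := congrArg natDegree h
      simp at this)
    rw [natDegree_X_pow_sub_C] at h
    omega
  obtain ⟨u, v, huv⟩ := exists_eq_X_add_C_of_natDegree_le_one hd
  refine ⟨v, u, ?_⟩
  have h3 : aeval s f = aeval s (f %ₘ (X ^ 2 - C a)) :=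
    (aeval_modByMonic_eq_self_of_root (by simp [hs])).symm
  change aeval s f = _
  rw [h3, huv]
  simp [add_comm]

/-- A field in which every element is a square has no quadratic extension. -/
theorem finrank_ne_two_of_forall_isSquare [CharZero E] (h : ∀ x : E, IsSquare x) :
    Module.finrank E N ≠ 2 := by
  intro h2
  have : FiniteDimensional E N := Module.finite_of_finrank_pos (by omega)
  have : CharZero N := charZero_of_injective_algebraMap (algebraMap E N).injective
  obtain ⟨θ, hθ⟩ := Field.exists_primitive_element E N
  have hint : IsIntegral E θ := IsIntegral.of_finite E θ
  have hdeg : (minpoly E θ).natDegree = 2 := by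
    rw [← IntermediateField.adjoin.finrank hint, hθ, IntermediateField.finrank_top', h2]
  have hmon := minpoly.monic hint
  have hirr := minpoly.irreducible hint
  obtain ⟨s, hs⟩ := h (discrim 1 ((minpoly E θ).coeff 1) ((minpoly E θ).coeff 0))
  have hexp : minpoly E θ = X ^ 2 + C ((minpoly E θ).coeff 1) * X + C ((minpoly E θ).coeff 0) := by
    conv_lhs => rw [hmon.as_sum, hdeg]
    simp [Finset.sum_range_succ]
    ring
  obtain ⟨r, hr⟩ : ∃ r, (minpoly E θ).IsRoot r := by
    refine ⟨(-((minpoly E θ).coeff 1) + s) / (2 * 1), ?_⟩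
    rw [IsRoot.def, congrArg (eval _) hexp]
    have := (quadratic_eq_zero_iff (a := (1 : E)) one_ne_zero hs _).2 (Or.inl rfl)
    simp only [eval_add, eval_pow, eval_X, eval_mul, eval_C]
    linear_combination this
  have := degree_eq_one_of_irreducible_of_root hirr hr
  rw [degree_eq_natDegree hirr.ne_zero, hdeg] at this
  norm_num at this

variable [LinearOrder E] [IsStrictOrderedRing E] [IsRealClosed E]

/-- The minimal polynomial of a primitive element has odd degree, hence a root, and it is
irreducible. -/
theorem IsRealClosed.finrank_eq_one_of_odd [FiniteDimensional E N]
    (h : Odd (Module.finrank E N)) : Module.finrank E N = 1 := by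
  obtain ⟨θ, hθ⟩ := Field.exists_primitive_element E N
  have hint : IsIntegral E θ := IsIntegral.of_finite E θ
  have hdeg : (minpoly E θ).natDegree = Module.finrank E N := by
    rw [← IntermediateField.adjoin.finrank hint, hθ, IntermediateField.finrank_top']
  rw [← hdeg] at h ⊢
  obtain ⟨r, hr⟩ := IsRealClosed.exists_isRoot_of_odd_natDegree h
  exact natDegree_eq_of_degree_eq_some
    (degree_eq_one_of_irreducible_of_root (minpoly.irreducible hint) hr)

/-- The usual square root of a complex number: with r the modulus of a + bi, take u² = (r + a)/2 and
v = b/(2u). If u = 0, the number is a nonpositive element of `E`. -/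
theorem IsRealClosed.isSquare_add_mul {i : N} (hi : i ^ 2 = -1) (a b : E) :
    ∃ u v : E, algebraMap E N a + algebraMap E N b * i =
      (algebraMap E N u + algebraMap E N v * i) ^ 2 := by
  have hn : 0 ≤ a * a + b * b := add_nonneg (mul_self_nonneg a) (mul_self_nonneg b)
  obtain ⟨r, hr0, hr⟩ : ∃ r : E, 0 ≤ r ∧ r * r = a * a + b * b := by
    obtain ⟨r, hr⟩ := IsRealClosed.nonneg_iff_isSquare.1 hn
    exact ⟨|r|, abs_nonneg r, by rw [abs_mul_abs_self, hr]⟩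
  have hra : 0 ≤ (r + a) / 2 := by
    have : -r ≤ a := by nlinarith [mul_self_nonneg b]
    linarith
  obtain ⟨u, hu⟩ := IsRealClosed.nonneg_iff_isSquare.1 hra
  have key : ∀ u v : E, a = u * u - v * v → b = 2 * u * v →
      algebraMap E N a + algebraMap E N b * i =
      (algebraMap E N u + algebraMap E N v * i) ^ 2 := by
    rintro u v rfl rfl
    simp only [map_sub, map_mul, map_ofNat]
    linear_combination -(algebraMap E N v) ^ 2 * hi
  by_cases hu0 : u = 0
  · subst hu0
    have hra' : r = -a := by linarith
    have hb : b = 0 := by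
      subst hra'
      have : b * b = 0 := by linarith
      simpa using this
    have ha : 0 ≤ -a := by linarith
    obtain ⟨v, hv⟩ := IsRealClosed.nonneg_iff_isSquare.1 ha
    exact ⟨0, v, key 0 v (by linarith) (by simp [hb])⟩
  · refine ⟨u, b / (2 * u), key _ _ ?_ ?_⟩
    · have h1 : r = 2 * (u * u) - a := by linarith
      rw [h1] at hr
      field_simp
      linear_combination -hr
    · field_simp

/-- The fixed field of a Sylow 2-subgroup has odd degree over `E`, hence degree 1, so the Galois
group is a 2-group. If the degree exceeded 2, a subgroup of index 2 in the Galois group over E(i)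
would yield a quadratic extension of E(i), where every element is already a square. -/
theorem IsRealClosed.finrank_le_two_of_isGalois [FiniteDimensional E N] [IsGalois E N]
    {i : N} (hi : i ^ 2 = -1) : Module.finrank E N ≤ 2 := by
  classical
  have : Fact (Nat.Prime 2) := ⟨Nat.prime_two⟩
  have : CharZero N := charZero_of_injective_algebraMap (algebraMap E N).injective
  obtain ⟨k, hk⟩ : ∃ k, Module.finrank E N = 2 ^ k := by
    let P : Sylow 2 (N ≃ₐ[E] N) := default
    have hodd : Odd (Module.finrank E (IntermediateField.fixedField (P : Subgroup (N ≃ₐ[E] N)))) := by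
      have h1 := Module.finrank_mul_finrank E (IntermediateField.fixedField
        (P : Subgroup (N ≃ₐ[E] N))) N
      rw [IntermediateField.finrank_fixedField_eq_card, ← IsGalois.card_aut_eq_finrank E N,
        ← (P : Subgroup (N ≃ₐ[E] N)).index_mul_card] at h1
      have h2 := Nat.eq_of_mul_eq_mul_right Nat.card_pos h1
      rw [h2, ← Nat.not_even_iff_odd, even_iff_two_dvd]
      exact P.not_dvd_index
    have h1 := IsRealClosed.finrank_eq_one_of_odd hodd
    have h2 := Module.finrank_mul_finrank E (IntermediateField.fixedField
        (P : Subgroup (N ≃ₐ[E] N))) N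
    rw [h1, one_mul, IntermediateField.finrank_fixedField_eq_card] at h2
    obtain ⟨k, hk⟩ := IsPGroup.iff_card.1 P.isPGroup'
    exact ⟨k, by rw [← h2, ← hk]⟩
  by_contra hgt
  let E1 := IntermediateField.adjoin E {i}
  have hint : IsIntegral E i := IsIntegral.of_finite E i
  have hE1 : ∀ x : E1, IsSquare x := by
    intro x
    have hx := exists_eq_add_mul_of_mem_adjoin (a := (-1 : E)) (s := i) (by simpa using hi) x.2
    obtain ⟨a, b, hab⟩ := hx
    obtain ⟨u, v, huv⟩ := IsRealClosed.isSquare_add_mul hi a b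
    refine ⟨algebraMap E E1 u + algebraMap E E1 v * IntermediateField.AdjoinSimple.gen E i, ?_⟩
    apply Subtype.ext
    rw [hab, huv, sq]
    rfl
  have h2 : Module.finrank E E1 ≤ 2 := by
    rw [IntermediateField.adjoin.finrank hint]
    have hne : (X ^ 2 + 1 : E[X]) ≠ 0 := (by monicity! : (X ^ 2 + 1 : E[X]).Monic).ne_zero
    refine (natDegree_le_of_dvd (minpoly.dvd E i (by simp [hi])) hne).trans ?_
    compute_degree
  have h3 := Module.finrank_mul_finrank E E1 N
  obtain ⟨m, -, hm⟩ := (Nat.dvd_prime_pow Nat.prime_two).1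
    (hk ▸ h3 ▸ Dvd.intro_left _ rfl : Module.finrank E1 N ∣ 2 ^ k)
  rcases m with - | m
  · rw [hm] at h3
    omega
  · have hcard : Nat.card (N ≃ₐ[E1] N) = 2 ^ (m + 1) := by
      rw [IsGalois.card_aut_eq_finrank, hm]
    obtain ⟨H, hH⟩ := Sylow.exists_subgroup_card_pow_prime (G := N ≃ₐ[E1] N) 2 (n := m)
      (hcard ▸ pow_dvd_pow 2 (Nat.le_succ m))
    have h4 := Module.finrank_mul_finrank E1 (IntermediateField.fixedField H) N
    rw [IntermediateField.finrank_fixedField_eq_card, hH, hm, pow_succ, mul_comm] at h4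
    exact finrank_ne_two_of_forall_isSquare hE1
      (Nat.eq_of_mul_eq_mul_left (by positivity) h4)

/-- Irreducible polynomials over a real closed field have degree at most two. -/
theorem IsRealClosed.natDegree_le_two {p : E[X]} (hp : Irreducible p) : p.natDegree ≤ 2 := by
  -- The extra factor puts a square root of -1 into the splitting field.
  let q : E[X] := p * (X ^ 2 + 1)
  have hX : (X ^ 2 + 1 : E[X]).Monic := by monicity!
  have hq : q ≠ 0 := mul_ne_zero hp.ne_zero hX.ne_zero
  have hs := SplittingField.splits q
  have hdeg : (X ^ 2 + 1 : E[X]).degree ≠ 0 := by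
    rw [show (X ^ 2 + 1 : E[X]).degree = 2 by compute_degree!]
    norm_num
  have hsp := (splits_mul (f := p.map (algebraMap E q.SplittingField))
    (Polynomial.map_ne_zero hp.ne_zero) (hX.map (algebraMap E q.SplittingField)).ne_zero).1
    (by rwa [← Polynomial.map_mul])
  obtain ⟨i, hi⟩ := hsp.2.exists_eval_eq_zero (by rwa [degree_map])
  obtain ⟨θ, hθ⟩ := hsp.1.exists_eval_eq_zero (by
    rw [degree_map]; exact (degree_pos_of_irreducible hp).ne')
  have : Normal E q.SplittingField := Normal.of_isSplittingField q
  have : IsGalois E q.SplittingField := { }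
  have h1 := IsRealClosed.finrank_le_two_of_isGalois (E := E) (N := q.SplittingField) (i := i)
    (by simpa [eq_neg_iff_add_eq_zero] using hi)
  have hint : IsIntegral E θ := IsIntegral.of_finite E θ
  have h2 := minpoly.natDegree_le (A := E) θ
  have h3 : Associated (minpoly E θ) p :=
    (minpoly.irreducible hint).associated_of_dvd hp (minpoly.dvd E θ (by
      rwa [aeval_def, ← eval_map]))
  rw [← natDegree_eq_of_degree_eq (degree_eq_degree_of_associated h3)]
  omega

end Degree

/-! ### Factorization, intermediate values and Rolle's theorem for polynomials. -/

namespace IsRealClosed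

variable {E : Type*} [Field E] [LinearOrder E] [IsStrictOrderedRing E] [IsRealClosed E]

/-- Complete the square in degree 2; the remaining constant is positive, since otherwise its
negative would be a square and give a root. -/
theorem irreducible_eq {p : E[X]} (hp : Irreducible p) :
    ∃ c : E, c ≠ 0 ∧ ((∃ a, p = C c * (X - C a)) ∨
      ∃ a d, d ≠ 0 ∧ p = C c * ((X - C a) ^ 2 + C (d ^ 2))) := by
  have h1 := hp.natDegree_pos
  have h2 := natDegree_le_two hp
  have hc : p.leadingCoeff ≠ 0 := leadingCoeff_ne_zero.2 hp.ne_zero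
  rcases (by omega : p.natDegree = 1 ∨ p.natDegree = 2) with h | h
  · refine ⟨p.coeff 1, by rwa [leadingCoeff, h] at hc, Or.inl ⟨-p.coeff 0 / p.coeff 1, ?_⟩⟩
    have hc' : p.coeff 1 ≠ 0 := by rwa [leadingCoeff, h] at hc
    conv_lhs => rw [p.as_sum_range_C_mul_X_pow, h]
    simp only [Finset.sum_range_succ, Finset.sum_range_zero, mul_sub, ← C_mul,
      mul_div_cancel₀ _ hc', C_neg]
    simp [add_comm]
  · have hc' : p.coeff 2 ≠ 0 := by rwa [leadingCoeff, h] at hc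
    set c := p.coeff 2 with hcdef
    set a := -p.coeff 1 / (2 * c)
    set e := p.coeff 0 / c - a ^ 2 with he
    have hpe : p = C c * ((X - C a) ^ 2 + C e) := by
      conv_lhs => rw [p.as_sum_range_C_mul_X_pow, h]
      have h3 : p.coeff 1 = c * (-2 * a) := by simp only [a]; field_simp
      have h4 : p.coeff 0 = c * (e + a ^ 2) := by simp only [e]; field_simp; ring
      simp only [Finset.sum_range_succ, Finset.sum_range_zero, ← hcdef]
      rw [h3, h4]
      simp only [C_mul, C_add, C_neg, C_pow, map_ofNat]
      ring
    have hepos : 0 < e := by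
      by_contra hneg
      obtain ⟨s, hs⟩ := nonneg_iff_isSquare.1 (by linarith : 0 ≤ -e)
      have hroot : p.IsRoot (a + s) := by
        rw [hpe]
        simp only [IsRoot.def, eval_mul, eval_C, eval_add, eval_pow, eval_sub, eval_X]
        rw [show (a + s - a) ^ 2 + e = 0 by linear_combination -hs, mul_zero]
      have := degree_eq_one_of_irreducible_of_root hp hroot
      rw [degree_eq_natDegree hp.ne_zero, h] at this
      norm_num at this
    obtain ⟨d, hd⟩ := nonneg_iff_isSquare.1 hepos.le
    refine ⟨c, hc', Or.inr ⟨a, d, ?_, ?_⟩⟩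
    · rintro rfl
      simp [hd] at hepos
    · rw [sq d, ← hd]
      exact hpe

/-- Nonzero polynomials over a real closed field are products of linear polynomials and of
quadratic polynomials that are sums of two squares. -/
theorem polynomial_induction {P : E[X] → Prop} (hC : ∀ c, c ≠ 0 → P (C c))
    (hlin : ∀ a, P (X - C a)) (hquad : ∀ a d, d ≠ 0 → P ((X - C a) ^ 2 + C (d ^ 2)))
    (hmul : ∀ p q, P p → P q → P (p * q)) {p : E[X]} (hp : p ≠ 0) : P p := by
  induction p using UniqueFactorizationMonoid.induction_on_prime with
  | h₁ => exact absurd rfl hp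
  | h₂ q hq =>
    obtain ⟨c, hc, rfl⟩ := isUnit_iff.1 hq
    exact hC c hc.ne_zero
  | h₃ q π hq hπ ih =>
    refine hmul _ _ ?_ (ih hq)
    obtain ⟨c, hc, ⟨a, rfl⟩ | ⟨a, d, hd, rfl⟩⟩ := irreducible_eq hπ.irreducible
    · exact hmul _ _ (hC c hc) (hlin a)
    · exact hmul _ _ (hC c hc) (hquad a d hd)

/-- The property is multiplicative, so it is enough to check the irreducible factors: a linear
factor whose root is outside the interval keeps its sign, and the quadratic factors are positive
everywhere. -/
theorem eval_mul_eval_pos {p : E[X]} {a b : E} (hab : a ≤ b)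
    (h : ∀ r, a ≤ r → r ≤ b → p.eval r ≠ 0) : 0 < p.eval a * p.eval b := by
  have hp : p ≠ 0 := by
    rintro rfl
    exact h a le_rfl hab (by simp)
  revert h
  refine polynomial_induction (P := fun p => (∀ r, a ≤ r → r ≤ b → p.eval r ≠ 0) →
    0 < p.eval a * p.eval b) ?_ ?_ ?_ ?_ hp
  · intro c hc _
    simpa using hc
  · intro s h
    simp only [eval_sub, eval_X, eval_C, ne_eq, sub_eq_zero] at h ⊢
    rcases lt_or_ge s a with hs | hs
    · exact mul_pos (by linarith) (by linarith)
    · rcases lt_or_ge b s with hb | hb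
      · exact mul_pos_of_neg_of_neg (by linarith) (by linarith)
      · exact absurd rfl (h s hs hb)
  · intro s d hd _
    simp only [eval_add, eval_pow, eval_sub, eval_X, eval_C]
    positivity
  · intro p q ihp ihq h
    have h1 := ihp fun r ha hb h0 => h r ha hb (by simp [h0])
    have h2 := ihq fun r ha hb h0 => h r ha hb (by simp [h0])
    simp only [eval_mul]
    have := mul_pos h1 h2
    linarith

/-- The intermediate value theorem for polynomials over a real closed field. -/
theorem exists_root_of_eval_mul_eval_neg {p : E[X]} {a b : E} (hab : a ≤ b)
    (h : p.eval a * p.eval b < 0) : ∃ r, a < r ∧ r < b ∧ p.eval r = 0 := by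
  by_contra! hne
  refine absurd (eval_mul_eval_pos (p := p) hab fun r ha hb => ?_) h.not_gt
  rcases ha.eq_or_lt with rfl | ha
  · intro h0; simp [h0] at h
  rcases hb.eq_or_lt with rfl | hb
  · intro h0; simp [h0] at h
  exact hne r ha hb

/-- Rolle's theorem, proved algebraically. Replace b by the next root b' after a and split off both
roots with their multiplicities; the cofactor q has constant sign on [a, b'], and what is left of
the derivative takes opposite signs at a and b'. -/
theorem exists_derivative_root {p : E[X]} (hp : p ≠ 0) {a b : E} (hab : a < b)
    (ha : p.eval a = 0) (hb : p.eval b = 0) :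
    ∃ r, a < r ∧ r < b ∧ (derivative p).eval r = 0 := by
  classical
  obtain ⟨b', ⟨hab', hb'b, hb'⟩, hmin⟩ : ∃ b', (a < b' ∧ b' ≤ b ∧ p.eval b' = 0) ∧
      ∀ r, a < r → r < b' → p.eval r ≠ 0 := by
    let S := p.roots.toFinset.filter fun r => a < r
    have hS : S.Nonempty := ⟨b, by simp [S, hp, hb, hab]⟩
    have h1 := S.min'_mem hS
    simp only [S, Finset.mem_filter, Multiset.mem_toFinset, mem_roots hp, IsRoot.def] at h1
    refine ⟨S.min' hS, ⟨h1.2, S.min'_le _ (by simp [S, hp, hb, hab]), h1.1⟩, fun r hr1 hr2 h0 => ?_⟩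
    exact absurd (S.min'_le r (by simp [S, hp, h0, hr1])) hr2.not_ge
  obtain ⟨q₁, hq₁, hna⟩ := exists_eq_pow_rootMultiplicity_mul_and_not_dvd p hp a
  have hq₁0 : q₁ ≠ 0 := by rintro rfl; simp at hna
  obtain ⟨q, hq, hnb⟩ := exists_eq_pow_rootMultiplicity_mul_and_not_dvd q₁ hq₁0 b'
  rw [dvd_iff_isRoot, IsRoot.def] at hna hnb
  have hm : p.rootMultiplicity a ≠ 0 := by
    intro h
    rw [h] at hq₁
    apply hna
    rw [← ha]
    conv_rhs => rw [hq₁]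
    simp
  have hn : q₁.rootMultiplicity b' ≠ 0 := by
    intro h
    rw [h] at hq
    apply hnb
    have := hb'
    rw [hq₁, eval_mul, mul_eq_zero] at this
    rcases this with h0 | h0
    · simp [sub_eq_zero, hab'.ne'] at h0
    · rw [← h0]
      conv_rhs => rw [hq]
      simp
  obtain ⟨m, hm'⟩ := Nat.exists_eq_succ_of_ne_zero hm
  obtain ⟨n, hn'⟩ := Nat.exists_eq_succ_of_ne_zero hn
  rw [hm'] at hq₁
  rw [hn'] at hq
  have hpq : p = (X - C a) ^ (m + 1) * ((X - C b') ^ (n + 1) * q) := by rw [← hq, ← hq₁]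
  have hqr : ∀ r, a ≤ r → r ≤ b' → q.eval r ≠ 0 := by
    intro r h1 h2 h0
    rcases h1.eq_or_lt with rfl | h1
    · exact hna (by rw [hq]; simp [h0])
    rcases h2.eq_or_lt with rfl | h2
    · exact hnb h0
    · exact hmin r h1 h2 (by rw [hpq]; simp [h0])
  have hpos := eval_mul_eval_pos hab'.le hqr
  let g : E[X] := C (m + 1 : E) * ((X - C b') * q) + C (n + 1 : E) * ((X - C a) * q) +
    (X - C a) * (X - C b') * derivative q
  have hder : derivative p = (X - C a) ^ m * (X - C b') ^ n * g := by
    rw [hpq]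
    simp only [derivative_mul, derivative_X_sub_C_pow, g, Nat.add_sub_cancel]
    push_cast
    simp only [C_add, C_1, C_eq_natCast]
    ring
  obtain ⟨r, h1, h2, h3⟩ := exists_root_of_eval_mul_eval_neg (p := g) hab'.le (by
    simp only [g, eval_add, eval_mul, eval_sub, eval_X, eval_C, sub_self, mul_zero, zero_mul,
      add_zero, zero_add]
    have h4 : (0 : E) < (m + 1) * (n + 1) * (b' - a) ^ 2 * (q.eval a * q.eval b') := by
      have := sub_pos.2 hab'
      positivity
    linarith)
  exact ⟨r, h1, h2.trans_le hb'b, by rw [hder]; simp [h3]⟩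

/-- The root m is simple, so p = (X - m)h where h has no root in the interval and keeps its sign. -/
theorem eval_mul_eval_neg_of_unique_root {p : E[X]} {a b m : E} (ham : a < m) (hmb : m < b)
    (hm : p.eval m = 0) (hm' : (derivative p).eval m ≠ 0)
    (huniq : ∀ r, a ≤ r → r ≤ b → p.eval r = 0 → r = m) : p.eval a * p.eval b < 0 := by
  obtain ⟨h, rfl⟩ := dvd_iff_isRoot.2 hm
  have h1 : ∀ r, a ≤ r → r ≤ b → h.eval r ≠ 0 := by
    intro r ha hb h0
    obtain rfl := huniq r ha hb (by simp [h0])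
    exact hm' (by simp [derivative_mul, h0])
  have h2 := eval_mul_eval_pos (ham.trans hmb).le h1
  simp only [eval_mul, eval_sub, eval_X, eval_C]
  have h3 : (a - m) * (b - m) < 0 := mul_neg_of_neg_of_pos (by linarith) (by linarith)
  have := mul_neg_of_neg_of_pos h3 h2
  linarith

end IsRealClosed

/-! ### Sums of squares of polynomials over a semireal field. -/

section SumSq

variable {E : Type*} [Field E] [IsSemireal E]

theorem IsSumSq.eq_zero_of_mul_self_add {a s : E} (hs : IsSumSq s) (h : a * a + s = 0) :
    a = 0 := by
  by_contra ha
  refine IsSemireal.one_add_ne_zero (hs.mul (IsSumSq.mul_self a⁻¹)) ?_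
  field_simp
  linear_combination h

theorem IsSumSq.eval {p : E[X]} (hp : IsSumSq p) (x : E) : IsSumSq (p.eval x) := by
  induction hp with
  | zero => simp
  | sq_add a _ ih => rw [eval_add, eval_mul]; exact .sq_add _ ih

/-- Leading coefficients of sums of squares are themselves sums of squares, so over a semireal field
they cannot cancel; this is why the second conjunct is carried through the induction. -/
theorem IsSumSq.even_natDegree {p : E[X]} (hp : IsSumSq p) :
    Even p.natDegree ∧ IsSumSq p.leadingCoeff := by
  induction hp with
  | zero => simp
  | @sq_add a s _ ih =>
    by_cases ha : a = 0
    · simpa [ha] using ih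
    have hd : (a * a).natDegree = a.natDegree + a.natDegree := natDegree_mul ha ha
    have hl : (a * a).leadingCoeff = a.leadingCoeff * a.leadingCoeff := leadingCoeff_mul a a
    have hl0 : a.leadingCoeff ≠ 0 := leadingCoeff_ne_zero.2 ha
    by_cases hs : s = 0
    · rw [hs, add_zero, hd, hl]
      exact ⟨⟨_, rfl⟩, IsSumSq.mul_self _⟩
    have haa : a * a ≠ 0 := mul_ne_zero ha ha
    rcases lt_trichotomy (a * a).natDegree s.natDegree with h | h | h
    · have h' := degree_lt_degree h
      rw [natDegree_add_eq_right_of_natDegree_lt h, leadingCoeff_add_of_degree_lt h']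
      exact ih
    · have h' : (a * a).degree = s.degree := by
        rw [degree_eq_natDegree haa, degree_eq_natDegree hs, h]
      have h0 : (a * a).leadingCoeff + s.leadingCoeff ≠ 0 := by
        rw [hl]
        exact fun h0 => hl0 (ih.2.eq_zero_of_mul_self_add h0)
      have h1 : (a * a + s).degree = s.degree := by
        rw [degree_add_eq_of_leadingCoeff_add_ne_zero h0, h', max_self]
      rw [leadingCoeff_add_of_degree_eq h' h0, natDegree_eq_of_degree_eq h1, hl]
      exact ⟨ih.1, .sq_add _ ih.2⟩
    · have h' := degree_lt_degree h
      rw [natDegree_add_eq_left_of_natDegree_lt h, leadingCoeff_add_of_degree_lt' h', hd, hl]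
      exact ⟨⟨_, rfl⟩, IsSumSq.mul_self _⟩

end SumSq

/-! ### Existence of real closures, by the Artin–Schreier argument with weights from K. -/

namespace RealClosure

variable {K : Type*} [Field K] [LinearOrder K] [IsStrictOrderedRing K]
  {A : Type*} [Field A] [Algebra K A]

/-- The sums of squares of elements of `E` with nonnegative weights in `K`. -/
def weightedSumSq (E : IntermediateField K A) : AddSubmonoid A :=
  AddSubmonoid.closure {y | ∃ c : K, 0 ≤ c ∧ ∃ g ∈ E, y = algebraMap K A c * g ^ 2}

theorem weightedSumSq_mono {E F : IntermediateField K A} (h : E ≤ F) :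
    weightedSumSq E ≤ weightedSumSq F :=
  AddSubmonoid.closure_mono fun _ ⟨c, hc, g, hg, hy⟩ => ⟨c, hc, g, h hg, hy⟩

theorem mem_weightedSumSq {E : IntermediateField K A} {c : K} (hc : 0 ≤ c) {g : A} (hg : g ∈ E) :
    algebraMap K A c * g ^ 2 ∈ weightedSumSq E :=
  AddSubmonoid.subset_closure ⟨c, hc, g, hg, rfl⟩

theorem sq_mem_weightedSumSq {E : IntermediateField K A} {g : A} (hg : g ∈ E) :
    g ^ 2 ∈ weightedSumSq E := by
  simpa using mem_weightedSumSq zero_le_one hg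

theorem weightedSumSq_le (E : IntermediateField K A) {y : A} (hy : y ∈ weightedSumSq E) :
    y ∈ E := by
  induction hy using AddSubmonoid.closure_induction with
  | mem y hy =>
    obtain ⟨c, _, g, hg, rfl⟩ := hy
    exact mul_mem (E.algebraMap_mem c) (pow_mem hg 2)
  | zero => exact zero_mem E
  | add x y _ _ hx hy => exact add_mem hx hy

theorem mul_mem_weightedSumSq {E : IntermediateField K A} {x y : A}
    (hx : x ∈ weightedSumSq E) (hy : y ∈ weightedSumSq E) : x * y ∈ weightedSumSq E := by
  induction hx using AddSubmonoid.closure_induction with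
  | mem x hx =>
    obtain ⟨c, hc, g, hg, rfl⟩ := hx
    induction hy using AddSubmonoid.closure_induction with
    | mem y hy =>
      obtain ⟨d, hd, h, hh, rfl⟩ := hy
      have := mem_weightedSumSq (mul_nonneg hc hd) (mul_mem hg hh)
      rw [map_mul] at this
      convert this using 1
      ring
    | zero => simp
    | add a b _ _ ha hb => rw [mul_add]; exact add_mem ha hb
  | zero => simp
  | add a b _ _ ha hb => rw [add_mul]; exact add_mem ha hb

theorem inv_mem_weightedSumSq {E : IntermediateField K A} {x : A}
    (hx : x ∈ weightedSumSq E) : x⁻¹ ∈ weightedSumSq E := by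
  by_cases h0 : x = 0
  · simp [h0]
  have := mul_mem_weightedSumSq hx (sq_mem_weightedSumSq (E.inv_mem (weightedSumSq_le E hx)))
  convert this using 1
  field_simp

theorem neg_one_notMem_bot : (-1 : A) ∉ weightedSumSq (⊥ : IntermediateField K A) := by
  have key : ∀ y ∈ weightedSumSq (⊥ : IntermediateField K A),
      ∃ c : K, 0 ≤ c ∧ y = algebraMap K A c := by
    intro y hy
    induction hy using AddSubmonoid.closure_induction with
    | mem y hy =>
      obtain ⟨c, hc, g, hg, rfl⟩ := hy
      obtain ⟨d, rfl⟩ := IntermediateField.mem_bot.1 hg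
      exact ⟨c * d ^ 2, by positivity, by simp⟩
    | zero => exact ⟨0, le_rfl, by simp⟩
    | add x y _ _ hx hy =>
      obtain ⟨c, hc, rfl⟩ := hx
      obtain ⟨d, hd, rfl⟩ := hy
      exact ⟨c + d, by positivity, by simp⟩
  intro h
  obtain ⟨c, hc, h⟩ := key _ h
  rw [← map_one (algebraMap K A), ← map_neg] at h
  have := (algebraMap K A).injective h
  linarith

theorem exists_maximal : ∃ E : IntermediateField K A, Maximal (fun E => (-1 : A) ∉ weightedSumSq E) E := by
  obtain ⟨E, -, hE⟩ := zorn_le_nonempty₀ {E : IntermediateField K A | (-1 : A) ∉ weightedSumSq E}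
    (fun c hc hchain F hF => by
      refine ⟨sSup c, ?_, fun E hE => le_sSup hE⟩
      have hmem : ∀ x ∈ sSup c, ∃ E ∈ c, x ∈ E := by
        intro x hx
        have hd := hchain.directedOn
        have : Nonempty c := ⟨⟨F, hF⟩⟩
        rw [sSup_eq_iSup', ← SetLike.mem_coe, IntermediateField.coe_iSup_of_directed
          hd.directed_val] at hx
        simpa using hx
      have key : ∀ y ∈ weightedSumSq (sSup c), ∃ E ∈ c, y ∈ weightedSumSq E := by
        intro y hy
        induction hy using AddSubmonoid.closure_induction with
        | mem y hy =>
          obtain ⟨d, hd, g, hg, rfl⟩ := hy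
          obtain ⟨E, hE, hgE⟩ := hmem g hg
          exact ⟨E, hE, mem_weightedSumSq hd hgE⟩
        | zero => exact ⟨F, hF, zero_mem _⟩
        | add x y _ _ hx hy =>
          obtain ⟨E₁, h₁, hx⟩ := hx
          obtain ⟨E₂, h₂, hy⟩ := hy
          obtain ⟨E, hE, h1, h2⟩ := hchain.directedOn E₁ h₁ E₂ h₂
          exact ⟨E, hE, add_mem (weightedSumSq_mono h1 hx) (weightedSumSq_mono h2 hy)⟩
      intro h
      obtain ⟨E, hE, h⟩ := key _ h
      exact hc hE h) ⊥ neg_one_notMem_bot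
  exact ⟨E, hE⟩

variable {E : IntermediateField K A} (hE : Maximal (fun E => (-1 : A) ∉ weightedSumSq E) E)

include hE

theorem neg_one_mem_of_notMem {θ : A} (hθ : θ ∉ E) :
    (-1 : A) ∈ weightedSumSq ((IntermediateField.adjoin E {θ}).restrictScalars K) := by
  by_contra h
  refine hθ (hE.2 h (fun x hx => ?_) ?_)
  · exact (IntermediateField.adjoin E {θ}).algebraMap_mem ⟨x, hx⟩
  · exact IntermediateField.mem_adjoin_simple_self E θ

/-- If a root s of a is not in `E`, maximality writes -1 as u + av + ws with u, v weighted sums of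
squares over `E`. Then w = 0 because s is not in `E`, v ≠ 0 because -1 is not a weighted sum over
`E`, and -a = (1 + u)/v. -/
theorem isSquare_of_neg_notMem [IsAlgClosed A] {a : E} (ha : -(a : A) ∉ weightedSumSq E) :
    IsSquare a := by
  obtain ⟨s, hs⟩ := IsAlgClosed.exists_pow_nat_eq (a : A) two_pos
  by_cases hsE : s ∈ E
  · exact ⟨⟨s, hsE⟩, Subtype.ext (by simp [← hs, sq])⟩
  exfalso
  have key : ∀ y ∈ weightedSumSq ((IntermediateField.adjoin E {s}).restrictScalars K),
      ∃ u ∈ weightedSumSq E, ∃ v ∈ weightedSumSq E, ∃ w ∈ E, y = u + a * v + w * s := by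
    intro y hy
    induction hy using AddSubmonoid.closure_induction with
    | mem y hy =>
      obtain ⟨c, hc, g, hg, rfl⟩ := hy
      obtain ⟨u, v, rfl⟩ := exists_eq_add_mul_of_mem_adjoin (a := a) hs
        (IntermediateField.mem_restrictScalars K |>.1 hg)
      refine ⟨_, mem_weightedSumSq hc u.2, _, mem_weightedSumSq hc v.2,
        algebraMap K A c * (2 * u * v), mul_mem (E.algebraMap_mem c)
          (mul_mem (mul_mem (ofNat_mem E 2) u.2) v.2), ?_⟩
      simp only [IntermediateField.algebraMap_apply]
      linear_combination (algebraMap K A c) * v ^ 2 * hs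
    | zero => exact ⟨0, zero_mem _, 0, zero_mem _, 0, zero_mem _, by simp⟩
    | add x y _ _ hx hy =>
      obtain ⟨u, hu, v, hv, w, hw, rfl⟩ := hx
      obtain ⟨u', hu', v', hv', w', hw', rfl⟩ := hy
      exact ⟨_, add_mem hu hu', _, add_mem hv hv', _, add_mem hw hw', by ring⟩
  obtain ⟨u, hu, v, hv, w, hw, h⟩ := key _ (neg_one_mem_of_notMem hE hsE)
  have hw0 : w = 0 := by
    by_contra hw0
    refine hsE ?_
    have : s = (-1 - u - a * v) / w := by field_simp; linear_combination -h
    rw [this]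
    exact div_mem (sub_mem (sub_mem (neg_mem (one_mem E)) (weightedSumSq_le E hu))
      (mul_mem a.2 (weightedSumSq_le E hv))) hw
  subst hw0
  by_cases hv0 : v = 0
  · refine hE.1 ?_
    rw [h, hv0]
    simpa using hu
  · refine ha ?_
    have : -(a : A) = (1 ^ 2 + u) * v⁻¹ := by field_simp; linear_combination h
    rw [this]
    exact mul_mem_weightedSumSq (add_mem (sq_mem_weightedSumSq (one_mem E)) hu)
      (inv_mem_weightedSumSq hv)

/-- If both a and -a were weighted sums of squares, so would be -a · a · a⁻² = -1. -/
theorem isSquare_or_isSquare_neg [IsAlgClosed A] (a : E) : IsSquare a ∨ IsSquare (-a) := by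
  by_cases ha0 : a = 0
  · simp [ha0]
  by_cases h1 : -(a : A) ∈ weightedSumSq E
  · right
    refine isSquare_of_neg_notMem hE fun h2 => hE.1 ?_
    simp only [NegMemClass.coe_neg, neg_neg] at h2
    have ha0' : (a : A) ≠ 0 := by simpa using ha0
    have := mul_mem_weightedSumSq (mul_mem_weightedSumSq h1 h2)
      (sq_mem_weightedSumSq (E.inv_mem a.2))
    convert this using 1
    field_simp
  · exact Or.inl (isSquare_of_neg_notMem hE h1)

/-- The weights force this: if -c = e² with c > 0, then -1 = c⁻¹e² is a weighted square. Hence the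
squares of `E` induce the given order on `K`. -/
theorem isSquare_algebraMap [IsAlgClosed A] {c : K} (hc : 0 ≤ c) :
    IsSquare (algebraMap K E c) := by
  rcases isSquare_or_isSquare_neg hE (algebraMap K E c) with h | ⟨e, he⟩
  · exact h
  · rcases hc.eq_or_lt with rfl | hc
    · simp
    exfalso
    refine hE.1 ?_
    have h1 := mem_weightedSumSq (A := A) (inv_nonneg.2 hc.le) e.2
    have h2 := congrArg (algebraMap E A) he
    simp only [map_neg, map_mul, ← IsScalarTower.algebraMap_apply] at h2
    have h3 : algebraMap K A c ≠ 0 := by simpa using hc.ne'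
    convert h1 using 1
    rw [map_inv₀]
    field_simp
    rw [h2, sq]
    rfl

theorem isSemireal : IsSemireal E := by
  rw [isSemireal_iff_not_isSumSq_neg_one]
  intro h
  refine hE.1 ?_
  have key : ∀ s : E, IsSumSq s → (s : A) ∈ weightedSumSq E := by
    intro s hs
    induction hs with
    | zero => simp
    | sq_add a _ ih =>
      have := add_mem (sq_mem_weightedSumSq a.2) ih
      simpa [sq] using this
  simpa using key _ h

/-- Suppose f is irreducible of odd degree n and has a root θ outside `E`. Then -1 is a sum of
squares in E(θ), the weights being squares in `E`; so f divides some 1 + S, with S a sum of squares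
of degree at most 2(n - 1). The cofactor has odd degree below n, and a root of it contradicts
semireality. -/
theorem exists_isRoot_of_odd [IsAlgClosed A] (n : ℕ) :
    ∀ f : E[X], f.natDegree = n → Odd n → ∃ x, f.IsRoot x := by
  have := isSemireal hE
  induction n using Nat.strong_induction_on with
  | _ n ih =>
  intro f hfn hn
  have hf0 : f ≠ 0 := by rintro rfl; simp at hfn; simp [← hfn] at hn
  have hdpos : 0 < f.natDegree := by rw [hfn]; exact hn.pos
  by_cases hirr : Irreducible f
  · obtain ⟨θ, hθ⟩ := IsAlgClosed.exists_aeval_eq_zero A f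
      (degree_pos_of_irreducible hirr).ne'
    by_cases hθE : θ ∈ E
    · refine ⟨⟨θ, hθE⟩, ?_⟩
      have h1 : aeval (algebraMap E A ⟨θ, hθE⟩) f = 0 := hθ
      rw [aeval_algebraMap_apply] at h1
      simpa using h1
    exfalso
    have halg : IsAlgebraic E θ := ⟨f, hf0, hθ⟩
    have key : ∀ y ∈ weightedSumSq ((IntermediateField.adjoin E {θ}).restrictScalars K),
        ∃ S : E[X], IsSumSq S ∧ S.natDegree ≤ 2 * (n - 1) ∧ aeval θ S = y := by
      intro y hy
      induction hy using AddSubmonoid.closure_induction with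
      | mem y hy =>
        obtain ⟨c, hc, g, hg, rfl⟩ := hy
        obtain ⟨e, he⟩ := isSquare_algebraMap hE hc
        rw [IntermediateField.mem_restrictScalars, ← IntermediateField.mem_toSubalgebra,
          IntermediateField.adjoin_simple_toSubalgebra_of_isAlgebraic halg,
          Algebra.adjoin_singleton_eq_range_aeval] at hg
        obtain ⟨q, rfl⟩ := hg
        have hm : aeval θ (q % f) = aeval θ q := by
          conv_rhs => rw [← EuclideanDomain.div_add_mod q f]
          simp [hθ]
        have hd : (q % f).natDegree ≤ n - 1 := by
          have := natDegree_mod_lt q (by omega : f.natDegree ≠ 0)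
          omega
        refine ⟨(C e * (q % f)) * (C e * (q % f)), IsSumSq.mul_self _, ?_, ?_⟩
        · refine natDegree_mul_le.trans ?_
          have := natDegree_C_mul_le e (q % f)
          omega
        · have h2 := congrArg (algebraMap E A) he
          simp only [map_mul, ← IsScalarTower.algebraMap_apply] at h2
          change _ = algebraMap K A c * (aeval θ q) ^ 2
          rw [h2, ← hm, map_mul, map_mul, aeval_C]
          ring
      | zero => exact ⟨0, .zero, by simp, by simp⟩
      | add x y _ _ hx hy =>
        obtain ⟨S, h1, h2, rfl⟩ := hx
        obtain ⟨T, h1', h2', rfl⟩ := hy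
        exact ⟨S + T, h1.add h1', (natDegree_add_le _ _).trans (max_le h2 h2'), by simp⟩
    obtain ⟨S, hS, hSd, hSθ⟩ := key _ (neg_one_mem_of_notMem hE hθE)
    have hS1 : IsSumSq (1 + S) := by simpa using IsSumSq.sq_add (1 : E[X]) hS
    have hne : ∀ x, (1 + S).eval x ≠ 0 := fun x => by
      rw [eval_add, eval_one]
      exact IsSemireal.one_add_ne_zero (hS.eval x)
    have hS0 : 1 + S ≠ 0 := fun h => hne 0 (by simp [h])
    have hdvd : f ∣ 1 + S := by
      have h1 := (minpoly.irreducible halg.isIntegral).associated_of_dvd hirr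
        (minpoly.dvd E θ hθ)
      exact h1.dvd'.trans (minpoly.dvd E θ (by simp [hSθ]))
    obtain ⟨h, hh⟩ := hdvd
    have hh0 : h ≠ 0 := by rintro rfl; simp at hh; exact hS0 hh
    have hdeg : (1 + S).natDegree = f.natDegree + h.natDegree := by
      rw [hh, natDegree_mul hf0 hh0]
    have hle : (1 + S).natDegree ≤ 2 * (n - 1) :=
      (natDegree_add_le _ _).trans (by simpa using hSd)
    have hev := hS1.even_natDegree.1
    rw [hdeg, hfn] at hev
    have hodd : Odd h.natDegree := by
      rcases Nat.even_or_odd h.natDegree with h2 | h2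
      · exact absurd (hn.add_even h2) (by simpa using hev)
      · exact h2
    obtain ⟨x, hx⟩ := ih h.natDegree (by omega) h rfl hodd
    exact hne x (by rw [hh, eval_mul, hx.eq_zero, mul_zero])
  · have hu : ¬ IsUnit f := fun h => by simp [natDegree_eq_zero_of_isUnit h] at hdpos
    rw [irreducible_iff] at hirr
    push Not at hirr
    obtain ⟨a, b, rfl, ha, hb⟩ := hirr hu
    have ha0 := left_ne_zero_of_mul hf0
    have hb0 := right_ne_zero_of_mul hf0
    have hapos : 0 < a.natDegree := natDegree_pos_iff_degree_pos.2 (degree_pos_of_ne_zero_of_nonunit ha0 ha)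
    have hbpos : 0 < b.natDegree := natDegree_pos_iff_degree_pos.2 (degree_pos_of_ne_zero_of_nonunit hb0 hb)
    rw [natDegree_mul ha0 hb0] at hfn
    rcases Nat.even_or_odd a.natDegree with h | h
    · have hob : Odd b.natDegree := by
        rcases Nat.even_or_odd b.natDegree with h2 | h2
        · exact absurd (hfn ▸ h.add h2) (by simpa using hn)
        · exact h2
      obtain ⟨x, hx⟩ := ih _ (by omega) b rfl hob
      exact ⟨x, by simp [hx.eq_zero]⟩
    · obtain ⟨x, hx⟩ := ih _ (by omega) a rfl h
      exact ⟨x, by simp [hx.eq_zero]⟩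

end RealClosure

/-- Every ordered field has a real closure inside any of its algebraically closed extensions. -/
theorem exists_isRealClosed_intermediateField (K : Type*) [Field K] [LinearOrder K]
    [IsStrictOrderedRing K] (A : Type*) [Field A] [Algebra K A] [IsAlgClosed A] :
    ∃ E : IntermediateField K A, IsRealClosed E ∧ ∀ c : K, 0 ≤ c → IsSquare (algebraMap K E c) := by
  obtain ⟨E, hE⟩ := RealClosure.exists_maximal (K := K) (A := A)
  have := RealClosure.isSemireal hE
  exact ⟨E, ⟨RealClosure.isSquare_or_isSquare_neg hE,
    fun {f} hf => RealClosure.exists_isRoot_of_odd hE _ f rfl hf⟩,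
    fun c hc => RealClosure.isSquare_algebraMap hE hc⟩

/-! ### Extending order embeddings along algebraic extensions. -/

namespace RealClosure

/-- The Cauchy bound on roots. It shows that roots in an extension lie between elements of the base
field. -/
theorem exists_root_bound {F M : Type*} [Field F] [LinearOrder F] [IsStrictOrderedRing F]
    [Field M] [LinearOrder M] [IsStrictOrderedRing M] {j : F →+* M} (hj : StrictMono j)
    {q : F[X]} (hq : q ≠ 0) {m : M} (hm : (q.map j).eval m = 0) : ∃ B, 0 < B ∧ |m| < j B := by
  set n := q.natDegree with hn
  set S : F := ∑ i ∈ Finset.range n, |q.coeff i / q.leadingCoeff|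
  have hS : 0 ≤ S := Finset.sum_nonneg fun _ _ => abs_nonneg _
  refine ⟨S + 2, by linarith, ?_⟩
  have habs : ∀ x, j |x| = |j x| := fun x => by
    rcases le_total 0 x with h | h
    · rw [abs_of_nonneg h, abs_of_nonneg (by simpa using hj.monotone h)]
    · rw [abs_of_nonpos h, abs_of_nonpos (by simpa using hj.monotone h), map_neg]
  have hjS : 0 ≤ j S := by simpa using hj.monotone hS
  by_contra! hcon
  rw [map_add, map_ofNat] at hcon
  have hm1 : 1 ≤ |m| := by linarith
  have hm0 : 0 < |m| := by linarith
  have hl : q.leadingCoeff ≠ 0 := leadingCoeff_ne_zero.2 hq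
  have hl' : j q.leadingCoeff ≠ 0 := by simpa using hl
  have hn0 : n ≠ 0 := by
    intro h0
    rw [eq_C_of_natDegree_eq_zero (hn.symm.trans h0)] at hm
    rw [leadingCoeff, ← hn, h0] at hl'
    exact hl' (by simpa using hm)
  have h1 : m ^ n = -∑ i ∈ Finset.range n, j (q.coeff i / q.leadingCoeff) * m ^ i := by
    rw [eval_map, eval₂_eq_sum_range, Finset.sum_range_succ, ← hn] at hm
    have h2 : ∑ i ∈ Finset.range n, j (q.coeff i / q.leadingCoeff) * m ^ i =
        (∑ i ∈ Finset.range n, j (q.coeff i) * m ^ i) / j q.leadingCoeff := by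
      rw [Finset.sum_div]
      refine Finset.sum_congr rfl fun i _ => ?_
      rw [map_div₀]
      ring
    rw [h2]
    field_simp
    have : q.leadingCoeff = q.coeff n := rfl
    rw [this]
    linear_combination hm
  have h2 : |m| ^ n ≤ j S * |m| ^ (n - 1) := by
    rw [← abs_pow, h1, abs_neg]
    refine (Finset.abs_sum_le_sum_abs _ _).trans ?_
    simp only [S, map_sum, habs]
    rw [Finset.sum_mul]
    refine Finset.sum_le_sum fun i hi => ?_
    rw [abs_mul, abs_pow]
    have := Finset.mem_range.1 hi
    exact mul_le_mul_of_nonneg_left (pow_le_pow_right₀ hm1 (by omega)) (abs_nonneg _)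
  obtain ⟨k, hk⟩ := Nat.exists_eq_succ_of_ne_zero hn0
  rw [hk, Nat.succ_sub_one, pow_succ] at h2
  have h3 : 0 < |m| ^ k := pow_pos hm0 k
  nlinarith

variable {F R M : Type*} [Field F] [LinearOrder F] [IsStrictOrderedRing F]
  [Field R] [LinearOrder R] [IsStrictOrderedRing R] [IsRealClosed R]
  [Field M] [LinearOrder M] [IsStrictOrderedRing M] [IsRealClosed M]

theorem eval_map_mul {i : F →+* R} (q : F[X]) (a b : F) :
    (q.map i).eval (i a) * (q.map i).eval (i b) = i (q.eval a * q.eval b) := by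
  rw [eval_map, eval₂_at_apply, eval_map, eval₂_at_apply, map_mul]

/-- If all critical points of `q` are in the base field `F`, then every root of `q` outside of `F`
in one real closed extension has a counterpart in the same cut of `F` in any other one. -/
theorem exists_root_same_cut {i : F →+* R} {j : F →+* M} (hi : StrictMono i) (hj : StrictMono j)
    {q : F[X]} (hq : q ≠ 0)
    (hR : ∀ r, ((derivative q).map i).eval r = 0 → r ∈ Set.range i)
    (hM : ∀ r, ((derivative q).map j).eval r = 0 → r ∈ Set.range j)
    {m : M} (hm : (q.map j).eval m = 0) (hmF : m ∉ Set.range j) :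
    ∃ r, (q.map i).eval r = 0 ∧ r ∉ Set.range i ∧ ∀ c, i c < r ↔ j c < m := by
  classical
  have hmF' : ∀ c, j c ≠ m := fun c h => hmF ⟨c, h⟩
  have hq' : derivative q ≠ 0 := fun h => hmF (hM m (by simp [h]))
  obtain ⟨B, hB0, hB⟩ := exists_root_bound hj hq hm
  rw [abs_lt, ← map_neg] at hB
  -- The two points c < d of `S` adjacent to m have no critical point of q between them, so q
  -- changes sign exactly once there, in both extensions.
  let S : Finset F := insert (-B) (insert B (derivative q).roots.toFinset)
  have hlo : (S.filter fun s => j s < m).Nonempty := ⟨-B, Finset.mem_filter.2 ⟨by simp [S], hB.1⟩⟩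
  have hhi : (S.filter fun s => m < j s).Nonempty := ⟨B, Finset.mem_filter.2 ⟨by simp [S], hB.2⟩⟩
  obtain ⟨c, hc⟩ : ∃ c, c = (S.filter fun s => j s < m).max' hlo := ⟨_, rfl⟩
  obtain ⟨d, hd⟩ : ∃ d, d = (S.filter fun s => m < j s).min' hhi := ⟨_, rfl⟩
  have hcm : j c < m := by
    have := (S.filter fun s => j s < m).max'_mem hlo
    rw [← hc] at this
    exact (Finset.mem_filter.1 this).2
  have hmd : m < j d := by
    have := (S.filter fun s => m < j s).min'_mem hhi
    rw [← hd] at this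
    exact (Finset.mem_filter.1 this).2
  have hcd : c < d := hj.lt_iff_lt.1 (hcm.trans hmd)
  have hcrit : ∀ e, c < e → e < d → (derivative q).eval e ≠ 0 := by
    intro e h1 h2 h0
    have heS : e ∈ S := by simp [S, hq', h0]
    rcases lt_or_gt_of_ne (hmF' e) with h | h
    · exact h1.not_ge (hc ▸ Finset.le_max' _ _ (by simp [heS, h]))
    · exact h2.not_ge (hd ▸ Finset.min'_le _ _ (by simp [heS, h]))
  have hcritM : ∀ t, j c < t → t < j d → ((derivative q).map j).eval t ≠ 0 := by
    intro t h1 h2 h0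
    obtain ⟨e, rfl⟩ := hM t h0
    rw [eval_map, eval₂_at_apply, map_eq_zero] at h0
    exact hcrit e (hj.lt_iff_lt.1 h1) (hj.lt_iff_lt.1 h2) h0
  have hcritR : ∀ t, i c < t → t < i d → ((derivative q).map i).eval t ≠ 0 := by
    intro t h1 h2 h0
    obtain ⟨e, rfl⟩ := hR t h0
    rw [eval_map, eval₂_at_apply, map_eq_zero] at h0
    exact hcrit e (hi.lt_iff_lt.1 h1) (hi.lt_iff_lt.1 h2) h0
  have huM : ∀ t, j c ≤ t → t ≤ j d → (q.map j).eval t = 0 → t = m := by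
    intro t h1 h2 h0
    by_contra hne
    have hqj : q.map j ≠ 0 := Polynomial.map_ne_zero hq
    rcases lt_or_gt_of_ne hne with h | h
    · obtain ⟨s, hs1, hs2, hs3⟩ := IsRealClosed.exists_derivative_root hqj h h0 hm
      rw [derivative_map] at hs3
      exact hcritM s (h1.trans_lt hs1) (hs2.trans hmd) hs3
    · obtain ⟨s, hs1, hs2, hs3⟩ := IsRealClosed.exists_derivative_root hqj h hm h0
      rw [derivative_map] at hs3
      exact hcritM s (hcm.trans hs1) (hs2.trans_le h2) hs3
  have hneg : q.eval c * q.eval d < 0 := by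
    have := IsRealClosed.eval_mul_eval_neg_of_unique_root hcm hmd hm
      (by rw [derivative_map]; exact hcritM m hcm hmd) huM
    rw [eval_map_mul, ← map_zero j, hj.lt_iff_lt] at this
    exact this
  obtain ⟨r, hcr, hrd, hr⟩ := IsRealClosed.exists_root_of_eval_mul_eval_neg (p := q.map i)
    (hi hcd).le (by rwa [eval_map_mul, ← map_zero i, hi.lt_iff_lt])
  have huR : ∀ t, i c ≤ t → t ≤ i d → (q.map i).eval t = 0 → t = r := by
    intro t h1 h2 h0
    by_contra hne
    have hqi : q.map i ≠ 0 := Polynomial.map_ne_zero hq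
    rcases lt_or_gt_of_ne hne with h | h
    · obtain ⟨s, hs1, hs2, hs3⟩ := IsRealClosed.exists_derivative_root hqi h h0 hr
      rw [derivative_map] at hs3
      exact hcritR s (h1.trans_lt hs1) (hs2.trans hrd) hs3
    · obtain ⟨s, hs1, hs2, hs3⟩ := IsRealClosed.exists_derivative_root hqi h hr h0
      rw [derivative_map] at hs3
      exact hcritR s (hcr.trans hs1) (hs2.trans_le h2) hs3
  have hFne : ∀ e, c ≤ e → e ≤ d → q.eval e ≠ 0 := by
    intro e h1 h2 h0
    exact hmF' e (huM _ (hj.monotone h1) (hj.monotone h2) (by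
      rw [eval_map, eval₂_at_apply, h0, map_zero]))
  have hrF' : ∀ e, i e ≠ r := by
    rintro e rfl
    rw [eval_map, eval₂_at_apply, map_eq_zero] at hr
    exact hFne e (hi.lt_iff_lt.1 hcr).le (hi.lt_iff_lt.1 hrd).le hr
  refine ⟨r, hr, fun ⟨e, he⟩ => hrF' e he, fun e => ?_⟩
  have hposR : ∀ s t, c ≤ s → s ≤ t → t ≤ d → (r < i s ∨ i t < r) → 0 < q.eval s * q.eval t := by
    intro s t h1 h2 h3 h
    have := IsRealClosed.eval_mul_eval_pos (p := q.map i) (hi.monotone h2) (by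
      intro x hx1 hx2 h0
      have := huR x ((hi.monotone h1).trans hx1) (hx2.trans (hi.monotone h3)) h0
      subst this
      rcases h with h | h
      · exact absurd hx1 h.not_ge
      · exact absurd hx2 h.not_ge)
    rwa [eval_map_mul, ← map_zero i, hi.lt_iff_lt] at this
  have hposM : ∀ s t, c ≤ s → s ≤ t → t ≤ d → (m < j s ∨ j t < m) → 0 < q.eval s * q.eval t := by
    intro s t h1 h2 h3 h
    have := IsRealClosed.eval_mul_eval_pos (p := q.map j) (hj.monotone h2) (by
      intro x hx1 hx2 h0
      have := huM x ((hj.monotone h1).trans hx1) (hx2.trans (hj.monotone h3)) h0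
      subst this
      rcases h with h | h
      · exact absurd hx1 h.not_ge
      · exact absurd hx2 h.not_ge)
    rwa [eval_map_mul, ← map_zero j, hj.lt_iff_lt] at this
  -- The sign of q at a point e between c and d tells on which side of the root e lies. This sign is
  -- computed in `F`, so the answer is the same in `R` and `M`.
  have hcomb : 0 < q.eval c * q.eval e → 0 < q.eval e * q.eval d → False := by
    intro h1 h2
    have h3 := mul_pos h1 h2
    have h4 : q.eval c * q.eval e * (q.eval e * q.eval d) =
      q.eval c * q.eval d * (q.eval e) ^ 2 := by ring
    rw [h4] at h3
    nlinarith [sq_nonneg (q.eval e)]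
  rcases le_or_gt e c with hec | hec
  · exact iff_of_true ((hi.monotone hec).trans_lt hcr) ((hj.monotone hec).trans_lt hcm)
  rcases le_or_gt d e with hde | hde
  · exact iff_of_false (hrd.trans_le (hi.monotone hde)).not_gt
      (hmd.trans_le (hj.monotone hde)).not_gt
  constructor
  · intro h
    by_contra hcon
    have hcon := lt_of_le_of_ne (not_lt.1 hcon) (hmF' e).symm
    exact hcomb (hposR c e le_rfl hec.le hde.le (Or.inr h)) (hposM e d hec.le hde.le le_rfl (Or.inl hcon))
  · intro h
    by_contra hcon
    have hcon := lt_of_le_of_ne (not_lt.1 hcon) (hrF' e).symm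
    exact hcomb (hposM c e le_rfl hec.le hde.le (Or.inr h)) (hposR e d hec.le hde.le le_rfl (Or.inl hcon))

/-- No root of g separates a from e, so g has the same sign at both: signs of values at a can be
read off inside `F`. -/
theorem eval_mul_eval_pos_of_same_cut {i : F →+* R} (hi : StrictMono i) {g : F[X]}
    (hg : ∀ r, (g.map i).eval r = 0 → r ∈ Set.range i) {a : R} (ha : a ∉ Set.range i) {e : F}
    (he : ∀ s, g.eval s = 0 → s ≠ e ∧ (s < e ↔ i s < a)) :
    0 < (g.map i).eval a * (g.map i).eval (i e) := by
  have key : ∀ r, (g.map i).eval r = 0 → (r < i e ↔ r < a) ∧ r ≠ i e ∧ r ≠ a := by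
    intro r h0
    obtain ⟨s, rfl⟩ := hg r h0
    rw [eval_map, eval₂_at_apply, map_eq_zero] at h0
    obtain ⟨h1, h2⟩ := he s h0
    exact ⟨by rw [hi.lt_iff_lt, h2], hi.injective.ne h1, fun h => ha ⟨s, h⟩⟩
  rcases le_total a (i e) with h | h
  · refine IsRealClosed.eval_mul_eval_pos h fun r h1 h2 h0 => ?_
    obtain ⟨k1, k2, k3⟩ := key r h0
    exact (k1.1 (lt_of_le_of_ne h2 k2)).not_ge h1
  · rw [mul_comm]
    refine IsRealClosed.eval_mul_eval_pos h fun r h1 h2 h0 => ?_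
    obtain ⟨k1, k2, k3⟩ := key r h0
    exact (k1.2 (lt_of_le_of_ne h2 k3)).not_ge h1

/-- By induction on the degree the critical points lie in `F`; a root in `M` outside `F` would then
have a counterpart in `R` outside `F`. -/
theorem mem_range_of_root_of_natDegree_lt {i : F →+* R} {j : F →+* M} (hi : StrictMono i)
    (hj : StrictMono j) {n : ℕ}
    (hR : ∀ q : F[X], q ≠ 0 → q.natDegree < n → ∀ r, (q.map i).eval r = 0 → r ∈ Set.range i)
    (q : F[X]) (hq : q ≠ 0) (hqn : q.natDegree < n) (m : M) (hm : (q.map j).eval m = 0) :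
    m ∈ Set.range j := by
  induction hk : q.natDegree using Nat.strong_induction_on generalizing q m with
  | _ k ih =>
  have hk0 : q.natDegree ≠ 0 := by
    intro h0
    rw [eq_C_of_natDegree_eq_zero h0] at hm hq
    simp only [map_C, eval_C, map_eq_zero] at hm
    exact hq (by rw [hm, C_0])
  have hq' : derivative q ≠ 0 := by
    intro h
    exact hk0 (derivative_eq_zero.1 h)
  have hlt := natDegree_derivative_lt hk0
  by_contra hmF
  obtain ⟨r, h1, h2, -⟩ := exists_root_same_cut hi hj hq (hR _ hq' (hlt.trans hqn))
    (fun r hr => ih _ (hk ▸ hlt) _ hq' (hlt.trans hqn) r hr rfl) hm hmF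
  exact h2 (hR q hq hqn r h1)

/-- A simple extension step for embeddings into real closed fields. -/
theorem exists_root_sameSign {i : F →+* R} {j : F →+* M} (hi : StrictMono i) (hj : StrictMono j)
    {p : F[X]} (hp : p.natDegree ≠ 0)
    (hR : ∀ q : F[X], q ≠ 0 → q.natDegree < p.natDegree →
      ∀ r, (q.map i).eval r = 0 → r ∈ Set.range i)
    {a : R} (ha : (p.map i).eval a = 0) (haF : a ∉ Set.range i) :
    ∃ m : M, (p.map j).eval m = 0 ∧ ∀ g : F[X], g.natDegree < p.natDegree →
      0 ≤ (g.map i).eval a → 0 ≤ (g.map j).eval m := by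
  classical
  have hM := mem_range_of_root_of_natDegree_lt hi hj hR
  have hp0 : p ≠ 0 := by rintro rfl; simp at hp
  have hp' : derivative p ≠ 0 := fun h => hp (derivative_eq_zero.1 h)
  have hlt := natDegree_derivative_lt hp
  obtain ⟨m, hm, hmF, hcut⟩ := exists_root_same_cut hj hi hp0 (hM _ hp' hlt) (hR _ hp' hlt) ha haF
  refine ⟨m, hm, fun g hgd hg => ?_⟩
  rcases eq_or_ne g 0 with rfl | hg0
  · simp
  -- The roots of g all lie in `F`; choose e in `F` on the same side of each of them as a, hence
  -- also as m.
  obtain ⟨e, he1, he2⟩ := Order.exists_between_finsets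
    (lo := g.roots.toFinset.filter fun s => i s < a)
    (hi := g.roots.toFinset.filter fun s => ¬ i s < a) (by
      intro x hx y hy
      simp only [Finset.mem_filter] at hx hy
      exact hi.lt_iff_lt.1 (hx.2.trans_le (not_lt.1 hy.2)))
  have he : ∀ s, g.eval s = 0 → s ≠ e ∧ (s < e ↔ i s < a) := by
    intro s hs
    by_cases h : i s < a
    · have := he1 s (by simp [hg0, hs, h])
      exact ⟨this.ne, iff_of_true this h⟩
    · have := he2 s (by simp only [Finset.mem_filter]; simp [hg0, hs, not_lt.1 h])
      exact ⟨this.ne', iff_of_false this.not_gt h⟩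
  have h1 := eval_mul_eval_pos_of_same_cut hi (hR g hg0 hgd) haF he
  have h2 := eval_mul_eval_pos_of_same_cut hj (hM g hg0 hgd) hmF
    (fun s hs => ⟨(he s hs).1, by rw [(he s hs).2, hcut]⟩)
  have h3 : 0 < (g.map i).eval (i e) := pos_of_mul_pos_right h1 hg
  rw [eval_map, eval₂_at_apply, ← map_zero i, hi.lt_iff_lt] at h3
  have h4 : 0 < (g.map j).eval (j e) := by
    rw [eval_map, eval₂_at_apply, ← map_zero j, hj.lt_iff_lt]
    exact h3
  exact (pos_of_mul_pos_left h2 h4.le).le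

end RealClosure

open IntermediateField in
/-- A positive homomorphism from a field to a real closed field `M` extends to every real closed
field that is algebraic over the domain. -/
theorem exists_extension_of_isAlgebraic {F₀ R M : Type*} [Field F₀]
    [Field R] [LinearOrder R] [IsStrictOrderedRing R] [IsRealClosed R]
    [Field M] [LinearOrder M] [IsStrictOrderedRing M] [IsRealClosed M]
    [Algebra F₀ R] [Algebra.IsAlgebraic F₀ R] (j : F₀ →+* M)
    (hj : ∀ c, 0 ≤ algebraMap F₀ R c → 0 ≤ j c) :
    ∃ ψ : R →+* M, ∀ c, ψ (algebraMap F₀ R c) = j c := by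
  let := j.toAlgebra
  obtain ⟨l, -, hl⟩ := zorn_le_nonempty₀
    {l : Lifts F₀ R M | ∀ x : l.carrier, 0 ≤ (x : R) → 0 ≤ l.emb x}
    (fun c hc hchain l₀ hl₀ => by
      refine ⟨Lifts.union c hchain, ?_, Lifts.le_union c hchain⟩
      rintro ⟨x, hx⟩ hx0
      have hx' := hx
      have : Nonempty c := ⟨⟨l₀, hl₀⟩⟩
      have hdir : Directed (· ≤ ·) fun i : c => i.1.carrier :=
        hchain.directedOn.directed_val.mono_comp _ fun _ _ h => h.1
      rw [Lifts.carrier_union, ← SetLike.mem_coe, coe_iSup_of_directed hdir] at hx'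
      obtain ⟨l, hxl⟩ := Set.mem_iUnion.1 hx'
      have h1 := (Lifts.le_union c hchain l.2).2 ⟨x, hxl⟩
      exact (hc l.2 ⟨x, hxl⟩ hx0).trans_eq h1.symm) ⊥ (by
      rintro ⟨x, hx⟩ hx0
      obtain ⟨c, rfl⟩ := mem_bot.1 hx
      have : (⊥ : Lifts F₀ R M).emb ⟨algebraMap F₀ R c, hx⟩ = j c :=
        (⊥ : Lifts F₀ R M).emb.commutes c
      rw [this]
      exact hj c hx0)
  have hmono : StrictMono l.emb := by
    refine (monotone_iff_map_nonneg l.emb).2 (fun x hx => hl.1 x hx) |>.strictMono_of_injective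
      l.emb.injective
  suffices htop : l.carrier = ⊤ by
    refine ⟨(l.emb.comp (inclusion htop.ge)).toRingHom.comp (topEquiv (F := F₀) (E := R)).symm, fun c => ?_⟩
    simp
    rfl
  by_contra hne
  obtain ⟨a₀, ha₀⟩ : ∃ a, a ∉ l.carrier := by
    by_contra! h
    exact hne (eq_top_iff.2 fun x _ => h x)
  let F := l.carrier
  -- Minimality of the degree of a ensures that all roots in `R` of polynomials of smaller degree
  -- already lie in `F`, as `exists_root_sameSign` requires.
  obtain ⟨a, ha, hmin⟩ : ∃ a, a ∉ F ∧ ∀ b, b ∉ F →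
      (minpoly F a).natDegree ≤ (minpoly F b).natDegree := by
    let n := sInf {n | ∃ a, a ∉ F ∧ (minpoly F a).natDegree = n}
    obtain ⟨a, ha, han⟩ := Nat.sInf_mem
      (s := {n | ∃ a, a ∉ F ∧ (minpoly F a).natDegree = n}) ⟨_, a₀, ha₀, rfl⟩
    exact ⟨a, ha, fun b hb => han ▸ Nat.sInf_le ⟨b, hb, rfl⟩⟩
  have hint : ∀ x : R, IsIntegral F x := fun x =>
    (Algebra.IsIntegral.isIntegral (R := F₀) x).tower_top
  obtain ⟨m, hm, hsign⟩ := RealClosure.exists_root_sameSign (i := algebraMap F R)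
    (j := l.emb.toRingHom) (p := minpoly F a) (Subtype.strictMono_coe _) hmono
    (minpoly.natDegree_pos (hint a)).ne'
    (fun q hq hqd r hr => by
      by_contra hrF
      have h1 := hmin r (fun h => hrF ⟨⟨r, h⟩, rfl⟩)
      have h2 := natDegree_le_of_dvd (minpoly.dvd F r (by rwa [aeval_def, ← eval_map])) hq
      omega) (a := a) (by rw [eval_map, ← aeval_def, minpoly.aeval])
      (fun ⟨x, hx⟩ => ha (hx ▸ x.2))
  let := l.emb.toRingHom.toAlgebra
  have : IsScalarTower F₀ F M := IsScalarTower.of_algebraMap_eq fun c => (l.emb.commutes c).symm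
  let φ : F⟮a⟯ →ₐ[F] M := (algHomAdjoinIntegralEquiv F (hint a)).symm ⟨m, by
    rw [mem_aroots]
    exact ⟨minpoly.ne_zero (hint a), by rw [aeval_def, ← eval_map]; exact hm⟩⟩
  have hφ : φ (AdjoinSimple.gen F a) = m := algHomAdjoinIntegralEquiv_symm_apply_gen F (hint a) _
  let l' : Lifts F₀ R M := ⟨F⟮a⟯.restrictScalars F₀, φ.restrictScalars F₀⟩
  have hle : l ≤ l' := ⟨fun x hx => F⟮a⟯.algebraMap_mem ⟨x, hx⟩, fun x => φ.commutes x⟩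
  have hl' : ∀ x : l'.carrier, 0 ≤ (x : R) → 0 ≤ l'.emb x := by
    intro x hx
    have hx2 : (x : R) ∈ F⟮a⟯ := x.2
    rw [← mem_toSubalgebra, adjoin_simple_toSubalgebra_of_isAlgebraic (hint a).isAlgebraic,
      Algebra.adjoin_singleton_eq_range_aeval] at hx2
    obtain ⟨g, hg⟩ := hx2
    -- Reducing modulo the minimal polynomial brings the degree into the range where the choice of m
    -- preserves signs.
    let g' := g %ₘ minpoly F a
    have hg' : aeval a g' = x := by
      rw [← hg]; exact aeval_modByMonic_eq_self_of_root (minpoly.aeval F a)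
    have hxg : (x : F⟮a⟯) = aeval (AdjoinSimple.gen F a) g' := by
      apply Subtype.ext
      rw [← hg']
      simp
    have h1 : l'.emb x = (g'.map l.emb.toRingHom).eval m := by
      change φ x = _
      rw [hxg, ← hφ, eval_map, ← aeval_algHom_apply]
      rfl
    rw [h1]
    refine hsign g' ?_ ?_
    · exact natDegree_modByMonic_lt _ (minpoly.monic (hint a)) (minpoly.ne_one F a)
    · rw [eval_map, ← aeval_def, hg']; exact hx
  have := (hl.2 hl' hle).1
  exact ha (this (mem_adjoin_simple_self F a))

/-! ### Long monotone sequences in linear orders. -/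

/-- The initial well-order of cardinality `ν⁺`. -/
abbrev SuccOrd (ν : Cardinal.{u}) : Type u := (Order.succ ν).ord.ToType

/-- There is no strictly monotone and no strictly antitone sequence of length `ν⁺` in `X`. -/
def NoLongChain (ν : Cardinal.{u}) (X : Type u) [LinearOrder X] : Prop :=
  (∀ f : SuccOrd ν → X, ¬ StrictMono f) ∧ ∀ f : SuccOrd ν → X, ¬ StrictAnti f

theorem NoLongChain.dual {ν : Cardinal.{u}} {X : Type u} [LinearOrder X] (h : NoLongChain ν X) :
    NoLongChain ν Xᵒᵈ :=
  ⟨fun f hf => h.2 (OrderDual.ofDual ∘ f) fun _ _ hab => hf hab,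
    fun f hf => h.1 (OrderDual.ofDual ∘ f) fun _ _ hab => hf hab⟩

namespace SuccOrd

variable {ν : Cardinal.{u}}

theorem mk_eq : #(SuccOrd ν) = Order.succ ν := Cardinal.mk_ord_toType _

theorem exists_forall_lt (hν : ℵ₀ ≤ ν) {s : Set (SuccOrd ν)} (hs : #s ≤ ν) :
    ∃ b, ∀ x ∈ s, x < b := by
  rw [← not_isCofinal_iff]
  intro h
  have h1 := Order.cof_le h
  rw [Ordinal.cof_toType, (Cardinal.isRegular_succ hν).cof_ord, Order.succ_le_iff] at h1
  exact h1.not_ge hs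

theorem exists_forall_range_lt (hν : ℵ₀ ≤ ν) {ι : Type u} (hι : #ι ≤ ν) (f : ι → SuccOrd ν) :
    ∃ b, ∀ x, f x < b := by
  obtain ⟨b, hb⟩ := exists_forall_lt hν (s := Set.range f) (Cardinal.mk_range_le.trans hι)
  exact ⟨b, fun x => hb _ ⟨x, rfl⟩⟩

theorem exists_nat_lt (hν : ℵ₀ ≤ ν) (f : ℕ → SuccOrd ν) : ∃ b, ∀ x, f x < b := by
  obtain ⟨b, hb⟩ := exists_forall_lt hν (s := Set.range f)
    ((Cardinal.le_aleph0_iff_set_countable.2 (Set.countable_range f)).trans hν)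
  exact ⟨b, fun x => hb _ ⟨x, rfl⟩⟩

theorem exists_lt_lt (hν : ℵ₀ ≤ ν) (i j : SuccOrd ν) : ∃ b, i < b ∧ j < b := by
  obtain ⟨b, hb⟩ := exists_forall_lt hν (s := {i, j})
    ((Cardinal.le_aleph0_iff_set_countable.2 (Set.toFinite _).countable).trans hν)
  exact ⟨b, hb i (by simp), hb j (by simp)⟩

theorem mk_Iio_le (i : SuccOrd ν) : #(Set.Iio i) ≤ ν :=
  Order.lt_succ_iff.1 ((Cardinal.mk_Iio_lt i (by
    rw [Cardinal.mk_ord_toType, Ordinal.type_toType])).trans_eq mk_eq)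

/-- Sequences of length `ν⁺` can be constructed if each small set can be surpassed. -/
theorem exists_seq {A : Type u} {R : A → A → Prop}
    (h : ∀ s : Set A, #s ≤ ν → ∃ b, ∀ x ∈ s, R x b) :
    ∃ g : SuccOrd ν → A, ∀ i j, i < j → R (g i) (g j) := by
  choose b hb using h
  let F : ∀ i : SuccOrd ν, (∀ j, j < i → A) → A := fun i g =>
    b (Set.range fun j : Set.Iio i => g j.1 j.2) (Cardinal.mk_range_le.trans (mk_Iio_le i))
  refine ⟨wellFounded_lt.fix F, fun i j hij => ?_⟩
  rw [wellFounded_lt.fix_eq F j]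
  exact hb _ _ _ ⟨⟨i, hij⟩, rfl⟩

/-- A monotone sequence that never stabilizes has a strictly increasing subsequence of full length,
by regularity of ν⁺. -/
theorem eventually_const_of_monotone (hν : ℵ₀ ≤ ν) {X : Type u} [LinearOrder X]
    (hX : ∀ f : SuccOrd ν → X, ¬ StrictMono f) {f : SuccOrd ν → X} (hf : Monotone f) :
    ∃ i₀, ∀ i, i₀ ≤ i → f i = f i₀ := by
  by_contra! h
  have h' : ∀ i, ∃ k, f i < f k := fun i => by
    obtain ⟨k, hk, hne⟩ := h i
    exact ⟨k, lt_of_le_of_ne (hf hk) hne.symm⟩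
  choose nx hnx using h'
  obtain ⟨g, hg⟩ := exists_seq (ν := ν) (R := fun x y => f x < f y) (fun s hs => by
    obtain ⟨b, hb⟩ := exists_forall_range_lt hν hs fun x : s => nx x
    exact ⟨b, fun x hx => (hnx x).trans_le (hf (hb ⟨x, hx⟩).le)⟩)
  exact hX (f ∘ g) fun i j hij => hg i j hij

theorem eventually_const_of_antitone (hν : ℵ₀ ≤ ν) {X : Type u} [LinearOrder X]
    (hX : ∀ f : SuccOrd ν → X, ¬ StrictAnti f) {f : SuccOrd ν → X} (hf : Antitone f) :
    ∃ i₀, ∀ i, i₀ ≤ i → f i = f i₀ := by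
  have h1 : ∀ g : SuccOrd ν → Xᵒᵈ, ¬ StrictMono g := fun g hg =>
    hX (OrderDual.ofDual ∘ g) fun _ _ hij => hg hij
  have h2 : Monotone (OrderDual.toDual ∘ f) := fun _ _ hij => hf hij
  exact eventually_const_of_monotone hν h1 h2

/-- If every fibre were bounded, the countably many bounds would have a common bound in ν⁺. -/
theorem exists_unbounded_fiber (hν : ℵ₀ ≤ ν) (c : SuccOrd ν → ℕ) (i₀ : SuccOrd ν) :
    ∃ n, ∀ b, ∃ i, i₀ ≤ i ∧ b ≤ i ∧ c i = n := by
  by_contra! h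
  choose b hb using h
  obtain ⟨k, hk⟩ := exists_nat_lt hν b
  obtain ⟨l, hl, hl'⟩ := exists_lt_lt hν k i₀
  exact hb (c l) l hl'.le ((hk _).le.trans hl.le) rfl

end SuccOrd

/-! ### From archimedean classes to the ordered group. -/

section Lift

variable {ν : Cardinal.{u}} {A : Type u} [AddCommGroup A] [LinearOrder A] [IsOrderedAddMonoid A]

/-- For fixed i the class of f j - f i is antitone in j and becomes constant from some J i on; these
eventual classes are monotone in i, hence constant from some i₀ on. With u = f (J i₀) - f i₀, one n
satisfies u ≤ n(f (J i) - f i) for unboundedly many i. Stacking such steps makes n(f i - f i₀)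
exceed every multiple of u, at indices with a common bound, although differences f j - f i₀ with j
beyond J i₀ stay in the class of u. -/
theorem not_strictMono_of_archimedeanClass (hν : ℵ₀ ≤ ν) (h : NoLongChain ν (ArchimedeanClass A))
    (f : SuccOrd ν → A) : ¬ StrictMono f := by
  intro hf
  have hanti : ∀ i, Antitone fun j => ArchimedeanClass.mk (f (max i j) - f i) := by
    intro i j k hjk
    refine ArchimedeanClass.mk_antitoneOn ?_ ?_ ?_
    · exact sub_nonneg.2 (hf.monotone (le_max_left _ _))
    · exact sub_nonneg.2 (hf.monotone (le_max_left _ _))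
    · exact sub_le_sub_right (hf.monotone (max_le_max le_rfl hjk)) _
  have h1 : ∀ i, ∃ J, i < J ∧ ∀ j, J ≤ j →
      ArchimedeanClass.mk (f j - f i) = ArchimedeanClass.mk (f J - f i) := by
    intro i
    obtain ⟨J, hJ⟩ := SuccOrd.eventually_const_of_antitone hν h.2 (hanti i)
    obtain ⟨J', hJ1, hJ2⟩ := SuccOrd.exists_lt_lt hν i J
    refine ⟨J', hJ1, fun j hj => ?_⟩
    have k1 := hJ j (hJ2.le.trans hj)
    have k2 := hJ J' hJ2.le
    simp only [max_eq_right (hJ1.le.trans hj), max_eq_right hJ1.le] at k1 k2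
    rw [k1, k2]
  choose J hJi hJ using h1
  have hmono : Monotone fun i => ArchimedeanClass.mk (f (J i) - f i) := by
    intro i k hik
    obtain ⟨j, hj1, hj2⟩ := SuccOrd.exists_lt_lt hν (J i) (J k)
    simp only
    rw [← hJ i j hj1.le, ← hJ k j hj2.le]
    refine ArchimedeanClass.mk_antitoneOn ?_ ?_ (sub_le_sub_left (hf.monotone hik) _)
    · exact sub_nonneg.2 (hf.monotone ((hJi k).le.trans hj2.le))
    · exact sub_nonneg.2 (hf.monotone ((hJi i).le.trans hj1.le))
  obtain ⟨i₀, hi₀⟩ := SuccOrd.eventually_const_of_monotone hν h.1 hmono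
  set u := f (J i₀) - f i₀ with hu
  have hu0 : 0 < u := sub_pos.2 (hf (hJi i₀))
  have h2 : ∀ i, ∃ n : ℕ, i₀ ≤ i → u ≤ n • (f (J i) - f i) := by
    intro i
    by_cases hi : i₀ ≤ i
    · obtain ⟨n, hn⟩ := ArchimedeanClass.mk_le_mk.1 (hi₀ i hi).le
      rw [abs_of_pos hu0, abs_of_pos (sub_pos.2 (hf (hJi i)))] at hn
      exact ⟨n, fun _ => hn⟩
    · exact ⟨0, fun h => absurd h hi⟩
  choose c hc using h2
  obtain ⟨n, hn⟩ := SuccOrd.exists_unbounded_fiber hν c i₀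
  have h3 : ∀ m : ℕ, ∃ i, i₀ ≤ i ∧ m • u ≤ n • (f i - f i₀) := by
    intro m
    induction m with
    | zero => exact ⟨i₀, le_rfl, by simp⟩
    | succ m ih =>
      obtain ⟨i, hi, him⟩ := ih
      obtain ⟨k, hk1, hk2, hk3⟩ := hn i
      refine ⟨J k, hk1.trans (hJi k).le, ?_⟩
      have k1 := hc k hk1
      rw [hk3] at k1
      calc (m + 1) • u = m • u + u := succ_nsmul u m
        _ ≤ n • (f i - f i₀) + n • (f (J k) - f k) := add_le_add him k1
        _ ≤ n • (f k - f i₀) + n • (f (J k) - f k) := by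
          gcongr
          exact hf.monotone hk2
        _ = n • (f (J k) - f i₀) := by rw [← nsmul_add]; congr 1; abel
  choose g hg0 hg using h3
  obtain ⟨b, hb⟩ := SuccOrd.exists_nat_lt hν g
  obtain ⟨b', hb', hbJ⟩ := SuccOrd.exists_lt_lt hν b (J i₀)
  obtain ⟨N, hN⟩ := ArchimedeanClass.mk_le_mk.1 (hJ i₀ b' hbJ.le).ge
  rw [← hu, abs_of_pos hu0, abs_of_pos (sub_pos.2 (hf ((hJi i₀).trans hbJ)))] at hN
  have h4 : (n * N + 1) • u ≤ (n * N) • u := by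
    refine (hg _).trans ?_
    rw [mul_nsmul']
    gcongr
    refine le_trans ?_ hN
    exact sub_le_sub_right (hf.monotone ((hb _).trans hb').le) _
  rw [succ_nsmul] at h4
  exact absurd h4 (not_le.2 (lt_add_of_pos_right _ hu0))

/-- If the archimedean classes of an ordered group admit no long chains, then neither does the
group. -/
theorem NoLongChain.of_archimedeanClass (hν : ℵ₀ ≤ ν) (h : NoLongChain ν (ArchimedeanClass A)) :
    NoLongChain ν A :=
  ⟨not_strictMono_of_archimedeanClass hν h, fun f hf =>
    not_strictMono_of_archimedeanClass hν h (fun i => -f i) fun _ _ hab => neg_lt_neg (hf hab)⟩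

end Lift

/-! ### A linear order without long chains is small. -/

section Hausdorff

variable {ν : Cardinal.{u}} {X : Type u} [LinearOrder X]

/-- On such a set the given order is itself a well-order, so more than ν elements would yield an
increasing sequence of length ν⁺. -/
theorem mk_le_of_lt_imp_wellOrderingRel (hX : ∀ f : SuccOrd ν → X, ¬ StrictMono f) (s : Set X)
    (hs : ∀ x ∈ s, ∀ y ∈ s, x < y → WellOrderingRel x y) : #s ≤ ν := by
  have hwf : WellFoundedLT s := by
    have h1 : WellFounded (InvImage (WellOrderingRel (α := X)) (Subtype.val : s → X)) :=
      InvImage.wf _ WellOrderingRel.isWellOrder.wf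
    exact ⟨Subrelation.wf (fun {a b} hab => hs a a.2 b b.2 hab) h1⟩
  by_contra! hcon
  have h1 : Ordinal.type (α := SuccOrd ν) (· < ·) ≤ Ordinal.type (α := s) (· < ·) := by
    rw [Ordinal.type_toType, Cardinal.ord_le, Ordinal.card_type]
    exact Order.succ_le_of_lt hcon
  obtain ⟨g⟩ := Ordinal.type_le_iff'.1 h1
  exact hX (fun i => (g i : X)) fun i j hij => g.map_rel_iff.2 hij

/-- `y` is an ancestor of `x` in the binary search tree given by a fixed well-ordering. -/
def IsAncestor (y x : X) : Prop := ∀ z ∈ Set.uIcc x y, ¬ WellOrderingRel z y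

theorem IsAncestor.rel_of_ne {y x : X} (h : IsAncestor y x) (hne : y ≠ x) : WellOrderingRel y x := by
  rcases trichotomous_of WellOrderingRel y x with h1 | h1 | h1
  · exact h1
  · exact absurd h1 hne
  · exact absurd h1 (h x Set.left_mem_uIcc)

/-- Among the ancestors on one side of x, those nearer to x come later in the well-ordering; apply
the previous lemma on the left, and its dual on the right. -/
theorem mk_isAncestor_le (hν : ℵ₀ ≤ ν) (hX : NoLongChain ν X) (x : X) :
    #{y | IsAncestor y x ∧ y ≠ x} ≤ ν := by
  have hl : #{y | IsAncestor y x ∧ y < x} ≤ ν := by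
    refine mk_le_of_lt_imp_wellOrderingRel hX.1 _ ?_
    rintro a ⟨ha, hax⟩ b ⟨hb, hbx⟩ hab
    rcases trichotomous_of WellOrderingRel a b with h1 | h1 | h1
    · exact h1
    · exact absurd h1 hab.ne
    · exact absurd h1 (ha b (Set.mem_uIcc.2 (Or.inr ⟨hab.le, hbx.le⟩)))
  have hr : #{y | IsAncestor y x ∧ x < y} ≤ ν := by
    refine mk_le_of_lt_imp_wellOrderingRel (X := Xᵒᵈ) hX.dual.1 {y : X | IsAncestor y x ∧ x < y} ?_
    rintro a ⟨ha, hax⟩ b ⟨hb, hbx⟩ hab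
    have hab' : (show X from b) < (show X from a) := hab
    rcases trichotomous_of (WellOrderingRel (α := X)) a b with h1 | h1 | h1
    · exact h1
    · exact absurd h1 hab.ne
    · exact absurd h1 (ha b (Set.mem_uIcc.2 (Or.inl ⟨hbx.le, hab'.le⟩)))
  have heq : {y | IsAncestor y x ∧ y ≠ x} =
      {y | IsAncestor y x ∧ y < x} ∪ {y | IsAncestor y x ∧ x < y} := by
    ext y
    simp only [Set.mem_ofPred_eq, Set.mem_union, ← and_or_left, lt_or_lt_iff_ne]
  rw [heq]
  exact (Cardinal.mk_union_le _ _).trans (Cardinal.add_le_of_le hν hl hr)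

/-- Whichever of two ancestors of x comes first in the well-ordering is an ancestor of the other,
since the interval between them is covered by their intervals to x. -/
theorem IsAncestor.total {x y z : X} (hy : IsAncestor y x) (hz : IsAncestor z x) :
    IsAncestor y z ∨ IsAncestor z y := by
  have key : ∀ y z, IsAncestor y x → IsAncestor z x → ¬ WellOrderingRel z y → IsAncestor y z := by
    intro y z hy hz hyz w hw hwy
    rcases trichotomous_of WellOrderingRel y z with h | rfl | h
    · rcases Set.uIcc_subset_uIcc_union_uIcc (b := x) hw with h1 | h1
      · rw [Set.uIcc_comm] at h1
        exact hz w h1 (_root_.trans hwy h)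
      · exact hy w h1 hwy
    · simp only [Set.uIcc_self, Set.mem_singleton_iff] at hw
      exact irrefl_of WellOrderingRel _ (hw ▸ hwy)
    · exact hyz h
  by_cases h : WellOrderingRel z y
  · exact Or.inr (key z y hz hy (asymm h))
  · exact Or.inl (key y z hy hz h)

/-- Take the first element of the interval between x and y in the well-ordering. -/
theorem exists_common_ancestor (x y : X) :
    ∃ z ∈ Set.uIcc x y, IsAncestor z x ∧ IsAncestor z y := by
  obtain ⟨z, hz, hmin⟩ := (WellOrderingRel.isWellOrder (α := X)).wf.has_min (Set.uIcc x y)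
    ⟨x, Set.left_mem_uIcc⟩
  refine ⟨z, hz, fun w hw => hmin w ?_, fun w hw => hmin w ?_⟩
  · exact Set.uIcc_subset_uIcc Set.left_mem_uIcc hz hw
  · exact Set.uIcc_subset_uIcc Set.right_mem_uIcc hz hw

/-- A linear order without chains of length `ν⁺` in either direction has at most `2 ^ ν` elements. -/
theorem NoLongChain.mk_le (hν : ℵ₀ ≤ ν) (hX : NoLongChain ν X) : #X ≤ 2 ^ ν := by
  classical
  -- The depth is defined by recursion along the well-ordering; it stays inside ν⁺ because an
  -- element has at most ν proper ancestors.
  obtain ⟨depth, hdepth⟩ : ∃ depth : X → SuccOrd ν,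
      ∀ x y, IsAncestor y x → y ≠ x → depth y < depth x := by
    have hb : ∀ (x : X) (g : ∀ y, WellOrderingRel y x → SuccOrd ν),
        ∃ b, ∀ y (h : IsAncestor y x ∧ y ≠ x), g y (h.1.rel_of_ne h.2) < b := by
      intro x g
      obtain ⟨b, hb⟩ := SuccOrd.exists_forall_range_lt hν (mk_isAncestor_le hν hX x)
        fun y => g y (y.2.1.rel_of_ne y.2.2)
      exact ⟨b, fun y h => hb ⟨y, h⟩⟩
    choose b hb using hb
    refine ⟨(WellOrderingRel.isWellOrder (α := X)).wf.fix b, fun x y hy hne => ?_⟩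
    rw [WellFounded.fix_eq _ b x]
    exact hb x (fun y _ => WellFounded.fix _ b y) y ⟨hy, hne⟩
  have huniq : ∀ {x y z}, IsAncestor y x → IsAncestor z x → depth y = depth z → y = z := by
    intro x y z hy hz h
    by_contra hne
    rcases hy.total hz with h1 | h1
    · exact (hdepth _ _ h1 hne).ne h
    · exact (hdepth _ _ h1 (Ne.symm hne)).ne h.symm
  -- The code of x records the turns of the path from the root to x: how the ancestor at each depth
  -- compares with x, or `none` if there is no ancestor of that depth.
  let code : ∀ x : X, SuccOrd ν → Option Ordering := fun x o =>
    if h : ∃ z, IsAncestor z x ∧ depth z = o then some (cmp h.choose x) else none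
  have hcode : ∀ x z, IsAncestor z x → code x (depth z) = some (cmp z x) := by
    intro x z hz
    have h : ∃ z', IsAncestor z' x ∧ depth z' = depth z := ⟨z, hz, rfl⟩
    have : h.choose = z := huniq h.choose_spec.1 hz h.choose_spec.2
    simp only [code, dif_pos h, this]
  -- Distinct x and y compare differently with their common ancestor in between, whose depth is at
  -- most that of x. So x is determined by its depth and at most ν entries of its code.
  have hinj : ∀ x y : X, (∀ o, o ≤ depth x → code x o = code y o) → x = y := by
    intro x y h
    obtain ⟨z, hz, hzx, hzy⟩ := exists_common_ancestor x y
    have hle : depth z ≤ depth x := by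
      by_cases hzx' : z = x
      · rw [hzx']
      · exact (hdepth x z hzx hzx').le
    have h1 := h _ hle
    rw [hcode x z hzx, hcode y z hzy, Option.some.injEq] at h1
    rcases Set.mem_uIcc.1 hz with ⟨h2, h3⟩ | ⟨h2, h3⟩
    · rcases h2.eq_or_lt with rfl | h2
      · rw [cmp_self_eq_eq] at h1
        exact (cmp_eq_eq_iff _ _).1 h1.symm
      · rw [(cmp_eq_gt_iff _ _).2 h2] at h1
        exact absurd ((cmp_eq_gt_iff _ _).1 h1.symm) h3.not_gt
    · rcases h3.eq_or_lt with rfl | h3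
      · rw [cmp_self_eq_eq] at h1
        exact (cmp_eq_eq_iff _ _).1 h1.symm
      · rw [(cmp_eq_lt_iff _ _).2 h3] at h1
        exact absurd ((cmp_eq_lt_iff _ _).1 h1.symm) h2.not_gt
  have hfib : ∀ o : SuccOrd ν, #(depth ⁻¹' {o}) ≤ 2 ^ ν := by
    intro o
    have hIic : #(Set.Iic o) ≤ ν := by
      rw [← Set.Iio_insert]
      exact (Cardinal.mk_insert_le).trans (Cardinal.add_le_of_le hν (SuccOrd.mk_Iio_le o)
        (Cardinal.one_le_aleph0.trans hν))
    have hle : #(depth ⁻¹' {o}) ≤ #(Set.Iic o → Option Ordering) := by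
      refine Cardinal.mk_le_of_injective (f := fun x => fun p : Set.Iic o => code x p) ?_
      rintro ⟨x, hx⟩ ⟨y, hy⟩ h
      refine Subtype.ext (hinj x y fun p hp => congrFun h ⟨p, ?_⟩)
      exact hp.trans_eq hx
    refine hle.trans ?_
    rw [Cardinal.mk_pi, Cardinal.prod_const, Cardinal.lift_id'.{0, u}]
    have h4 : Cardinal.lift.{u} #(Option Ordering) ≤ ℵ₀ := by
      rw [Cardinal.lift_le_aleph0]
      exact Cardinal.mk_le_aleph0
    calc Cardinal.lift.{u} #(Option Ordering) ^ #(Set.Iic o) ≤ ℵ₀ ^ ν :=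
          (Cardinal.power_le_power_right h4).trans
            (Cardinal.power_le_power_left Cardinal.aleph0_ne_zero hIic)
      _ = 2 ^ ν := Cardinal.power_eq_two_power hν Cardinal.natCast_lt_aleph0.le hν
  rw [← Cardinal.mk_congr (Equiv.sigmaFiberEquiv depth), Cardinal.mk_sigma]
  refine (Cardinal.sum_le_sum _ (fun _ => 2 ^ ν) fun o => hfib o).trans ?_
  rw [Cardinal.sum_const', SuccOrd.mk_eq]
  have h2 : ℵ₀ ≤ 2 ^ ν := hν.trans (Cardinal.cantor ν).le
  exact Cardinal.mul_le_of_le h2 (Order.succ_le_of_lt (Cardinal.cantor ν)) le_rfl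

end Hausdorff

/-! ### Orders built by balanced insertions have no long chains. -/

section Rank

variable {ν : Cardinal.{u}} {Γ : Type u} [LinearOrder Γ] (r : Γ → Ordinal.{u})

/-- The elements below `γ` of smaller rank have a countable cofinal subset. -/
def CountablyCofinalBelow (γ : Γ) : Prop :=
  ∃ S : Set Γ, S.Countable ∧ (∀ s ∈ S, s < γ ∧ r s < r γ) ∧ ∀ δ, δ < γ → r δ < r γ → ∃ s ∈ S, δ ≤ s

/-- The elements above `γ` of smaller rank have a countable coinitial subset. -/
def CountablyCoinitialAbove (γ : Γ) : Prop :=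
  ∃ S : Set Γ, S.Countable ∧ (∀ s ∈ S, γ < s ∧ r s < r γ) ∧ ∀ δ, γ < δ → r δ < r γ → ∃ s ∈ S, s ≤ δ

variable {r}

theorem exists_rank_min {P : Γ → Prop} (h : ∃ z, P z) : ∃ z, P z ∧ ∀ y, P y → r z ≤ r y := by
  obtain ⟨z, hz, hmin⟩ := (InvImage.wf r Ordinal.lt_wf).has_min {z | P z} h
  exact ⟨z, hz, fun y hy => not_lt.1 (hmin y hy)⟩

/-- The set contains a strictly increasing sequence of length ν⁺ ≥ ω₁, so some element has
uncountably many predecessors. The one of least rank has a set of predecessors that is uncountable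
with countable proper initial segments. -/
theorem exists_uncountable_initial (hν : ℵ₁ ≤ ν) {X : Set Γ}
    (hinc : ∀ x ∈ X, ∀ y ∈ X, x < y → r x < r y)
    (hX : ∀ s : Set X, #s ≤ ν → ∃ b : X, ∀ x ∈ s, x < b) :
    ∃ x ∈ X, ¬ {z ∈ X | z < x}.Countable ∧ ∀ z ∈ X, z < x → {y ∈ X | y < z}.Countable := by
  have hν0 : ℵ₀ ≤ ν := Cardinal.aleph0_lt_aleph_one.le.trans hν
  have h1 : ∃ x, x ∈ X ∧ ¬ {z ∈ X | z < x}.Countable := by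
    obtain ⟨g, hg⟩ := SuccOrd.exists_seq (R := fun x y : X => x < y) hX
    obtain ⟨s, hs⟩ := Cardinal.le_mk_iff_exists_set.1
      ((hν.trans (Order.le_succ ν)).trans_eq SuccOrd.mk_eq.symm)
    obtain ⟨b, hb⟩ := SuccOrd.exists_forall_lt hν0 (hs.trans_le hν)
    refine ⟨g b, (g b).2, fun hc => ?_⟩
    have hinj : Function.Injective fun i => (g i : Γ) := by
      intro i j hij
      have hij := Subtype.ext hij
      rcases lt_trichotomy i j with h | h | h
      · exact absurd hij (hg i j h).ne
      · exact h
      · exact absurd hij (hg j i h).ne'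
    have h2 : ((fun i => (g i : Γ)) '' s).Countable :=
      hc.mono (by rintro _ ⟨i, hi, rfl⟩; exact ⟨(g i).2, hg i b (hb i hi)⟩)
    have h3 := Set.countable_of_injective_of_countable_image hinj.injOn h2
    rw [← Cardinal.le_aleph0_iff_set_countable, hs] at h3
    exact h3.not_gt Cardinal.aleph0_lt_aleph_one
  obtain ⟨x, ⟨hx, hxc⟩, hmin⟩ := exists_rank_min (r := r) h1
  refine ⟨x, hx, hxc, fun z hz hzx => ?_⟩
  by_contra hzc
  exact (hmin z ⟨hz, hzc⟩).not_gt (hinc z hz x hx hzx)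

/-- A long increasing sequence produces a set Y with no countable cofinal subset, and a
first-inserted element x' in a gap above Y. Uncountability below x' and balance force uncountability
above x'; a later neighbour x'' of x' then has x' itself as nearest older element on one side,
contradicting balance at x''. -/
theorem not_strictMono_of_rank (hν : ℵ₁ ≤ ν) (hbase : #{γ | r γ = 0} ≤ ν)
    (hinj : ∀ γ δ, r γ ≠ 0 → r γ = r δ → γ = δ)
    (hbal : ∀ γ, r γ ≠ 0 → (CountablyCofinalBelow r γ ↔ CountablyCoinitialAbove r γ))
    (f : SuccOrd ν → Γ) : ¬ StrictMono f := by
  intro hf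
  have hν0 : ℵ₀ ≤ ν := Cardinal.aleph0_lt_aleph_one.le.trans hν
  have hlt : ∀ i, ∃ j : SuccOrd ν, i < j := fun i => by
    obtain ⟨j, hj, -⟩ := SuccOrd.exists_lt_lt hν0 i i
    exact ⟨j, hj⟩
  -- a tail of the sequence avoids the base
  obtain ⟨i₀, hi₀⟩ : ∃ i₀, ∀ z, f i₀ ≤ z → (∃ j, z ≤ f j) → r z ≠ 0 := by
    have h : ∀ b : {γ | r γ = 0}, ∃ i, (∃ j, (b : Γ) < f j) → (b : Γ) < f i := by
      intro b
      by_cases h : ∃ j, (b : Γ) < f j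
      · exact ⟨h.choose, fun _ => h.choose_spec⟩
      · exact ⟨(hlt (Classical.choice (by
          rw [← Cardinal.mk_ne_zero_iff, SuccOrd.mk_eq]; exact (Order.bot_lt_succ ν).ne'))).choose,
          fun h' => absurd h' h⟩
    choose g hg using h
    obtain ⟨i₀, hi₀⟩ := SuccOrd.exists_forall_range_lt hν0 hbase g
    refine ⟨i₀, fun z hz ⟨j, hj⟩ h0 => ?_⟩
    obtain ⟨k, hk⟩ := hlt j
    have := hg ⟨z, h0⟩ ⟨k, hj.trans_lt (hf hk)⟩
    exact (this.trans (hf (hi₀ _))).not_ge hz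
  -- These points have least rank among everything from them on up to the end of the sequence. Hence
  -- the rank is strictly increasing on `X`, and `X` is cofinal along the sequence.
  let X : Set Γ := {x | f i₀ ≤ x ∧ (∃ j, x ≤ f j) ∧ ∀ y, x ≤ y → (∃ j, y ≤ f j) → r x ≤ r y}
  have hX0 : ∀ x ∈ X, r x ≠ 0 := fun x hx => hi₀ x hx.1 hx.2.1
  have hinc : ∀ x ∈ X, ∀ y, x < y → (∃ j, y ≤ f j) → r x < r y := by
    intro x hx y hxy hy
    exact lt_of_le_of_ne (hx.2.2 y hxy.le hy) fun h => hxy.ne (hinj x y (hX0 x hx) h)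
  have hcof : ∀ j, ∃ x ∈ X, f j ≤ x := by
    intro j
    obtain ⟨x, ⟨hx1, hx2⟩, hmin⟩ := exists_rank_min (r := r)
      (P := fun y => f (max i₀ j) ≤ y ∧ ∃ k, y ≤ f k) ⟨_, le_rfl, _, le_rfl⟩
    refine ⟨x, ⟨(hf.monotone (le_max_left _ _)).trans hx1, hx2, fun y hy hy' => ?_⟩,
      (hf.monotone (le_max_right _ _)).trans hx1⟩
    exact hmin y ⟨hx1.trans hy, hy'⟩
  have hXb : ∀ s : Set X, #s ≤ ν → ∃ b : X, ∀ x ∈ s, x < b := by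
    intro s hs
    obtain ⟨b, hb⟩ := SuccOrd.exists_forall_range_lt hν0 hs fun x => x.1.2.2.1.choose
    obtain ⟨y, hy, hby⟩ := hcof b
    refine ⟨⟨y, hy⟩, fun x hx => ?_⟩
    exact (x.2.2.1.choose_spec.trans_lt (hf (hb ⟨x, hx⟩))).trans_le hby
  obtain ⟨x, hx, hxc, hxmin⟩ := exists_uncountable_initial (r := r) hν
    (fun x hx y hy h => hinc x hx y h hy.2.1) hXb
  set Y : Set Γ := {z ∈ X | z < x} with hY
  have hYcof : ∀ S : Set Γ, S.Countable → S ⊆ Y → ¬ ∀ t ∈ Y, ∃ s ∈ S, t ≤ s := by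
    intro S hS hSY h
    refine hxc (Set.Countable.mono (s₂ := ⋃ s ∈ S, insert s {y ∈ X | y < s}) ?_ ?_)
    · intro t ht
      obtain ⟨s, hs, hts⟩ := h t ht
      simp only [Set.mem_iUnion]
      refine ⟨s, hs, ?_⟩
      rcases hts.eq_or_lt with h | h
      · exact Or.inl h
      · exact Or.inr ⟨ht.1, h⟩
    · exact hS.biUnion fun s hs => (hxmin s (hSY hs).1 (hSY hs).2).insert s
  obtain ⟨t₀, ht₀⟩ : Y.Nonempty := by
    by_contra h
    rw [Set.not_nonempty_iff_eq_empty] at h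
    exact hxc (h ▸ Set.countable_empty)
  obtain ⟨⟨y, hyX⟩, hxy⟩ := hXb {⟨x, hx⟩} (by simpa using Cardinal.one_le_aleph0.trans hν0)
  have hxy : x < y := hxy _ rfl
  -- the first element between `Y` and `y`
  obtain ⟨x', ⟨hx'Y, hx'y⟩, hx'min⟩ := exists_rank_min (r := r)
    (P := fun z => (∀ t ∈ Y, t < z) ∧ z ≤ y) ⟨x, fun t ht => ht.2, hxy.le⟩
  obtain ⟨jy, hjy⟩ := hyX.2.1
  have hYr : ∀ t ∈ Y, r t < r x' := fun t ht => hinc t ht.1 x' (hx'Y t ht) ⟨jy, hx'y.trans hjy⟩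
  have hx'0 : r x' ≠ 0 := (hYr t₀ ht₀).ne_bot
  -- By minimality of `x'`, every older element below it is dominated by an element of `Y`, so a
  -- countable cofinal set there would give one in `Y`.
  have hbelow : ¬ CountablyCofinalBelow r x' := by
    rintro ⟨S, hS, hSlt, hScof⟩
    have h : ∀ s ∈ S, ∃ t ∈ Y, s ≤ t := by
      intro s hs
      by_contra! h
      exact (hx'min s ⟨h, (hSlt s hs).1.le.trans hx'y⟩).not_gt (hSlt s hs).2
    choose! g hg hgle using h
    refine hYcof (g '' S) (hS.image g) (Set.image_subset_iff.2 hg) fun t ht => ?_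
    obtain ⟨s, hs, hts⟩ := hScof t (hx'Y t ht) (hYr t ht)
    exact ⟨g s, ⟨s, hs, rfl⟩, hts.trans (hgle s hs)⟩
  have habove : ¬ CountablyCoinitialAbove r x' := fun h => hbelow ((hbal x' hx'0).2 h)
  have hup : ∀ δ, x' < δ → r δ < r x' → y < δ := by
    intro δ h1 h2
    by_contra h
    exact (hx'min δ ⟨fun t ht => (hx'Y t ht).trans h1, not_lt.1 h⟩).not_gt h2
  rcases hx'y.lt_or_eq with hlt' | rfl
  -- Below `x''` the largest older element is `x'`. Balance then gives a countable coinitial set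
  -- above `x''`, and it transfers to the elements above `x'` that are older than `x'`.
  · obtain ⟨x'', ⟨h1, h2⟩, hmin⟩ := exists_rank_min (r := r)
      (P := fun z => x' < z ∧ ∀ δ, x' < δ → r δ < r x' → z < δ) ⟨y, hlt', hup⟩
    have hr : r x' < r x'' := by
      refine lt_of_le_of_ne (not_lt.1 fun h => (h2 x'' h1 h).false) fun h => ?_
      exact h1.ne (hinj x' x'' hx'0 h)
    obtain ⟨S, hS, hSlt, hScof⟩ := (hbal x'' hr.ne_bot).1
      ⟨{x'}, Set.countable_singleton _, by rintro _ rfl; exact ⟨h1, hr⟩, fun δ hδ hδr => by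
        refine ⟨x', rfl, ?_⟩
        by_contra h
        exact (hmin δ ⟨not_le.1 h, fun δ' k1 k2 => hδ.trans (h2 δ' k1 k2)⟩).not_gt hδr⟩
    have h : ∀ s ∈ S, ∃ d, (x' < d ∧ r d < r x') ∧ d ≤ s := by
      intro s hs
      by_contra! h
      refine (hmin s ⟨h1.trans (hSlt s hs).1, fun δ k1 k2 => h δ ⟨k1, k2⟩⟩).not_gt (hSlt s hs).2
    choose! g hg hgle using h
    refine habove ⟨g '' S, hS.image g, ?_, fun δ k1 k2 => ?_⟩
    · rintro _ ⟨s, hs, rfl⟩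
      exact hg s hs
    · obtain ⟨s, hs, hle⟩ := hScof δ (h2 δ k1 k2) (k2.trans hr)
      exact ⟨g s, ⟨s, hs, rfl⟩, (hgle s hs).trans hle⟩
  -- Here `x'` is the least older element above `x''`, and balance yields a countable cofinal subset
  -- of `Y`.
  · obtain ⟨x'', ⟨h1, h2⟩, hmin⟩ := exists_rank_min (r := r)
      (P := fun z => (∀ t ∈ Y, t < z) ∧ z < x') ⟨x, fun t ht => ht.2, hxy⟩
    have hr : r x' < r x'' := by
      refine lt_of_le_of_ne (hx'min x'' ⟨h1, h2.le⟩) fun h => ?_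
      exact h2.ne' (hinj x' x'' hx'0 h)
    obtain ⟨S, hS, hSlt, hScof⟩ := (hbal x'' hr.ne_bot).2
      ⟨{x'}, Set.countable_singleton _, by rintro _ rfl; exact ⟨h2, hr⟩, fun δ hδ hδr => by
        refine ⟨x', rfl, ?_⟩
        by_contra h
        exact (hmin δ ⟨fun t ht => (h1 t ht).trans hδ, not_le.1 h⟩).not_gt hδr⟩
    have h : ∀ s ∈ S, ∃ t ∈ Y, s ≤ t := by
      intro s hs
      by_contra! h
      exact (hmin s ⟨h, (hSlt s hs).1.trans h2⟩).not_gt (hSlt s hs).2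
    choose! g hg hgle using h
    refine hYcof (g '' S) (hS.image g) (Set.image_subset_iff.2 hg) fun t ht => ?_
    obtain ⟨s, hs, hts⟩ := hScof t (h1 t ht) ((hYr t ht).trans hr)
    exact ⟨g s, ⟨s, hs, rfl⟩, hts.trans (hgle s hs)⟩

/-- A ranked linear order in which every element outside of the base was inserted alone into a
cut of the elements of smaller rank that is balanced with respect to countable cofinality has no
long chains. -/
theorem NoLongChain.of_rank (hν : ℵ₁ ≤ ν) (hbase : #{γ | r γ = 0} ≤ ν)
    (hinj : ∀ γ δ, r γ ≠ 0 → r γ = r δ → γ = δ)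
    (hbal : ∀ γ, r γ ≠ 0 → (CountablyCofinalBelow r γ ↔ CountablyCoinitialAbove r γ)) :
    NoLongChain ν Γ :=
  ⟨not_strictMono_of_rank hν hbase hinj hbal, fun f hf =>
    not_strictMono_of_rank (Γ := Γᵒᵈ) (r := r) hν hbase hinj (fun γ hγ => (hbal γ hγ).symm)
      (OrderDual.toDual ∘ f) fun _ _ hab => hf hab⟩

end Rank

/-! ### Values and rank classes of an ordered field. -/

section ValueClass

variable {L : Type u} [Field L] [LinearOrder L] [IsStrictOrderedRing L]

/-- The natural valuation of an ordered field, as an element of the value group; `0` is sent to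
`0`. -/
noncomputable def unitClass (y : L) : AddUnits (ArchimedeanClass L) :=
  if h : y = 0 then 0 else
    ⟨.mk y, .mk y⁻¹, by rw [← ArchimedeanClass.mk_mul, mul_inv_cancel₀ h, ArchimedeanClass.mk_one],
      by rw [← ArchimedeanClass.mk_mul, inv_mul_cancel₀ h, ArchimedeanClass.mk_one]⟩

theorem unitClass_val {y : L} (h : y ≠ 0) :
    (unitClass y : ArchimedeanClass L) = ArchimedeanClass.mk y := by
  simp [unitClass, h]

theorem unitClass_zero : unitClass (0 : L) = 0 := by simp [unitClass]

theorem unitClass_eq_iff {y z : L} (hy : y ≠ 0) (hz : z ≠ 0) :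
    unitClass y = unitClass z ↔ ArchimedeanClass.mk y = ArchimedeanClass.mk z := by
  rw [← unitClass_val hy, ← unitClass_val hz, AddUnits.ext_iff]

theorem unitClass_one : unitClass (1 : L) = 0 := by
  apply AddUnits.ext
  rw [unitClass_val one_ne_zero]; rfl

theorem unitClass_mul {y z : L} (hy : y ≠ 0) (hz : z ≠ 0) :
    unitClass (y * z) = unitClass y + unitClass z := by
  apply AddUnits.ext
  rw [unitClass_val (mul_ne_zero hy hz), AddUnits.val_add, unitClass_val hy, unitClass_val hz,
    ArchimedeanClass.mk_mul]

theorem unitClass_inv (y : L) : unitClass y⁻¹ = -unitClass y := by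
  rcases eq_or_ne y 0 with rfl | hy
  · simp [unitClass_zero]
  · rw [eq_neg_iff_add_eq_zero, ← unitClass_mul (inv_ne_zero hy) hy, inv_mul_cancel₀ hy,
      unitClass_one]

theorem unitClass_pow {y : L} (hy : y ≠ 0) (n : ℕ) : unitClass (y ^ n) = n • unitClass y := by
  induction n with
  | zero => simp [unitClass_one]
  | succ n ih => rw [pow_succ, unitClass_mul (pow_ne_zero n hy) hy, ih, succ_nsmul]

theorem unitClass_neg (y : L) : unitClass (-y) = unitClass y := by
  rcases eq_or_ne y 0 with rfl | hy
  · simp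
  · rw [unitClass_eq_iff (neg_ne_zero.2 hy) hy, ArchimedeanClass.mk_neg]

/-- The Archimedean class of the value of an element of an ordered field. -/
noncomputable def rankClass (y : L) : ArchimedeanClass (AddUnits (ArchimedeanClass L)) :=
  .mk (unitClass y)

theorem rankClass_surjective : Function.Surjective (rankClass (L := L)) := by
  intro γ
  induction γ using ArchimedeanClass.ind with
  | _ g =>
    obtain ⟨y, hy⟩ := ArchimedeanClass.mk_surjective L (g : ArchimedeanClass L)
    have hy0 : y ≠ 0 := by
      rintro rfl
      have h := g.val_neg
      rw [← hy, ArchimedeanClass.mk_zero, top_add] at h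
      have h1 : (ArchimedeanClass.mk (1 : L)) = ⊤ := h.symm
      exact one_ne_zero (ArchimedeanClass.mk_eq_top_iff.1 h1)
    refine ⟨y, ?_⟩
    rw [rankClass]
    congr 1
    exact AddUnits.ext (by rw [unitClass_val hy0, hy])

theorem rankClass_zero : rankClass (0 : L) = rankClass 1 := by
  rw [rankClass, rankClass, unitClass_zero, unitClass_one]

theorem rankClass_inv (y : L) : rankClass y⁻¹ = rankClass y := by
  rw [rankClass, rankClass, unitClass_inv, ArchimedeanClass.mk_neg]

theorem rankClass_neg (y : L) : rankClass (-y) = rankClass y := by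
  rw [rankClass, rankClass, unitClass_neg]

/-- For elements at least 1, comparing rank classes means comparing growth up to powers and integer
multiples. The order is reversed: larger elements have smaller classes. -/
theorem rankClass_le_iff {y z : L} (hy : 1 ≤ y) (hz : 1 ≤ z) :
    rankClass y ≤ rankClass z ↔ ∃ n m : ℕ, z ≤ m * y ^ n := by
  have hy0 : y ≠ 0 := (zero_lt_one.trans_le hy).ne'
  have hz0 : z ≠ 0 := (zero_lt_one.trans_le hz).ne'
  have key : ∀ t : L, 1 ≤ t → unitClass t ≤ 0 := fun t ht => by
    have ht0 : t ≠ 0 := (zero_lt_one.trans_le ht).ne'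
    rw [← AddUnits.val_le_val, unitClass_val ht0, AddUnits.val_zero, ← ArchimedeanClass.mk_one]
    exact ArchimedeanClass.mk_antitoneOn (Set.mem_Ici.2 zero_le_one)
      (Set.mem_Ici.2 (zero_le_one.trans ht)) ht
  rw [rankClass, rankClass, ArchimedeanClass.mk_le_mk]
  refine exists_congr fun n => ?_
  rw [abs_of_nonpos (key y hy), abs_of_nonpos (key z hz), smul_neg, neg_le_neg_iff,
    ← unitClass_pow hy0, ← AddUnits.val_le_val, unitClass_val hz0,
    unitClass_val (pow_ne_zero n hy0), ArchimedeanClass.mk_le_mk]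
  refine exists_congr fun m => ?_
  rw [abs_of_nonneg (zero_le_one.trans hz),
    abs_of_nonneg (pow_nonneg (zero_le_one.trans hy) n), nsmul_eq_mul]

theorem rankClass_anti {y z : L} (hy : 1 ≤ y) (h : y ≤ z) : rankClass z ≤ rankClass y :=
  (rankClass_le_iff (hy.trans h) hy).2 ⟨1, 1, by simpa using h⟩

/-- Every element has the same rank class as one that is at least `1`, obtained by changing the
sign and inverting. -/
theorem exists_one_le_of_inv_neg {P : L → Prop} {y : L} (hy : y ≠ 0) (hP : P y)
    (hinv : ∀ z, 0 < z → P z → P z⁻¹) (hneg : ∀ z, P z → P (-z)) :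
    ∃ z, 1 ≤ z ∧ P z ∧ rankClass z = rankClass y := by
  obtain ⟨t, ht, htP, hty⟩ : ∃ t, 0 < t ∧ P t ∧ rankClass t = rankClass y := by
    rcases lt_or_gt_of_ne hy with h | h
    · exact ⟨-y, neg_pos.2 h, hneg y hP, rankClass_neg y⟩
    · exact ⟨y, h, hP, rfl⟩
  rcases le_total 1 t with h | h
  · exact ⟨t, h, htP, hty⟩
  · exact ⟨t⁻¹, (one_le_inv₀ ht).2 h, hinv t ht htP, (rankClass_inv t).trans hty⟩

theorem ArchimedeanClass.mk_eq_or_eq_of_add {A : Type*} [AddCommGroup A] [LinearOrder A]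
    [IsOrderedAddMonoid A] {g h : A} (hne : mk g ≠ mk h) :
    mk (g + h) = mk g ∨ mk (g + h) = mk h := by
  rcases lt_or_gt_of_ne hne with hlt | hlt
  · exact .inl (ArchimedeanClass.mk_add_eq_mk_left hlt)
  · exact .inr (by rw [add_comm]; exact ArchimedeanClass.mk_add_eq_mk_left hlt)

/-- A vanishing finite sum has two nonzero terms of the same Archimedean class. -/
theorem exists_mk_eq_of_sum_eq_zero {ι : Type*} {s : Finset ι} {f : ι → L}
    (h0 : ∑ i ∈ s, f i = 0) (hne : ∃ i ∈ s, f i ≠ 0) :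
    ∃ i ∈ s, ∃ j ∈ s, i ≠ j ∧ f i ≠ 0 ∧ f j ≠ 0 ∧
      ArchimedeanClass.mk (f i) = ArchimedeanClass.mk (f j) := by
  classical
  by_contra! hcon
  have key : ∀ t ⊆ s, (∃ i ∈ t, f i ≠ 0) →
      ∃ i ∈ t, f i ≠ 0 ∧ ArchimedeanClass.mk (∑ j ∈ t, f j) = ArchimedeanClass.mk (f i) := by
    intro t
    induction t using Finset.induction_on with
    | empty => simp
    | insert a t ha ih =>
      intro hts hex
      rw [Finset.sum_insert ha]
      have hts' := (Finset.subset_insert a t).trans hts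
      by_cases ht : ∃ i ∈ t, f i ≠ 0
      · obtain ⟨i, hi, hi0, his⟩ := ih hts' ht
        by_cases ha0 : f a = 0
        · exact ⟨i, Finset.mem_insert_of_mem hi, hi0, by rw [ha0, zero_add, his]⟩
        · have hdist := hcon a (hts (Finset.mem_insert_self a t)) i (hts' hi)
            (by rintro rfl; exact ha hi) ha0 hi0
          rcases ArchimedeanClass.mk_eq_or_eq_of_add (his ▸ hdist) with h | h
          · exact ⟨a, Finset.mem_insert_self a t, ha0, h⟩
          · exact ⟨i, Finset.mem_insert_of_mem hi, hi0, h.trans his⟩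
      · push Not at ht
        obtain ⟨i, hi, hi0⟩ := hex
        rcases Finset.mem_insert.1 hi with rfl | hi
        · exact ⟨i, Finset.mem_insert_self i t, hi0, by rw [Finset.sum_eq_zero ht, add_zero]⟩
        · exact absurd (ht i hi) hi0
  obtain ⟨i, -, hi0, hi⟩ := key s subset_rfl hne
  rw [h0, ArchimedeanClass.mk_zero] at hi
  exact hi0 (ArchimedeanClass.mk_eq_top_iff.1 hi.symm)

end ValueClass

/-! ### Rank classes of an algebraic extension of F(x). -/

section AlgOver

/-- `y` is algebraic over the subfield generated by the range of `i` and by `x`. -/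
def AlgOver {F L : Type*} [Field F] [Field L] (i : F →+* L) (x y : L) : Prop :=
  ∃ P : F[X][X], P ≠ 0 ∧ P.eval₂ (eval₂RingHom i x) y = 0

variable {F : Type v} {L : Type u} [Field F] [LinearOrder F] [IsStrictOrderedRing F]
  [IsRealClosed F] [Field L] [LinearOrder L] [IsStrictOrderedRing L] {i : F →+* L} {x : L}

theorem eval₂_quadratic (a d : F) :
    ((X - C a) ^ 2 + C (d ^ 2)).eval₂ i x = (x - i a) ^ 2 + i d ^ 2 := by
  simp [eval₂_pow]

theorem eval₂_ne_zero_of_notMem (hx : x ∉ Set.range i) {p : F[X]} (hp : p ≠ 0) :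
    p.eval₂ i x ≠ 0 := by
  refine IsRealClosed.polynomial_induction (P := fun p => p.eval₂ i x ≠ 0) ?_ ?_ ?_ ?_ hp
  · intro c hc; simpa using hc
  · intro a h
    refine hx ⟨a, ?_⟩
    rw [eval₂_sub, eval₂_X, eval₂_C] at h
    exact (sub_eq_zero.1 h).symm
  · intro a d hd
    rw [eval₂_quadratic]
    have : i d ≠ 0 := by simpa using hd
    positivity
  · intro p q hp hq
    rw [eval₂_mul]
    exact mul_ne_zero hp hq

theorem eval₂RingHom_injective_of_notMem (hx : x ∉ Set.range i) :
    Function.Injective (eval₂RingHom i x) :=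
  (injective_iff_map_eq_zero _).2 fun p hp => by
    by_contra h
    exact eval₂_ne_zero_of_notMem hx h hp

/-- Factor p: linear factors are covered by assumption, and in a sum of two squares there is no
cancellation, so its value is twice that of the larger term. -/
theorem unitClass_eval₂_mem (hx : x ∉ Set.range i) {H : AddSubgroup (AddUnits (ArchimedeanClass L))}
    (hF : ∀ c, unitClass (i c) ∈ H) (hlin : ∀ a, unitClass (x - i a) ∈ H) {p : F[X]} (hp : p ≠ 0) :
    unitClass (p.eval₂ i x) ∈ H := by
  have hx0 : ∀ a, x - i a ≠ 0 := fun a h => hx ⟨a, (sub_eq_zero.1 h).symm⟩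
  refine (IsRealClosed.polynomial_induction
    (P := fun p => p.eval₂ i x ≠ 0 ∧ unitClass (p.eval₂ i x) ∈ H) ?_ ?_ ?_ ?_ hp).2
  · intro c hc; simpa [hc] using hF c
  · intro a
    simpa using ⟨hx0 a, hlin a⟩
  · intro a d hd
    rw [eval₂_quadratic]
    have hd0 : i d ≠ 0 := by simpa using hd
    have h0 := hx0 a
    have hpos : 0 < (x - i a) ^ 2 + i d ^ 2 := by positivity
    refine ⟨hpos.ne', ?_⟩
    have key : ∀ s t : L, s ≠ 0 → |t| ≤ |s| → unitClass (s ^ 2 + t ^ 2) = 2 • unitClass s := by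
      intro s t hs hts
      have hts := sq_le_sq.2 hts
      have h2 : 0 < s ^ 2 := by positivity
      have h3 := sq_nonneg t
      rw [← unitClass_pow hs, unitClass_eq_iff (by positivity) h2.ne']
      refine ArchimedeanClass.mk_eq_mk.2 ⟨⟨1, ?_⟩, ⟨2, ?_⟩⟩
      · rw [one_smul, abs_of_pos h2, abs_of_nonneg (by positivity)]; linarith
      · rw [abs_of_pos h2, abs_of_nonneg (by positivity), nsmul_eq_mul]; push_cast; linarith
    rcases le_total |i d| |x - i a| with h | h
    · rw [key _ _ h0 h]; exact H.nsmul_mem (hlin a) 2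
    · rw [add_comm, key _ _ hd0 h]; exact H.nsmul_mem (hF d) 2
  · intro p q hp hq
    rw [eval₂_mul, unitClass_mul hp.1 hq.1]
    exact ⟨mul_ne_zero hp.1 hq.1, H.add_mem hp.2 hq.2⟩

/-- In an algebraic equation for y, two nonzero terms of different degrees must have the same value;
comparing them puts a nonzero multiple of the value of y into `H`. -/
theorem AlgOver.exists_nsmul_mem (hx : x ∉ Set.range i)
    {H : AddSubgroup (AddUnits (ArchimedeanClass L))}
    (hF : ∀ c, unitClass (i c) ∈ H) (hlin : ∀ a, unitClass (x - i a) ∈ H) {y : L} (hy0 : y ≠ 0)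
    (hy : AlgOver i x y) : ∃ n : ℕ, n ≠ 0 ∧ n • unitClass y ∈ H := by
  obtain ⟨P, hP, hPy⟩ := hy
  rw [eval₂_eq_sum_range] at hPy
  have hco : ∀ n, P.coeff n ≠ 0 → eval₂RingHom i x (P.coeff n) ≠ 0 := fun n hn =>
    eval₂_ne_zero_of_notMem hx hn
  obtain ⟨m, -, n, -, hmn, hm0, hn0, h⟩ := exists_mk_eq_of_sum_eq_zero hPy
    ⟨P.natDegree, by simp, mul_ne_zero (hco _ (by simpa using hP)) (pow_ne_zero _ hy0)⟩
  wlog hlt : m < n generalizing m n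
  · exact this n m hmn.symm hn0 hm0 h.symm (lt_of_le_of_ne (not_lt.1 hlt) hmn.symm)
  have hcm : P.coeff m ≠ 0 := fun h => hm0 (by rw [h]; simp)
  have hcn : P.coeff n ≠ 0 := fun h => hn0 (by rw [h]; simp)
  rw [← unitClass_eq_iff hm0 hn0, unitClass_mul (hco m hcm) (pow_ne_zero _ hy0),
    unitClass_mul (hco n hcn) (pow_ne_zero _ hy0), unitClass_pow hy0, unitClass_pow hy0] at h
  refine ⟨n - m, (Nat.sub_pos_of_lt hlt).ne', ?_⟩
  have h1 : (n - m) • unitClass y = unitClass (eval₂RingHom i x (P.coeff m)) -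
      unitClass (eval₂RingHom i x (P.coeff n)) := by
    have h2 : n • unitClass y = (n - m) • unitClass y + m • unitClass y := by
      rw [← add_nsmul, Nat.sub_add_cancel hlt.le]
    rw [h2] at h
    rw [eq_sub_iff_add_eq']
    have h3 : (unitClass (eval₂RingHom i x (P.coeff n)) + (n - m) • unitClass y) + m • unitClass y =
        unitClass (eval₂RingHom i x (P.coeff m)) + m • unitClass y := by rw [h, add_assoc]
    exact add_right_cancel h3
  rw [h1]
  exact H.sub_mem (unitClass_eval₂_mem hx hF hlin hcm) (unitClass_eval₂_mem hx hF hlin hcn)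

/-- The value group of the range of `i`. -/
noncomputable def valueSubgroup (i : F →+* L) : AddSubgroup (AddUnits (ArchimedeanClass L)) where
  carrier := Set.range fun c => unitClass (i c)
  zero_mem' := ⟨1, by simp [unitClass_one]⟩
  neg_mem' := by
    rintro _ ⟨c, rfl⟩
    exact ⟨c⁻¹, by simp [unitClass_inv]⟩
  add_mem' := by
    rintro _ _ ⟨c, rfl⟩ ⟨d, rfl⟩
    rcases eq_or_ne c 0 with rfl | hc
    · exact ⟨d, by simp [unitClass_zero]⟩
    rcases eq_or_ne d 0 with rfl | hd
    · exact ⟨c, by simp [unitClass_zero]⟩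
    · exact ⟨c * d, by simp [unitClass_mul, hc, hd]⟩

/-- The value group of a real closed field is divisible, because positive elements have roots of
every order. -/
theorem exists_zsmul_unitClass_eq (c : F) {k : ℤ} (hk : k ≠ 0) :
    ∃ b : F, b ≠ 0 ∧ k • unitClass (i b) = unitClass (i c) := by
  obtain ⟨t, ht, htc⟩ : ∃ t : F, 0 < t ∧ unitClass (i t) = unitClass (i c) := by
    rcases lt_trichotomy c 0 with h | rfl | h
    · exact ⟨-c, neg_pos.2 h, by rw [map_neg, unitClass_neg]⟩
    · exact ⟨1, one_pos, by simp [unitClass_zero, unitClass_one]⟩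
    · exact ⟨c, h, rfl⟩
  have hn : k.natAbs ≠ 0 := Int.natAbs_ne_zero.2 hk
  obtain ⟨s, hs⟩ := IsRealClosed.exists_eq_pow_of_nonneg ht.le hn
  have hs0 : s ≠ 0 := by rintro rfl; rw [zero_pow hn] at hs; exact ht.ne' hs
  have hs0' : i s ≠ 0 := by simpa using hs0
  have h1 : k.natAbs • unitClass (i s) = unitClass (i c) := by
    rw [← unitClass_pow hs0', ← map_pow, ← hs, htc]
  rcases Int.natAbs_eq k with h | h
  · exact ⟨s, hs0, by rw [h, natCast_zsmul, h1]⟩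
  · exact ⟨s⁻¹, inv_ne_zero hs0, by
      rw [h, map_inv₀, unitClass_inv, neg_smul, smul_neg, neg_neg, natCast_zsmul, h1]⟩

/-- Passing from `F` to elements algebraic over `F(x)` adds at most one rank class, and this class
is then that of `b * (x - a)` for some `a b : F`. -/
theorem exists_rankClass_eq_of_algOver (hx : x ∉ Set.range i) :
    ∃ a b : F, b ≠ 0 ∧ ∀ y, AlgOver i x y →
      (∃ c, rankClass y = rankClass (i c)) ∨ rankClass y = rankClass (i b * (x - i a)) := by
  by_cases hA : ∀ a, unitClass (x - i a) ∈ valueSubgroup i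
  -- If all x - a have values in the value group of F, no rank class is new, and the choice of a and
  -- b is immaterial.
  · refine ⟨0, 1, one_ne_zero, fun y hy => .inl ?_⟩
    rcases eq_or_ne y 0 with rfl | hy0
    · exact ⟨0, by simp⟩
    obtain ⟨n, hn, c, hc⟩ := hy.exists_nsmul_mem hx (H := valueSubgroup i) (fun c => ⟨c, rfl⟩) hA hy0
    refine ⟨c, ?_⟩
    have hc : unitClass (i c) = n • unitClass y := hc
    rw [rankClass, rankClass, hc, ← natCast_zsmul, ArchimedeanClass.mk_smul _ (by exact_mod_cast hn)]
  push Not at hA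
  obtain ⟨a, ha⟩ := hA
  have hx0 : ∀ a, x - i a ≠ 0 := fun a h => hx ⟨a, (sub_eq_zero.1 h).symm⟩
  set ζ := unitClass (x - i a) with hζ
  have hlin : ∀ c, unitClass (x - i c) ∈ valueSubgroup i ⊔ AddSubgroup.zmultiples ζ := by
    intro c
    rcases eq_or_ne c a with rfl | hca
    · exact AddSubgroup.mem_sup_right (AddSubgroup.mem_zmultiples _)
    have h0 : i (a - c) ≠ 0 := by
      rw [Ne, map_eq_zero, sub_eq_zero]; exact hca.symm
    have hne : ArchimedeanClass.mk (x - i a) ≠ ArchimedeanClass.mk (i (a - c)) := by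
      rw [Ne, ← unitClass_eq_iff (hx0 a) h0]
      exact fun h => ha ⟨a - c, h.symm⟩
    have hxc : x - i c = (x - i a) + i (a - c) := by rw [map_sub]; ring
    rw [hxc]
    rcases ArchimedeanClass.mk_eq_or_eq_of_add hne with h | h
    · rw [(unitClass_eq_iff (hxc ▸ hx0 c) (hx0 a)).2 h]
      exact AddSubgroup.mem_sup_right (AddSubgroup.mem_zmultiples _)
    · rw [(unitClass_eq_iff (hxc ▸ hx0 c) h0).2 h]
      exact AddSubgroup.mem_sup_left ⟨a - c, rfl⟩
  have key : ∀ y, AlgOver i x y → (∃ c, rankClass y = rankClass (i c)) ∨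
      ∃ b : F, b ≠ 0 ∧ rankClass y = rankClass (i b * (x - i a)) := by
    intro y hy
    rcases eq_or_ne y 0 with rfl | hy0
    · exact .inl ⟨0, by simp⟩
    obtain ⟨n, hn, hmem⟩ := hy.exists_nsmul_mem hx
      (fun c => AddSubgroup.mem_sup_left (show _ ∈ valueSubgroup i from ⟨c, rfl⟩)) hlin hy0
    obtain ⟨_, ⟨c, rfl⟩, _, ⟨k, rfl⟩, hck⟩ := AddSubgroup.mem_sup.1 hmem
    have hck : unitClass (i c) + k • ζ = n • unitClass y := hck
    have hyn : rankClass y = ArchimedeanClass.mk (n • unitClass y) := by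
      rw [← natCast_zsmul, ArchimedeanClass.mk_smul _ (by exact_mod_cast hn), rankClass]
    rcases eq_or_ne k 0 with rfl | hk
    · left
      refine ⟨c, ?_⟩
      rw [hyn, ← hck, zero_smul, add_zero, rankClass]
    · right
      -- Here n·v(y) = v(c) + kζ with k ≠ 0. Writing v(c) = k·v(b) gives n·v(y) = k·v(b(x - a)), and
      -- nonzero multiples do not change the class.
      obtain ⟨b, hb, hbc⟩ := exists_zsmul_unitClass_eq (i := i) c hk
      refine ⟨b, hb, ?_⟩
      rw [hyn, ← hck, ← hbc, ← smul_add, ArchimedeanClass.mk_smul _ hk, rankClass,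
        unitClass_mul (by simpa using hb) (hx0 a)]
  by_cases hex : ∃ y, AlgOver i x y ∧ ∀ c, rankClass y ≠ rankClass (i c)
  · obtain ⟨y, hy, hyc⟩ := hex
    obtain ⟨b, hb, hyb⟩ := (key y hy).resolve_left (by push Not; exact hyc)
    refine ⟨a, b, hb, fun z hz => ?_⟩
    by_cases hzc : ∃ c, rankClass z = rankClass (i c)
    · exact .inl hzc
    obtain ⟨d, hd, hzd⟩ := (key z hz).resolve_left hzc
    right
    push Not at hzc
    have hb' : i b ≠ 0 := by simpa using hb
    have hd' : i d ≠ 0 := by simpa using hd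
    -- The values of d(x - a) and b(x - a) differ by that of d/b. The class of the former is thus
    -- either old, which is excluded, or that of the latter.
    have h1 : unitClass (i d * (x - i a)) = unitClass (i (d / b)) + unitClass (i b * (x - i a)) := by
      rw [← unitClass_mul (by simp [hb, hd]) (mul_ne_zero hb' (hx0 a)), map_div₀]
      congr 1
      field_simp
    have h2 : ArchimedeanClass.mk (unitClass (i (d / b))) ≠
        ArchimedeanClass.mk (unitClass (i b * (x - i a))) := by
      change rankClass _ ≠ rankClass _
      rw [← hyb]
      exact (hyc _).symm
    rw [hzd]
    rcases ArchimedeanClass.mk_eq_or_eq_of_add h2 with h | h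
    · rw [← h1] at h
      exact absurd (hzd.trans h) (hzc _)
    · rw [← h1] at h
      exact h
  · push Not at hex
    exact ⟨0, 1, one_ne_zero, fun y hy => .inl (hex y hy)⟩

end AlgOver

/-! ### Balanced cuts, and the cuts they induce in the rank classes. -/

section Balanced

variable {F L : Type u} [Field F] [LinearOrder F] [IsStrictOrderedRing F]
  [Field L] [LinearOrder L] [IsStrictOrderedRing L] {i : F →+* L}

/-- The elements of `F` below `x` have a countable cofinal subset. -/
def CountableBelow (i : F →+* L) (x : L) : Prop :=
  ∃ S : Set F, S.Countable ∧ (∀ s ∈ S, i s < x) ∧ ∀ c, i c < x → ∃ s ∈ S, c ≤ s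

/-- The elements of `F` above `x` have a countable coinitial subset. -/
def CountableAbove (i : F →+* L) (x : L) : Prop :=
  ∃ S : Set F, S.Countable ∧ (∀ s ∈ S, x < i s) ∧ ∀ c, x < i c → ∃ s ∈ S, s ≤ c

/-- The elements of `F` below `x` have countable cofinality if and only if those above `x` have
countable coinitiality. -/
def CountablyBalanced (i : F →+* L) (x : L) : Prop :=
  CountableBelow i x ↔ CountableAbove i x

theorem CountableBelow.neg {x : L} (h : CountableBelow i x) : CountableAbove i (-x) := by
  obtain ⟨S, hS, h1, h2⟩ := h
  refine ⟨(- ·) '' S, hS.image _, ?_, fun c hc => ?_⟩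
  · rintro _ ⟨s, hs, rfl⟩
    simpa using h1 s hs
  · obtain ⟨s, hs, hcs⟩ := h2 (-c) (by rw [map_neg]; exact neg_lt.1 hc)
    exact ⟨-s, ⟨s, hs, rfl⟩, neg_le.1 hcs⟩

theorem CountableAbove.neg {x : L} (h : CountableAbove i x) : CountableBelow i (-x) := by
  obtain ⟨S, hS, h1, h2⟩ := h
  refine ⟨(- ·) '' S, hS.image _, ?_, fun c hc => ?_⟩
  · rintro _ ⟨s, hs, rfl⟩
    simpa using h1 s hs
  · obtain ⟨s, hs, hcs⟩ := h2 (-c) (by rw [map_neg]; exact lt_neg.1 hc)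
    exact ⟨-s, ⟨s, hs, rfl⟩, le_neg.1 hcs⟩

theorem CountablyBalanced.neg {x : L} (h : CountablyBalanced i x) : CountablyBalanced i (-x) :=
  ⟨fun h1 => (h.2 (by simpa using h1.neg)).neg, fun h1 => (h.1 (by simpa using h1.neg)).neg⟩

theorem CountableBelow.sub {x : L} (a : F) (h : CountableBelow i x) :
    CountableBelow i (x - i a) := by
  obtain ⟨S, hS, h1, h2⟩ := h
  refine ⟨(· - a) '' S, hS.image _, ?_, fun c hc => ?_⟩
  · rintro _ ⟨s, hs, rfl⟩
    simpa using h1 s hs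
  · obtain ⟨s, hs, hcs⟩ := h2 (c + a) (by rw [map_add]; exact lt_sub_iff_add_lt.1 hc)
    exact ⟨s - a, ⟨s, hs, rfl⟩, le_sub_iff_add_le.2 hcs⟩

theorem CountableAbove.sub {x : L} (a : F) (h : CountableAbove i x) :
    CountableAbove i (x - i a) := by
  have h1 := (h.neg.sub (-a)).neg
  have h2 : -(-x - i (-a)) = x - i a := by rw [map_neg]; ring
  rwa [h2] at h1

theorem CountablyBalanced.sub {x : L} (h : CountablyBalanced i x) (a : F) :
    CountablyBalanced i (x - i a) := by
  have key : x - i a - i (-a) = x := by rw [map_neg]; ring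
  exact ⟨fun h1 => (h.1 (key ▸ h1.sub (-a))).sub a, fun h1 => (h.2 (key ▸ h1.sub (-a))).sub a⟩

variable (hi : StrictMono i)
include hi

theorem CountableBelow.mul {x : L} {b : F} (hb : 0 < b) (h : CountableBelow i x) :
    CountableBelow i (i b * x) := by
  have hb' : 0 < i b := by simpa using hi hb
  obtain ⟨S, hS, h1, h2⟩ := h
  refine ⟨(b * ·) '' S, hS.image _, ?_, fun c hc => ?_⟩
  · rintro _ ⟨s, hs, rfl⟩
    simpa [hb'] using h1 s hs
  · obtain ⟨s, hs, hcs⟩ := h2 (c / b) (by rw [map_div₀, div_lt_iff₀' hb']; exact hc)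
    exact ⟨b * s, ⟨s, hs, rfl⟩, (div_le_iff₀' hb).1 hcs⟩

theorem CountableAbove.mul {x : L} {b : F} (hb : 0 < b) (h : CountableAbove i x) :
    CountableAbove i (i b * x) := by
  have h1 := (h.neg.mul hi hb).neg
  rwa [mul_neg, neg_neg] at h1

theorem CountablyBalanced.mul {x : L} (h : CountablyBalanced i x) {b : F} (hb : b ≠ 0) :
    CountablyBalanced i (i b * x) := by
  have key : ∀ b : F, 0 < b → CountablyBalanced i (i b * x) := by
    intro b hb
    have hb' : i b ≠ 0 := by simpa using hb.ne'
    have hk : i b⁻¹ * (i b * x) = x := by rw [map_inv₀, inv_mul_cancel_left₀ hb']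
    exact ⟨fun h1 => (h.1 (hk ▸ h1.mul hi (inv_pos.2 hb))).mul hi hb,
      fun h1 => (h.2 (hk ▸ h1.mul hi (inv_pos.2 hb))).mul hi hb⟩
  rcases lt_or_gt_of_ne hb with h0 | h0
  · have := (key (-b) (neg_pos.2 h0)).neg
    rwa [map_neg, neg_mul, neg_neg] at this
  · exact key b h0

theorem CountableBelow.inv {x : L} (hx : 0 < x) (h : CountableBelow i x) :
    CountableAbove i x⁻¹ := by
  obtain ⟨S, hS, h1, h2⟩ := h
  refine ⟨(·⁻¹) '' {s ∈ S | 0 < s}, (hS.mono (Set.sep_subset _ _)).image _, ?_, fun c hc => ?_⟩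
  · rintro _ ⟨s, ⟨hs, hs0⟩, rfl⟩
    have hs0' : 0 < i s := by simpa using hi hs0
    rw [map_inv₀]
    exact (inv_lt_inv₀ hx hs0').2 (h1 s hs)
  · have hc0' : 0 < i c := (inv_pos.2 hx).trans hc
    have hc0 : 0 < c := hi.lt_iff_lt.1 (by simpa using hc0')
    obtain ⟨s, hs, hcs⟩ := h2 c⁻¹ (by rw [map_inv₀]; exact inv_lt_of_inv_lt₀ hx hc)
    have hs0 := (inv_pos.2 hc0).trans_le hcs
    exact ⟨s⁻¹, ⟨s, ⟨hs, hs0⟩, rfl⟩, inv_le_of_inv_le₀ hc0 hcs⟩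

theorem CountableAbove.inv {x : L} (hx : 0 < x) (h : CountableAbove i x) :
    CountableBelow i x⁻¹ := by
  obtain ⟨S, hS, h1, h2⟩ := h
  refine ⟨insert 0 ((·⁻¹) '' S), (hS.image _).insert 0, ?_, fun c hc => ?_⟩
  · rintro _ (rfl | ⟨s, hs, rfl⟩)
    · simpa using hx
    · rw [map_inv₀]
      exact (inv_lt_inv₀ (hx.trans (h1 s hs)) hx).2 (h1 s hs)
  · rcases le_or_gt c 0 with hc0 | hc0
    · exact ⟨0, .inl rfl, hc0⟩
    have hc0' : 0 < i c := by simpa using hi hc0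
    obtain ⟨s, hs, hcs⟩ := h2 c⁻¹ (by rw [map_inv₀]; exact (lt_inv_comm₀ hc0' hx).1 hc)
    have hs0 : 0 < s := hi.lt_iff_lt.1 (by simpa using hx.trans (h1 s hs))
    exact ⟨s⁻¹, .inr ⟨s, hs, rfl⟩, (le_inv_comm₀ hc0 hs0).2 hcs⟩

theorem CountablyBalanced.inv {x : L} (hx : 0 < x) (h : CountablyBalanced i x) :
    CountablyBalanced i x⁻¹ := by
  have hx' := inv_pos.2 hx
  exact ⟨fun h1 => (h.2 (by simpa using h1.inv hi hx')).inv hi hx,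
    fun h1 => (h.1 (by simpa using h1.inv hi hx')).inv hi hx⟩

theorem exists_one_le_rankClass_eq (c : F) : ∃ d : F, 1 ≤ i d ∧ rankClass (i d) = rankClass (i c) := by
  rcases eq_or_ne c 0 with rfl | hc
  · exact ⟨1, by simp, by rw [map_zero, map_one, rankClass_zero]⟩
  obtain ⟨_, h1, ⟨d, rfl⟩, h2⟩ := exists_one_le_of_inv_neg (P := fun z : L => ∃ d, i d = z)
    (y := i c) (by simpa using hc) ⟨c, rfl⟩ (by rintro _ - ⟨d, rfl⟩; exact ⟨d⁻¹, map_inv₀ i d⟩)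
    (by rintro _ ⟨d, rfl⟩; exact ⟨-d, map_neg i d⟩)
  exact ⟨d, h1, h2⟩

variable [IsRealClosed F] {w : L}

/-- Classes below that of w belong to large elements above w. To return from class representatives g
to a coinitial set of elements, one needs all roots (g/m)^(1/n), which exist since `F` is real
closed. -/
theorem exists_cofinal_rankClass_iff (hw1 : 1 ≤ w) (hw : ∀ c, rankClass w ≠ rankClass (i c)) :
    (∃ S : Set (ArchimedeanClass (AddUnits (ArchimedeanClass L))), S.Countable ∧
      (∀ s ∈ S, s < rankClass w ∧ ∃ c, s = rankClass (i c)) ∧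
      ∀ c, rankClass (i c) < rankClass w → ∃ s ∈ S, rankClass (i c) ≤ s) ↔
    CountableAbove i w := by
  constructor
  · rintro ⟨S, hS, h1, h2⟩
    have : ∀ s : S, ∃ c, 1 ≤ i c ∧ rankClass (i c) = s := fun s => by
      obtain ⟨c, hc⟩ := (h1 s s.2).2
      obtain ⟨d, hd1, hd⟩ := exists_one_le_rankClass_eq hi c
      exact ⟨d, hd1, hd.trans hc.symm⟩
    choose g hg1 hg using this
    have := hS.to_subtype
    have hroot : ∀ q : S × ℕ × ℕ, ∃ t, 0 ≤ t ∧ (q.2.1 ≠ 0 → q.2.2 ≠ 0 → g q.1 = q.2.2 * t ^ q.2.1) := by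
      rintro ⟨s, n, m⟩
      by_cases hn : n = 0
      · exact ⟨0, le_rfl, fun h => absurd hn h⟩
      by_cases hm : m = 0
      · exact ⟨0, le_rfl, fun _ h => absurd hm h⟩
      have hg0 : 0 ≤ g s := by
        have h0 : i 0 ≤ i (g s) := by rw [map_zero]; exact zero_le_one.trans (hg1 s)
        exact hi.le_iff_le.1 h0
      have hm' : (0 : F) < m := by exact_mod_cast Nat.pos_of_ne_zero hm
      have h0 : 0 ≤ g s / m := by positivity
      obtain ⟨t, ht⟩ := IsRealClosed.exists_eq_pow_of_nonneg h0 hn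
      obtain ⟨t', ht'0, ht'⟩ : ∃ t', 0 ≤ t' ∧ t' ^ n = g s / m := ⟨|t|, abs_nonneg t, by
        rw [← abs_pow, ← ht, abs_of_nonneg h0]⟩
      exact ⟨t', ht'0, fun _ _ => by simp only [ht']; field_simp⟩
    choose t ht0 ht using hroot
    refine ⟨{z ∈ Set.range t | w < i z}, (Set.countable_range t).mono (Set.sep_subset _ _),
      fun s hs => hs.2, fun c hc => ?_⟩
    have hc1 := hw1.trans hc.le
    have hlt := lt_of_le_of_ne (rankClass_anti hw1 hc.le) (hw c).symm
    obtain ⟨s, hs, hcs⟩ := h2 c hlt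
    have hcs' : rankClass (i c) ≤ rankClass (i (g ⟨s, hs⟩)) := by rw [hg]; exact hcs
    obtain ⟨n, m, hnm⟩ := (rankClass_le_iff hc1 (hg1 _)).1 hcs'
    have hm : m ≠ 0 := by
      rintro rfl
      rw [Nat.cast_zero, zero_mul] at hnm
      exact (zero_lt_one.trans_le (hg1 ⟨s, hs⟩)).not_ge hnm
    -- Raising the exponent is harmless because 1 ≤ `i c`, and it makes the exponent nonzero.
    have hnm' : i (g ⟨s, hs⟩) ≤ m * i c ^ (n + 1) := hnm.trans (by
      gcongr
      exact Nat.le_succ n)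
    have e := ht ⟨⟨s, hs⟩, n + 1, m⟩ (Nat.succ_ne_zero n) hm
    have hm' : (0 : F) < m := by exact_mod_cast Nat.pos_of_ne_zero hm
    refine ⟨t ⟨⟨s, hs⟩, n + 1, m⟩, ⟨⟨_, rfl⟩, ?_⟩, ?_⟩
    · by_contra! hle
      have hit0 : 0 ≤ i (t ⟨⟨s, hs⟩, n + 1, m⟩) := by
        simpa using hi.monotone (ht0 ⟨⟨s, hs⟩, n + 1, m⟩)
      have h3 : i (g ⟨s, hs⟩) ≤ m * w ^ (n + 1) := by
        rw [e]
        simp only [map_mul, map_natCast, map_pow]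
        gcongr
      have h4 := (rankClass_le_iff hw1 (hg1 ⟨s, hs⟩)).2 ⟨_, _, h3⟩
      rw [hg] at h4
      exact (h1 s hs).1.not_ge h4
    · have h5 : g ⟨s, hs⟩ ≤ m * c ^ (n + 1) := hi.le_iff_le.1 (by simpa using hnm')
      rw [e] at h5
      have h6 := le_of_mul_le_mul_left h5 hm'
      have hc0 : 0 ≤ c := hi.le_iff_le.1 (by rw [map_zero]; exact zero_le_one.trans hc1)
      exact (pow_le_pow_iff_left₀ (ht0 _) hc0 (Nat.succ_ne_zero n)).1 h6
  · rintro ⟨S, hS, h1, h2⟩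
    refine ⟨(fun s => rankClass (i s)) '' S, hS.image _, ?_, fun c hc => ?_⟩
    · rintro _ ⟨s, hs, rfl⟩
      exact ⟨lt_of_le_of_ne (rankClass_anti hw1 (h1 s hs).le) (hw s).symm, s, rfl⟩
    · obtain ⟨d, hd1, hd⟩ := exists_one_le_rankClass_eq hi c
      rw [← hd] at hc ⊢
      have hwd : w < i d := by
        by_contra! hle
        exact hc.not_ge (rankClass_anti hd1 hle)
      obtain ⟨s, hs, hsd⟩ := h2 d hwd
      exact ⟨_, ⟨s, hs, rfl⟩, rankClass_anti (hw1.trans (h1 s hs).le) (hi.monotone hsd)⟩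

/-- Classes above that of w belong to elements of [1, w); the multiples m·gⁿ of powers of class
representatives stay below w because the class of w is new, and they are cofinal there. -/
theorem exists_coinitial_rankClass_iff (hw1 : 1 ≤ w) (hw : ∀ c, rankClass w ≠ rankClass (i c)) :
    (∃ S : Set (ArchimedeanClass (AddUnits (ArchimedeanClass L))), S.Countable ∧
      (∀ s ∈ S, rankClass w < s ∧ ∃ c, s = rankClass (i c)) ∧
      ∀ c, rankClass w < rankClass (i c) → ∃ s ∈ S, s ≤ rankClass (i c)) ↔
    CountableBelow i w := by
  constructor
  · rintro ⟨S, hS, h1, h2⟩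
    have : ∀ s : S, ∃ c, 1 ≤ i c ∧ rankClass (i c) = s := fun s => by
      obtain ⟨c, hc⟩ := (h1 s s.2).2
      obtain ⟨d, hd1, hd⟩ := exists_one_le_rankClass_eq hi c
      exact ⟨d, hd1, hd.trans hc.symm⟩
    choose g hg1 hg using this
    have := hS.to_subtype
    have hlt : ∀ (s : S) (n m : ℕ), i (m * g s ^ n) < w := by
      intro s n m
      by_contra! hle
      have h3 := (rankClass_le_iff (hg1 s) hw1).2 ⟨n, m, by simpa using hle⟩
      rw [hg] at h3
      exact (h1 s s.2).1.not_ge h3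
    have key : ∀ c, 1 ≤ i c → i c < w → ∃ z ∈ Set.range fun q : S × ℕ × ℕ => q.2.2 * g q.1 ^ q.2.1,
        c ≤ z := by
      intro c hc1 hc
      obtain ⟨s, hs, hcs⟩ := h2 c (lt_of_le_of_ne (rankClass_anti hc1 hc.le) (hw c))
      have hcs' : rankClass (i (g ⟨s, hs⟩)) ≤ rankClass (i c) := by rw [hg]; exact hcs
      obtain ⟨n, m, hnm⟩ := (rankClass_le_iff (hg1 _) hc1).1 hcs'
      exact ⟨_, ⟨⟨⟨s, hs⟩, n, m⟩, rfl⟩, hi.le_iff_le.1 (by simpa using hnm)⟩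
    refine ⟨Set.range fun q : S × ℕ × ℕ => q.2.2 * g q.1 ^ q.2.1, Set.countable_range _, ?_,
      fun c hc => ?_⟩
    · rintro _ ⟨q, rfl⟩
      exact hlt _ _ _
    · rcases le_total 1 (i c) with hc1 | hc1
      · exact key c hc1 hc
      · obtain ⟨z, hz, h1z⟩ := key 1 (by simp)
          (by rw [map_one]; exact lt_of_le_of_ne hw1 fun h => hw 1 (by rw [map_one, h]))
        exact ⟨z, hz, (hi.le_iff_le.1 (by simpa using hc1)).trans h1z⟩
  · rintro ⟨S, hS, h1, h2⟩
    refine ⟨(fun s => rankClass (i s)) '' {s ∈ S | 1 ≤ s}, (hS.mono (Set.sep_subset _ _)).image _,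
      ?_, fun c hc => ?_⟩
    · rintro _ ⟨s, ⟨hs, hs1⟩, rfl⟩
      exact ⟨lt_of_le_of_ne (rankClass_anti (by simpa using hi.monotone hs1) (h1 s hs).le) (hw s),
        s, rfl⟩
    · obtain ⟨d, hd1, hd⟩ := exists_one_le_rankClass_eq hi c
      rw [← hd] at hc ⊢
      have hwd : i d < w := by
        by_contra! hle
        exact hc.not_ge (rankClass_anti hw1 hle)
      obtain ⟨s, hs, hsd⟩ := h2 d hwd
      have hd1' : 1 ≤ d := hi.le_iff_le.1 (by simpa using hd1)
      exact ⟨_, ⟨s, ⟨hs, hd1'.trans hsd⟩, rfl⟩, rankClass_anti hd1 (hi.monotone hsd)⟩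

/-- If `x` is balanced over `F`, then so is a rank class of `b * (x - a)` that is new over `F`. -/
theorem CountablyBalanced.rankClass_iff {x : L} (hx : CountablyBalanced i x) {a b : F} (hb : b ≠ 0)
    (hw : ∀ c, rankClass (i b * (x - i a)) ≠ rankClass (i c)) :
    (∃ S : Set (ArchimedeanClass (AddUnits (ArchimedeanClass L))), S.Countable ∧
      (∀ s ∈ S, s < rankClass (i b * (x - i a)) ∧ ∃ c, s = rankClass (i c)) ∧
      ∀ c, rankClass (i c) < rankClass (i b * (x - i a)) → ∃ s ∈ S, rankClass (i c) ≤ s) ↔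
    (∃ S : Set (ArchimedeanClass (AddUnits (ArchimedeanClass L))), S.Countable ∧
      (∀ s ∈ S, rankClass (i b * (x - i a)) < s ∧ ∃ c, s = rankClass (i c)) ∧
      ∀ c, rankClass (i b * (x - i a)) < rankClass (i c) → ∃ s ∈ S, s ≤ rankClass (i c)) := by
  have hw0 : i b * (x - i a) ≠ 0 := fun h => hw 0 (by rw [h, map_zero])
  -- Affine changes, sign changes and inversion preserve balance, so b(x - a) can be replaced by an
  -- element at least 1 of the same rank class.
  obtain ⟨z, hz1, hz, hzw⟩ := exists_one_le_of_inv_neg (P := CountablyBalanced i) hw0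
    ((hx.sub a).mul hi hb) (fun z hz h => h.inv hi hz) (fun z h => h.neg)
  rw [← hzw] at hw ⊢
  rw [exists_cofinal_rankClass_iff hi hz1 hw, exists_coinitial_rankClass_iff hi hz1 hw]
  exact hz.symm

end Balanced

/-! ### Cofinalities and monotone sequences. -/

section Cofinality

/-- A linear order has a strictly increasing cofinal sequence indexed by its cofinality. -/
theorem Order.exists_strictMono_isCofinal_range {X : Type u} [LinearOrder X] {κ : Cardinal.{u}}
    (hκ : Order.cof X = κ) : ∃ f : κ.ord.ToType → X, StrictMono f ∧ IsCofinal (Set.range f) := by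
  subst hκ
  obtain ⟨S, hS, hScard⟩ := Order.exists_cof_eq X
  obtain ⟨e⟩ : Nonempty ((Order.cof X).ord.ToType ≃ S) := by
    rw [← Cardinal.eq, Cardinal.mk_ord_toType, hScard]
  have h : ∀ s : Set X, #s < Order.cof X → ∃ b, ∀ x ∈ s, x < b := fun s hs =>
    (not_isCofinal_iff).1 fun hc => (Order.cof_le hc).not_gt hs
  choose b hb using h
  have hIio : ∀ i : (Order.cof X).ord.ToType, #(Set.Iio i) < Order.cof X := fun i =>
    (Cardinal.mk_Iio_lt i (by rw [Cardinal.mk_ord_toType, Ordinal.type_toType])).trans_eq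
      (Cardinal.mk_ord_toType _)
  let G : ∀ i : (Order.cof X).ord.ToType, (∀ j, j < i → X) → X := fun i g =>
    max (b (Set.range fun j : Set.Iio i => g j.1 j.2) (Cardinal.mk_range_le.trans_lt (hIio i))) (e i)
  refine ⟨wellFounded_lt.fix G, fun i j hij => ?_, fun x => ?_⟩
  · rw [wellFounded_lt.fix_eq G j]
    exact lt_max_of_lt_left (hb _ _ _ ⟨⟨i, hij⟩, rfl⟩)
  · obtain ⟨s, hs, hxs⟩ := hS x
    refine ⟨_, ⟨e.symm ⟨s, hs⟩, rfl⟩, hxs.trans ?_⟩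
    rw [wellFounded_lt.fix_eq G]
    exact le_max_of_le_right (by simp)

/-- Choose for each t in a minimal cofinal set an index whose g-value is at least t. These indices
suffice for h: as `Y` has no maximum, they surpass any given index, even if g is not strictly
monotone. -/
theorem Order.cof_le_of_monotone {I : Type*} [LinearOrder I] {Y Z : Type u} [LinearOrder Y]
    [LinearOrder Z] [NoMaxOrder Y] {g : I → Y} {h : I → Z} (hg : Monotone g)
    (hg' : IsCofinal (Set.range g)) (hh : Monotone h) (hh' : IsCofinal (Set.range h)) :
    Order.cof Z ≤ Order.cof Y := by
  obtain ⟨T, hT, hTc⟩ := Order.exists_cof_eq Y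
  have : ∀ t : T, ∃ i, (t : Y) ≤ g i := fun t => by
    obtain ⟨_, ⟨i, rfl⟩, hi⟩ := hg' t
    exact ⟨i, hi⟩
  choose k hk using this
  rw [← hTc]
  refine (Order.cof_le (s := Set.range fun t => h (k t)) fun z => ?_).trans Cardinal.mk_range_le
  obtain ⟨_, ⟨i, rfl⟩, hi⟩ := hh' z
  obtain ⟨y, hy⟩ := exists_gt (g i)
  obtain ⟨t, ht, hyt⟩ := hT y
  exact ⟨_, ⟨⟨t, ht⟩, rfl⟩, hi.trans (hh (hg.reflect_lt (hy.trans_le (hyt.trans (hk ⟨t, ht⟩)))).le)⟩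

theorem Order.cof_eq_of_monotone {I : Type*} [LinearOrder I] {Y Z : Type u} [LinearOrder Y]
    [LinearOrder Z] [NoMaxOrder Y] [NoMaxOrder Z] {g : I → Y} {h : I → Z} (hg : Monotone g)
    (hg' : IsCofinal (Set.range g)) (hh : Monotone h) (hh' : IsCofinal (Set.range h)) :
    Order.cof Y = Order.cof Z :=
  (Order.cof_le_of_monotone hh hh' hg hg').antisymm (Order.cof_le_of_monotone hg hg' hh hh')

theorem Order.exists_countable_isCofinal_iff {X : Type u} [LinearOrder X] :
    (∃ S : Set X, S.Countable ∧ IsCofinal S) ↔ Order.cof X ≤ ℵ₀ := by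
  constructor
  · rintro ⟨S, hS, hc⟩
    exact (Order.cof_le hc).trans (Cardinal.le_aleph0_iff_set_countable.2 hS)
  · intro h
    obtain ⟨S, hS, hc⟩ := Order.exists_cof_eq X
    exact ⟨S, Cardinal.le_aleph0_iff_set_countable.1 (hc.trans_le h), hS⟩

end Cofinality

namespace OrderCut

variable {F : Type u} [LinearOrder F] {C : OrderCut F}

theorem mem_or_mem (C : OrderCut F) (x : F) : x ∈ C.lower ∨ x ∈ C.upper := by
  have h : x ∈ C.lower ∪ C.upper := by rw [C.union_eq]; trivial
  exact h

theorem IsDedekind.noMaxOrder_lower (h : C.IsDedekind) : NoMaxOrder C.lower where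
  exists_gt a := by
    by_contra! hcon
    exact h.no_max a ⟨a.2, fun b hb => hcon ⟨b, hb⟩⟩

theorem IsDedekind.noMaxOrder_upper (h : C.IsDedekind) : NoMaxOrder (C.upper)ᵒᵈ where
  exists_gt a := by
    by_contra! hcon
    exact h.no_min (OrderDual.ofDual a : C.upper) ⟨(OrderDual.ofDual a).2,
      fun b hb => hcon (OrderDual.toDual ⟨b, hb⟩)⟩

/-- The cut whose lower part is the lower closure of a set. -/
def ofLower (s : Set F) : OrderCut F where
  lower := {x | ∃ a ∈ s, x ≤ a}
  upper := {x | ∀ a ∈ s, a < x}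
  union_eq := by
    ext x
    by_cases h : ∃ a ∈ s, x ≤ a
    · simp only [Set.mem_union, Set.mem_ofPred_eq, Set.mem_univ, iff_true]; exact .inl h
    · simp only [Set.mem_union, Set.mem_ofPred_eq, Set.mem_univ, iff_true]
      push Not at h; exact .inr h
  lower_lt_upper := by
    rintro x ⟨a, ha, hxa⟩ y hy
    exact hxa.trans_lt (hy a ha)

end OrderCut

/-! ### Symmetric completeness and nested intervals. -/

section NestedIntervals

variable {F : Type u} [LinearOrder F] [Nonempty F]

theorem IsSymmetricallyComplete.hasNestedIntervalProperty (h : IsSymmetricallyComplete F) :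
    HasNestedIntervalProperty F := by
  intro o a b hab hdec
  have ha : Monotone a := fun i j hij => (hdec i j hij ⟨le_rfl, hab j⟩).1
  have hb : Antitone b := fun i j hij => (hdec i j hij ⟨hab j, le_rfl⟩).2
  have hle : ∀ i j, a i ≤ b j := fun i j => by
    rcases le_total i j with hij | hij
    · exact (ha hij).trans (hab j)
    · exact (hab i).trans (hb hij)
  by_contra hempty
  have hno : ∀ x, ¬ ∀ i, a i ≤ x ∧ x ≤ b i := fun x hx => hempty ⟨x, by simpa using hx⟩
  obtain ⟨i₀⟩ : Nonempty (Set.Iio o) := by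
    by_contra hne
    rw [not_nonempty_iff] at hne
    exact hno (Classical.arbitrary F) fun i => isEmptyElim i
  -- A largest left endpoint would lie in every interval; likewise a smallest right endpoint.
  have hgta : ∀ i, ∃ j, a i < a j := fun i => by
    by_contra! hcon
    exact hno (a i) fun j => ⟨hcon j, hle i j⟩
  have hltb : ∀ i, ∃ j, b j < b i := fun i => by
    by_contra! hcon
    exact hno (b i) fun j => ⟨hle j i, hcon j⟩
  let C := OrderCut.ofLower (Set.range a)
  have hbC : ∀ i, b i ∈ C.upper := by
    rintro i _ ⟨j, rfl⟩
    obtain ⟨k, hk⟩ := hgta j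
    exact hk.trans_le (hle k i)
  have haC : ∀ i, a i ∈ C.lower := fun i => ⟨a i, ⟨i, rfl⟩, le_rfl⟩
  have hup : ∀ x ∈ C.upper, ∃ i, b i ≤ x := by
    intro x hx
    by_contra! hcon
    exact hno x fun i => ⟨(hx _ ⟨i, rfl⟩).le, (hcon i).le⟩
  have hC : C.IsDedekind := by
    refine ⟨⟨_, haC i₀⟩, ⟨_, hbC i₀⟩, ?_, ?_⟩
    · rintro x ⟨⟨_, ⟨i, rfl⟩, hxi⟩, hx2⟩
      obtain ⟨j, hj⟩ := hgta i
      exact (hx2 (haC j)).not_gt (hxi.trans_lt hj)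
    · rintro x ⟨hx1, hx2⟩
      obtain ⟨i, hi⟩ := hup x hx1
      obtain ⟨j, hj⟩ := hltb i
      exact (hx2 (hbC j)).not_gt (hj.trans_le hi)
  refine h C hC ?_
  have := hC.noMaxOrder_lower
  have := hC.noMaxOrder_upper
  refine Order.cof_eq_of_monotone (g := fun i => (⟨a i, haC i⟩ : C.lower))
    (h := fun i => OrderDual.toDual (⟨b i, hbC i⟩ : C.upper)) (fun i j hij => ha hij) ?_
    (fun i j hij => hb hij) ?_
  · rintro ⟨x, _, ⟨i, rfl⟩, hxi⟩
    exact ⟨_, ⟨i, rfl⟩, hxi⟩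
  · rintro ⟨x, hx⟩
    obtain ⟨i, hi⟩ := hup x hx
    exact ⟨_, ⟨i, rfl⟩, hi⟩

theorem HasNestedIntervalProperty.isSymmetricallyComplete (h : HasNestedIntervalProperty F) :
    IsSymmetricallyComplete F := by
  intro C hC hsymm
  obtain ⟨f, hf, hf'⟩ := Order.exists_strictMono_isCofinal_range (X := C.lower) rfl
  obtain ⟨g, hg, hg'⟩ := Order.exists_strictMono_isCofinal_range (X := (C.upper)ᵒᵈ)
    (κ := Order.cof C.lower) (Eq.symm hsymm)
  have := hC.noMaxOrder_lower
  have := hC.noMaxOrder_upper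
  obtain ⟨x, hx⟩ := h (Order.cof C.lower).ord (fun i => (f (Ordinal.ToType.mk i) : F))
    (fun i => ((OrderDual.ofDual (g (Ordinal.ToType.mk i)) : C.upper) : F))
    (fun i => (C.lower_lt_upper _ (Subtype.prop _) _ (Subtype.prop _)).le)
    (fun i j hij => Set.Icc_subset_Icc (hf.monotone (Ordinal.ToType.mk.monotone hij))
      (hg.monotone (Ordinal.ToType.mk.monotone hij)))
  have hx : ∀ i, (f i : F) ≤ x ∧ x ≤ (OrderDual.ofDual (g i) : C.upper) := fun i => by
    simpa using Set.mem_iInter.1 hx (Ordinal.ToType.mk.symm i)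
  rcases C.mem_or_mem x with h1 | h1
  · obtain ⟨y, hy⟩ := exists_gt (⟨x, h1⟩ : C.lower)
    obtain ⟨_, ⟨i, rfl⟩, hi⟩ := hf' y
    exact (hx i).1.not_gt (hy.trans_le hi)
  · obtain ⟨y, hy⟩ := exists_gt (OrderDual.toDual (⟨x, h1⟩ : C.upper))
    obtain ⟨_, ⟨i, rfl⟩, hi⟩ := hg' y
    exact (hx i).2.not_gt (hy.trans_le hi)

theorem isSymmetricallyComplete_iff_hasNestedIntervalProperty :
    IsSymmetricallyComplete F ↔ HasNestedIntervalProperty F :=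
  ⟨fun h => h.hasNestedIntervalProperty, fun h => h.isSymmetricallyComplete⟩

end NestedIntervals

/-! ### Filling symmetric cuts in a symmetrically complete order. -/

section Fill

/-- A symmetrically complete order fills the image of every symmetric Dedekind cut. -/
theorem IsSymmetricallyComplete.exists_between {F : Type u} {M : Type v} [LinearOrder F]
    [LinearOrder M] (hM : IsSymmetricallyComplete M) {C : OrderCut F} (hC : C.IsDedekind)
    (hsymm : C.IsSymmetric) {f : F → M} (hf : StrictMono f) :
    ∃ m, (∀ a ∈ C.lower, f a < m) ∧ ∀ b ∈ C.upper, m < f b := by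
  by_contra! hcon
  let D := OrderCut.ofLower (f '' C.lower)
  have hlow : ∀ a ∈ C.lower, f a ∈ D.lower := fun a ha => ⟨f a, ⟨a, ha, rfl⟩, le_rfl⟩
  have hupp : ∀ b ∈ C.upper, f b ∈ D.upper := by
    rintro b hb _ ⟨a, ha, rfl⟩
    exact hf (C.lower_lt_upper a ha b hb)
  have hup : ∀ x ∈ D.upper, ∃ b ∈ C.upper, f b ≤ x := fun x hx =>
    hcon x fun a ha => hx _ ⟨a, ha, rfl⟩
  have := hC.noMaxOrder_lower
  have := hC.noMaxOrder_upper
  have hD : D.IsDedekind := by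
    refine ⟨?_, ?_, ?_, ?_⟩
    · obtain ⟨a, ha⟩ := hC.lower_nonempty
      exact ⟨_, hlow a ha⟩
    · obtain ⟨b, hb⟩ := hC.upper_nonempty
      exact ⟨_, hupp b hb⟩
    · rintro x ⟨⟨_, ⟨a, ha, rfl⟩, hxa⟩, hx2⟩
      obtain ⟨a', ha'⟩ := exists_gt (⟨a, ha⟩ : C.lower)
      exact (hx2 (hlow a' a'.2)).not_gt (hxa.trans_lt (hf ha'))
    · rintro x ⟨hx1, hx2⟩
      obtain ⟨b, hb, hbx⟩ := hup x hx1
      obtain ⟨b', hb'⟩ := exists_gt (OrderDual.toDual (⟨b, hb⟩ : C.upper))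
      exact (hx2 (hupp _ (OrderDual.ofDual b').2)).not_gt ((hf hb').trans_le hbx)
  refine hM D hD ?_
  have h1 := Order.lift_cof_congr_of_strictMono (f := fun a : C.lower =>
    (⟨f a, hlow a a.2⟩ : D.lower)) (fun a b hab => hf hab) (by
      rintro ⟨x, _, ⟨a, ha, rfl⟩, hxa⟩
      exact ⟨_, ⟨⟨a, ha⟩, rfl⟩, hxa⟩)
  have h2 := Order.lift_cof_congr_of_strictMono (f := fun a : (C.upper)ᵒᵈ =>
    OrderDual.toDual (⟨f (OrderDual.ofDual a : C.upper), hupp _ (OrderDual.ofDual a : C.upper).2⟩ :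
      D.upper))
    (fun a b hab => hf hab) (by
      rintro ⟨x, hx⟩
      obtain ⟨b, hb, hbx⟩ := hup x hx
      exact ⟨_, ⟨OrderDual.toDual ⟨b, hb⟩, rfl⟩, hbx⟩)
  have h3 : Order.cof C.lower = Order.cof (C.upper)ᵒᵈ := hsymm
  rw [h3, h2] at h1
  exact (Cardinal.lift_injective h1).symm

variable {F L : Type u} [Field F] [LinearOrder F] [IsStrictOrderedRing F]
  [Field L] [LinearOrder L] [IsStrictOrderedRing L] {i : F →+* L} {x : L} {C : OrderCut F}

/-- Only this consequence of symmetry, namely that both cofinalities are countable or neither is,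
enters the cardinality bound. -/
theorem OrderCut.IsSymmetric.countablyBalanced (hsymm : C.IsSymmetric)
    (hl : ∀ a ∈ C.lower, i a < x) (hu : ∀ b ∈ C.upper, x < i b) : CountablyBalanced i x := by
  have hl' : ∀ a, i a < x ↔ a ∈ C.lower := fun a =>
    ⟨fun h => (C.mem_or_mem a).resolve_right fun h' => (hu a h').not_gt h, hl a⟩
  have hu' : ∀ a, x < i a ↔ a ∈ C.upper := fun a =>
    ⟨fun h => (C.mem_or_mem a).resolve_left fun h' => (hl a h').not_gt h, hu a⟩
  have h1 : CountableBelow i x ↔ ∃ S : Set C.lower, S.Countable ∧ IsCofinal S := by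
    constructor
    · rintro ⟨S, hS, h1, h2⟩
      refine ⟨Subtype.val ⁻¹' S, hS.preimage Subtype.val_injective, fun a => ?_⟩
      obtain ⟨s, hs, has⟩ := h2 a ((hl' _).2 a.2)
      exact ⟨⟨s, (hl' s).1 (h1 s hs)⟩, hs, has⟩
    · rintro ⟨S, hS, h⟩
      refine ⟨Subtype.val '' S, hS.image _, ?_, fun a ha => ?_⟩
      · rintro _ ⟨s, -, rfl⟩
        exact (hl' _).2 s.2
      · obtain ⟨s, hs, has⟩ := h ⟨a, (hl' a).1 ha⟩
        exact ⟨_, ⟨s, hs, rfl⟩, has⟩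
  have h2 : CountableAbove i x ↔ ∃ S : Set (C.upper)ᵒᵈ, S.Countable ∧ IsCofinal S := by
    constructor
    · rintro ⟨S, hS, h1, h2⟩
      refine ⟨(fun b : (C.upper)ᵒᵈ => ((OrderDual.ofDual b : C.upper) : F)) ⁻¹' S,
        hS.preimage (Subtype.val_injective.comp OrderDual.ofDual.injective), fun a => ?_⟩
      obtain ⟨s, hs, has⟩ := h2 (OrderDual.ofDual a).1 ((hu' _).2 (OrderDual.ofDual a).2)
      exact ⟨OrderDual.toDual ⟨s, (hu' s).1 (h1 s hs)⟩, hs, has⟩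
    · rintro ⟨S, hS, h⟩
      refine ⟨(fun b : (C.upper)ᵒᵈ => ((OrderDual.ofDual b : C.upper) : F)) '' S, hS.image _, ?_,
        fun a ha => ?_⟩
      · rintro _ ⟨s, -, rfl⟩
        exact (hu' _).2 (OrderDual.ofDual s).2
      · obtain ⟨s, hs, has⟩ := h (OrderDual.toDual ⟨a, (hu' a).1 ha⟩)
        exact ⟨_, ⟨s, hs, rfl⟩, has⟩
  rw [CountablyBalanced, h1, h2, Order.exists_countable_isCofinal_iff,
    Order.exists_countable_isCofinal_iff]
  have h3 : Order.cof C.lower = Order.cof (C.upper)ᵒᵈ := hsymm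
  rw [h3]

end Fill

/-! ### Extending embeddings over a filled cut. -/

section SameCut

theorem mul_pos_iff_pos_iff_pos {R : Type*} [Field R] [LinearOrder R] [IsStrictOrderedRing R]
    {s t : R} (hs : s ≠ 0) (ht : t ≠ 0) : 0 < s * t ↔ (0 < s ↔ 0 < t) := by
  rcases lt_or_gt_of_ne hs with h | h <;> rcases lt_or_gt_of_ne ht with h' | h'
  · exact iff_of_true (mul_pos_of_neg_of_neg h h') (iff_of_false h.not_gt h'.not_gt)
  · exact iff_of_false (mul_neg_of_neg_of_pos h h').not_gt fun e => h.not_gt (e.2 h')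
  · exact iff_of_false (mul_neg_of_pos_of_neg h h').not_gt fun e => h'.not_gt (e.1 h)
  · exact iff_of_true (mul_pos h h') (iff_of_true h h')

variable {F : Type u} {S : Type u} {M : Type v} [Field F] [LinearOrder F] [IsStrictOrderedRing F]
  [IsRealClosed F] [Field S] [LinearOrder S] [IsStrictOrderedRing S]
  [Field M] [LinearOrder M] [IsStrictOrderedRing M]
  {i : F →+* S} {x : S} {j : F →+* M} {m : M}

/-- The signs of linear factors are given by the cut, and the quadratic factors are positive. -/
theorem eval₂_pos_iff_of_sameCut (hx : x ∉ Set.range i) (hm : m ∉ Set.range j)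
    (hcut : ∀ a, i a < x ↔ j a < m) {p : F[X]} (hp : p ≠ 0) :
    0 < p.eval₂ i x ↔ 0 < p.eval₂ j m := by
  refine (IsRealClosed.polynomial_induction (P := fun p => (p.eval₂ i x ≠ 0 ∧ p.eval₂ j m ≠ 0) ∧
    (0 < p.eval₂ i x ↔ 0 < p.eval₂ j m)) ?_ ?_ ?_ ?_ hp).2
  · intro c hc
    have h1 : 0 < i c ↔ 0 < c := by
      rw [← map_zero i, (IsRealClosed.strictMono_ringHom i).lt_iff_lt]
    have h2 : 0 < j c ↔ 0 < c := by
      rw [← map_zero j, (IsRealClosed.strictMono_ringHom j).lt_iff_lt]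
    simpa [hc] using h1.trans h2.symm
  · intro a
    refine ⟨⟨eval₂_ne_zero_of_notMem hx (X_sub_C_ne_zero a),
      eval₂_ne_zero_of_notMem hm (X_sub_C_ne_zero a)⟩, ?_⟩
    simpa using hcut a
  · intro a d hd
    rw [eval₂_quadratic, eval₂_quadratic]
    have h1 : i d ≠ 0 := by simpa using hd
    have h2 : j d ≠ 0 := by simpa using hd
    have h3 : 0 < (x - i a) ^ 2 + i d ^ 2 := by positivity
    have h4 : 0 < (m - j a) ^ 2 + j d ^ 2 := by positivity
    exact ⟨⟨h3.ne', h4.ne'⟩, iff_of_true h3 h4⟩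
  · rintro p q ⟨⟨hp1, hp2⟩, hp⟩ ⟨⟨hq1, hq2⟩, hq⟩
    rw [eval₂_mul, eval₂_mul]
    refine ⟨⟨mul_ne_zero hp1 hq1, mul_ne_zero hp2 hq2⟩, ?_⟩
    rw [mul_pos_iff_pos_iff_pos hp1 hq1, mul_pos_iff_pos_iff_pos hp2 hq2, hp, hq]

/-- A homomorphism into a real closed field extends to an algebraic real closed extension of a
simple transcendental extension, if the cut of the generator is filled. -/
theorem exists_extension_of_sameCut [IsRealClosed S] [IsRealClosed M]
    (hx : x ∉ Set.range i) (hm : m ∉ Set.range j) (hcut : ∀ a, i a < x ↔ j a < m)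
    (halg : ∀ y, AlgOver i x y) : ∃ ψ : S →+* M, ∀ a, ψ (i a) = j a := by
  let gS : FractionRing F[X] →+* S :=
    IsFractionRing.lift (g := eval₂RingHom i x) (eval₂RingHom_injective_of_notMem hx)
  let gM : FractionRing F[X] →+* M :=
    IsFractionRing.lift (g := eval₂RingHom j m) (eval₂RingHom_injective_of_notMem hm)
  have hgS : ∀ p, gS (algebraMap F[X] _ p) = p.eval₂ i x := fun p => IsFractionRing.lift_algebraMap _ _
  have hgM : ∀ p, gM (algebraMap F[X] _ p) = p.eval₂ j m := fun p => IsFractionRing.lift_algebraMap _ _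
  algebraize [gS]
  have : Algebra.IsAlgebraic (FractionRing F[X]) S := by
    refine ⟨fun y => ?_⟩
    obtain ⟨P, hP, hPy⟩ := halg y
    refine ⟨P.map (algebraMap F[X] (FractionRing F[X])), ?_, ?_⟩
    · rwa [Ne, Polynomial.map_eq_zero_iff (IsFractionRing.injective _ _)]
    · rw [aeval_def, eval₂_map, ← hPy]
      congr 1
      ext p
      · simp [RingHom.algebraMap_toAlgebra, hgS]
      · simp [RingHom.algebraMap_toAlgebra, hgS]
  obtain ⟨ψ, hψ⟩ := exists_extension_of_isAlgebraic (R := S) gM fun c hc => by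
    obtain ⟨p, q, hq, rfl⟩ := IsFractionRing.div_surjective (A := F[X]) c
    have hq0 : q ≠ 0 := nonZeroDivisors.ne_zero hq
    rcases eq_or_ne p 0 with rfl | hp0
    · simp
    have h1 : 0 ≤ p.eval₂ i x / q.eval₂ i x := by
      rw [← hgS, ← hgS, ← map_div₀]; exact hc
    rw [map_div₀, hgM, hgM]
    have hpS := eval₂_ne_zero_of_notMem hx hp0
    have hqS := eval₂_ne_zero_of_notMem hx hq0
    -- The sign of p/q is that of the polynomial pq.
    have h2 : 0 < (p * q).eval₂ i x := by
      rw [eval₂_mul]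
      have h3 := div_mul_cancel₀ (p.eval₂ i x) hqS
      have h4 : p.eval₂ i x * q.eval₂ i x = p.eval₂ i x / q.eval₂ i x * (q.eval₂ i x) ^ 2 := by
        field_simp
      rw [h4]
      have h5 : p.eval₂ i x / q.eval₂ i x ≠ 0 := div_ne_zero hpS hqS
      have h6 := lt_of_le_of_ne h1 h5.symm
      positivity
    rw [eval₂_pos_iff_of_sameCut hx hm hcut (mul_ne_zero hp0 hq0), eval₂_mul] at h2
    rcases pos_and_pos_or_neg_and_neg_of_mul_pos h2 with ⟨h, h'⟩ | ⟨h, h'⟩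
    · positivity
    · exact (div_pos_of_neg_of_neg h h').le
  refine ⟨ψ, fun a => ?_⟩
  have h1 := hψ (algebraMap F[X] _ (C a))
  rw [hgM, eval₂_C] at h1
  rw [← h1]
  congr 1
  exact ((hgS (C a)).trans (eval₂_C _ _)).symm

end SameCut

section AlgOverMap

variable {F L L' : Type*} [Field F] [Field L] [Field L'] {i : F →+* L} {x y : L}

theorem algOver_map_iff (f : L →+* L') : AlgOver (f.comp i) (f x) (f y) ↔ AlgOver i x y := by
  refine exists_congr fun P => and_congr_right fun _ => ?_
  have h : eval₂RingHom (f.comp i) (f x) = f.comp (eval₂RingHom i x) := by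
    ext <;> simp
  rw [h, ← hom_eval₂, map_eq_zero]

end AlgOverMap

section RelativelyClosed

/-- A subfield of a real closed field that contains every element algebraic over it is real
closed. -/
theorem IsRealClosed.of_isAlgebraic_mem {R : Type*} [Field R] [IsRealClosed R] (A : Subfield R)
    (hA : ∀ x : R, IsAlgebraic A x → x ∈ A) : IsRealClosed A where
  one_add_ne_zero {s} hs h := by
    have hs' : ∀ t : A, IsSumSq t → IsSumSq (t : R) := by
      intro t ht
      induction ht with
      | zero => exact IsSumSq.zero
      | sq_add a _ ih => exact IsSumSq.sq_add (a : R) ih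
    exact IsSemireal.one_add_ne_zero (hs' s hs) (by exact_mod_cast congrArg Subtype.val h)
  isSquare_or_isSquare_neg x := by
    have key : ∀ y : A, IsSquare (y : R) → IsSquare y := by
      rintro y ⟨z, hz⟩
      have hz' : z ∈ A := by
        refine hA z ⟨X ^ 2 - C y, X_pow_sub_C_ne_zero two_pos y, ?_⟩
        simp only [map_sub, map_pow, aeval_X, aeval_C]
        rw [sq, ← hz]
        exact sub_self _
      exact ⟨⟨z, hz'⟩, Subtype.ext hz⟩
    rcases isSquare_or_isSquare_neg (x : R) with h | h
    · exact .inl (key x h)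
    · exact .inr (key (-x) (by simpa using h))
  exists_isRoot_of_odd_natDegree {f} hf := by
    have hf0 : f ≠ 0 := by rintro rfl; simp at hf
    obtain ⟨x, hx⟩ := exists_isRoot_of_odd_natDegree (f := f.map A.subtype)
      (by rwa [natDegree_map])
    have hx' : eval₂ A.subtype x f = 0 := by rwa [IsRoot.def, eval_map] at hx
    refine ⟨⟨x, hA x ⟨f, hf0, hx'⟩⟩, ?_⟩
    rw [IsRoot.def]
    apply Subtype.ext
    have h := hom_eval₂ f (RingHom.id A) A.subtype ⟨x, hA x ⟨f, hf0, hx'⟩⟩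
    rw [RingHom.comp_id] at h
    exact h.trans hx'

end RelativelyClosed

/-! ### Realizing a Dedekind cut in a real closed extension. -/

section Realize

variable {F : Type u} [Field F] [LinearOrder F] [IsStrictOrderedRing F]

/-- Every Dedekind cut is filled in some real closed extension. -/
theorem OrderCut.IsDedekind.exists_realClosed_fill {C : OrderCut F} (hC : C.IsDedekind) :
    ∃ (R : Type u) (_ : Field R) (_ : LinearOrder R) (_ : IsStrictOrderedRing R) (i : F →+* R)
      (x : R), IsRealClosed R ∧ (∀ a ∈ C.lower, i a < x) ∧ ∀ b ∈ C.upper, x < i b := by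
  have : Nonempty C.lower := hC.lower_nonempty.to_subtype
  have := hC.noMaxOrder_lower
  -- In the ultrapower over the lower part, the germ of the inclusion exceeds each lower element,
  -- since the ultrafilter contains all final segments, and stays below each upper element.
  let U : Ultrafilter C.lower := Ultrafilter.of Filter.atTop
  have hU : (U : Filter C.lower) ≤ Filter.atTop := Ultrafilter.of_le _
  let G := Filter.Germ (U : Filter C.lower) F
  let j : F →+* G :=
    { toFun := fun a => (a : G)
      map_one' := rfl
      map_zero' := rfl
      map_add' := fun _ _ => rfl
      map_mul' := fun _ _ => rfl }
  let t : G := Filter.Germ.ofFun fun a : C.lower => (a : F)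
  have h1 : ∀ a ∈ C.lower, j a < t := fun a ha =>
    Filter.Germ.coe_lt.2 (hU (Filter.eventually_gt_atTop (⟨a, ha⟩ : C.lower)))
  have h2 : ∀ b ∈ C.upper, t < j b := fun b hb =>
    Filter.Germ.coe_lt.2 (Filter.Eventually.of_forall fun a => C.lower_lt_upper a a.2 b hb)
  obtain ⟨E, hE, hsq⟩ := exists_isRealClosed_intermediateField G (AlgebraicClosure G)
  let := IsRealClosed.linearOrder E
  have : IsStrictOrderedRing E := IsRealClosed.isStrictOrderedRing E
  have hmono : StrictMono (algebraMap G E) := by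
    intro a b hab
    have h := (hsq (b - a) (sub_nonneg.2 hab.le)).nonneg
    rw [map_sub, sub_nonneg] at h
    exact lt_of_le_of_ne h ((algebraMap G E).injective.ne hab.ne)
  exact ⟨E, inferInstance, inferInstance, inferInstance, (algebraMap G E).comp j, algebraMap G E t,
    hE, fun a ha => hmono (h1 a ha), fun b hb => hmono (h2 b hb)⟩

/-- Every Dedekind cut of a real closed field is filled by an element `x` of a real closed extension
algebraic over `F(x)`. -/
theorem OrderCut.IsDedekind.exists_algOver_fill [IsRealClosed F] {C : OrderCut F}
    (hC : C.IsDedekind) :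
    ∃ (R : Type u) (_ : Field R) (_ : LinearOrder R) (_ : IsStrictOrderedRing R) (i : F →+* R)
      (x : R), IsRealClosed R ∧ (∀ a ∈ C.lower, i a < x) ∧ (∀ b ∈ C.upper, x < i b) ∧
        ∀ y, AlgOver i x y := by
  obtain ⟨R, _, _, _, i, x, hR, h1, h2⟩ := hC.exists_realClosed_fill
  have hx : x ∉ Set.range i := by
    rintro ⟨a, rfl⟩
    rcases C.mem_or_mem a with h | h
    · exact (h1 a h).false
    · exact (h2 a h).false
  let g : FractionRing F[X] →+* R :=
    IsFractionRing.lift (g := eval₂RingHom i x) (eval₂RingHom_injective_of_notMem hx)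
  have hg : ∀ p, g (algebraMap F[X] _ p) = p.eval₂ i x := fun p => IsFractionRing.lift_algebraMap _ _
  algebraize [g, eval₂RingHom i x]
  have : IsScalarTower F[X] (FractionRing F[X]) R := IsScalarTower.of_algebraMap_eq fun p => (hg p).symm
  -- The relative algebraic closure of F(x) in `R` is still real closed and is algebraic over F(x).
  let A := algebraicClosure (FractionRing F[X]) R
  have hA : IsRealClosed A := by
    refine IsRealClosed.of_isAlgebraic_mem A.toSubfield fun y hy => ?_
    have hy : IsAlgebraic A y := hy
    exact mem_algebraicClosure_iff.2 (hy.restrictScalars (FractionRing F[X]))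
  have hmem : ∀ p : F[X], p.eval₂ i x ∈ A := fun p => by
    rw [← hg]; exact A.algebraMap_mem _
  let i' : F →+* A := i.codRestrict A fun a => by simpa using hmem (Polynomial.C a)
  refine ⟨A, inferInstance, inferInstance, inferInstance, i', ⟨x, by simpa using hmem X⟩, hA, h1, h2,
    fun y => ?_⟩
  rw [← algOver_map_iff A.val.toRingHom]
  have hy : IsAlgebraic F[X] (y : R) :=
    (IsFractionRing.isAlgebraic_iff F[X] (FractionRing F[X]) R).2 (mem_algebraicClosure_iff.1 y.2)
  obtain ⟨P, hP, hPy⟩ := hy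
  exact ⟨P, hP, hPy⟩

end Realize

/-! ### Filling cuts inside a fixed algebraically closed field. -/

section Embed

variable {Ω : Type u} [Field Ω] [IsAlgClosed Ω]

theorem exists_ringHom_of_algOver {F R : Type u} [Field F] [Field R] {i : F →+* R} {x : R}
    (hx : Function.Injective (eval₂RingHom i x)) (halg : ∀ y, AlgOver i x y) {f : F →+* Ω} {t : Ω}
    (ht : Function.Injective (eval₂RingHom f t)) :
    ∃ φ : R →+* Ω, (∀ a, φ (i a) = f a) ∧ φ x = t := by
  algebraize [eval₂RingHom i x, eval₂RingHom f t]
  have : Algebra.IsAlgebraic F[X] R := ⟨fun y => halg y⟩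
  have : FaithfulSMul F[X] R := (faithfulSMul_iff_algebraMap_injective _ _).2 hx
  have : FaithfulSMul F[X] Ω := (faithfulSMul_iff_algebraMap_injective _ _).2 ht
  let φ : R →ₐ[F[X]] Ω := IsAlgClosed.lift
  have hφ : ∀ p : F[X], φ (p.eval₂ i x) = p.eval₂ f t := fun p => φ.commutes p
  exact ⟨φ, fun a => by simpa using hφ (C a), by simpa using hφ X⟩

theorem exists_transcendental_of_mk_lt {F : Subfield Ω} [Infinite F] (hF : #F < #Ω) :
    ∃ t : Ω, Transcendental F t := by
  by_contra! hcon
  have : Algebra.IsAlgebraic F Ω := ⟨fun t => by simpa [Transcendental] using hcon t⟩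
  have h := Algebra.IsAlgebraic.cardinalMk_le_max F Ω
  rw [max_eq_left (Cardinal.aleph0_le_mk F)] at h
  exact h.not_gt hF

/-- `S` is a real closed subfield containing `F` and an element `x` that fills a symmetric Dedekind
cut of the real closed field `F`, and `S` is algebraic over `F(x)`. -/
def FillsSymmetricCut (F S : Subfield Ω) : Prop :=
  ∃ (_ : IsRealClosed F) (_ : IsRealClosed S) (h : F ≤ S),
    letI := IsRealClosed.linearOrder F
    letI := IsRealClosed.linearOrder S
    ∃ (C : OrderCut F) (x : S), C.IsDedekind ∧ C.IsSymmetric ∧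
      (∀ a ∈ C.lower, Subfield.inclusion h a < x) ∧ (∀ b ∈ C.upper, x < Subfield.inclusion h b) ∧
      ∀ y, AlgOver (Subfield.inclusion h) x y

theorem exists_fillsSymmetricCut {F : Subfield Ω} [hF : IsRealClosed F] (hcard : #F < #Ω)
    (hsc : letI := IsRealClosed.linearOrder F; ¬ IsSymmetricallyComplete F) :
    ∃ S, FillsSymmetricCut F S := by
  let := IsRealClosed.linearOrder F
  have : IsStrictOrderedRing F := IsRealClosed.isStrictOrderedRing F
  simp only [IsSymmetricallyComplete, not_forall, not_not] at hsc
  obtain ⟨C, hC, hsymm⟩ := hsc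
  obtain ⟨R, _, _, _, i, x, hR, h1, h2, halg⟩ := hC.exists_algOver_fill
  have hx : x ∉ Set.range i := by
    rintro ⟨a, rfl⟩
    rcases C.mem_or_mem a with h | h
    · exact (h1 a h).false
    · exact (h2 a h).false
  -- There is room in Ω for a transcendental t. Sending x to t copies the abstract filling into Ω;
  -- the order plays no role here, as it is recovered from the squares.
  obtain ⟨t, ht⟩ := exists_transcendental_of_mk_lt hcard
  obtain ⟨φ, hφ, -⟩ := exists_ringHom_of_algOver (eval₂RingHom_injective_of_notMem hx) halg
    (f := F.subtype) (t := t) (transcendental_iff_injective.1 ht)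
  let e : R ≃+* φ.fieldRange := RingEquiv.ofBijective φ.rangeRestrictField
    ⟨φ.rangeRestrictField.injective, by rintro ⟨_, y, rfl⟩; exact ⟨y, rfl⟩⟩
  have hS : IsRealClosed φ.fieldRange := IsRealClosed.of_ringEquiv e
  let := IsRealClosed.linearOrder φ.fieldRange
  have : IsStrictOrderedRing φ.fieldRange := IsRealClosed.isStrictOrderedRing _
  have hle : F ≤ φ.fieldRange := fun a ha => ⟨i ⟨a, ha⟩, hφ ⟨a, ha⟩⟩
  have hincl : Subfield.inclusion hle = (e : R →+* φ.fieldRange).comp i := by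
    ext a
    exact (hφ a).symm
  have he : StrictMono (e : R →+* φ.fieldRange) := IsRealClosed.strictMono_ringHom _
  refine ⟨φ.fieldRange, hF, hS, hle, C, e x, hC, hsymm, fun a ha => ?_, fun b hb => ?_, fun y => ?_⟩
  · rw [hincl]; exact he (h1 a ha)
  · rw [hincl]; exact he (h2 b hb)
  · obtain ⟨z, rfl⟩ := e.surjective y
    rw [hincl]
    exact (algOver_map_iff (e : R →+* φ.fieldRange)).2 (halg z)

end Embed

/-! ### Directed unions of real closed subfields. -/

section DirectedUnion

variable {Ω : Type u} [Field Ω]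

theorem Subfield.exists_forall_mem_of_directed {ι : Type*} [Nonempty ι] {T : ι → Subfield Ω}
    (hT : Directed (· ≤ ·) T) (g : ℕ → Ω) (hg : ∀ n, ∃ k, g n ∈ T k) (N : ℕ) :
    ∃ k, ∀ n ≤ N, g n ∈ T k := by
  induction N with
  | zero =>
    obtain ⟨k, hk⟩ := hg 0
    exact ⟨k, fun n hn => by rwa [Nat.le_zero.1 hn]⟩
  | succ N ih =>
    obtain ⟨k, hk⟩ := ih
    obtain ⟨l, hl⟩ := hg (N + 1)
    obtain ⟨m, hkm, hlm⟩ := hT k l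
    refine ⟨m, fun n hn => ?_⟩
    rcases Nat.le_succ_iff.1 hn with h | rfl
    · exact hkm (hk n h)
    · exact hlm hl

/-- A directed union of real closed subfields is real closed. -/
theorem IsRealClosed.of_directed_union {ι : Type*} [Nonempty ι] {T : ι → Subfield Ω}
    (hT : Directed (· ≤ ·) T) (hreal : ∀ k, IsRealClosed (T k)) {A : Subfield Ω}
    (hA : ∀ y, y ∈ A ↔ ∃ k, y ∈ T k) : IsRealClosed A where
  one_add_ne_zero {s} hs h := by
    have key : ∀ s : A, IsSumSq s → ∃ (k : ι) (t : T k), IsSumSq t ∧ (t : Ω) = s := by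
      intro s hs
      induction hs with
      | zero =>
        obtain ⟨k⟩ := ‹Nonempty ι›
        exact ⟨k, 0, IsSumSq.zero, rfl⟩
      | sq_add a _ ih =>
        obtain ⟨k, t, ht, hts⟩ := ih
        obtain ⟨l, hl⟩ := (hA a).1 a.2
        obtain ⟨m, hkm, hlm⟩ := hT k l
        have ht' : IsSumSq (Subfield.inclusion hkm t) := by
          clear hts
          induction ht with
          | zero => rw [map_zero]; exact IsSumSq.zero
          | sq_add b _ ih => rw [map_add, map_mul]; exact IsSumSq.sq_add _ ih
        refine ⟨m, ⟨a, hlm hl⟩ * ⟨a, hlm hl⟩ + Subfield.inclusion hkm t, IsSumSq.sq_add _ ht', ?_⟩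
        rw [Subfield.coe_add, Subfield.coe_add, ← hts]
        rfl
    obtain ⟨k, t, ht, hts⟩ := key s hs
    have := hreal k
    refine IsSemireal.one_add_ne_zero ht (Subtype.ext ?_)
    have h' := congrArg Subtype.val h
    simpa [hts] using h'
  isSquare_or_isSquare_neg x := by
    obtain ⟨k, hk⟩ := (hA x).1 x.2
    have := hreal k
    have hle : T k ≤ A := fun y hy => (hA y).2 ⟨k, hy⟩
    rcases IsRealClosed.isSquare_or_isSquare_neg (⟨x, hk⟩ : T k) with h | h
    · exact .inl (h.map (Subfield.inclusion hle))
    · exact .inr (h.map (Subfield.inclusion hle))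
  exists_isRoot_of_odd_natDegree {f} hf := by
    obtain ⟨k, hk⟩ := Subfield.exists_forall_mem_of_directed hT (fun n => (f.coeff n : Ω))
      (fun n => (hA _).1 (f.coeff n).2) f.natDegree
    have := hreal k
    have hle : T k ≤ A := fun y hy => (hA y).2 ⟨k, hy⟩
    have hlift : f ∈ lifts (Subfield.inclusion hle) := by
      rw [lifts_iff_coeff_lifts]
      intro n
      rcases le_or_gt n f.natDegree with h | h
      · exact ⟨⟨f.coeff n, hk n h⟩, rfl⟩
      · rw [coeff_eq_zero_of_natDegree_lt h]
        exact ⟨0, map_zero _⟩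
    obtain ⟨q, rfl⟩ := (mem_lifts _).1 hlift
    rw [natDegree_map] at hf
    obtain ⟨x, hx⟩ := IsRealClosed.exists_isRoot_of_odd_natDegree hf
    exact ⟨_, hx.map⟩

end DirectedUnion

/-! ### The transfinite tower of filled cuts. -/

section Tower

variable {Ω : Type u} [Field Ω] [IsAlgClosed Ω]

/-- An increasing continuous sequence of real closed subfields, in which every successor is equal to
its predecessor or fills one of its symmetric Dedekind cuts. -/
structure IsSymmetricTower (T : Ordinal.{u} → Subfield Ω) : Prop where
  mono : Monotone T
  isRealClosed : ∀ i, IsRealClosed (T i)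
  succ : ∀ i, T (Order.succ i) = T i ∨ FillsSymmetricCut (T i) (T (Order.succ i))
  limit : ∀ i, Order.IsSuccLimit i → ∀ y ∈ T i, ∃ k < i, y ∈ T k

open Classical in
/-- A subfield that fills a symmetric Dedekind cut of `F`, if there is one, and `F` otherwise. -/
noncomputable def fillSymmetricCut (F : Subfield Ω) : Subfield Ω :=
  if h : ∃ S, FillsSymmetricCut F S then h.choose else F

theorem fillSymmetricCut_spec (F : Subfield Ω) :
    fillSymmetricCut F = F ∨ FillsSymmetricCut F (fillSymmetricCut F) := by
  unfold fillSymmetricCut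
  split_ifs with h
  · exact .inr h.choose_spec
  · exact .inl rfl

theorem FillsSymmetricCut.lt {F S : Subfield Ω} (h : FillsSymmetricCut F S) : F < S := by
  obtain ⟨_, _, hle, C, x, -, -, h1, h2, -⟩ := h
  refine lt_of_le_of_ne hle fun heq => ?_
  have hx : (x : Ω) ∈ F := heq ▸ x.2
  let := IsRealClosed.linearOrder F
  let := IsRealClosed.linearOrder S
  rcases C.mem_or_mem ⟨x, hx⟩ with h | h
  · exact (h1 _ h).false
  · exact (h2 _ h).false

theorem not_fillsSymmetricCut_of_eq {F : Subfield Ω} (h : fillSymmetricCut F = F) (S : Subfield Ω) :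
    ¬ FillsSymmetricCut F S := by
  intro hS
  have hex : ∃ S, FillsSymmetricCut F S := ⟨S, hS⟩
  have h1 := hex.choose_spec.lt
  rw [fillSymmetricCut, dif_pos hex] at h
  exact h1.ne' h

theorem le_fillSymmetricCut (F : Subfield Ω) : F ≤ fillSymmetricCut F := by
  rcases fillSymmetricCut_spec F with h | h
  · exact h.ge
  · exact h.lt.le

/-- The tower obtained from `B` by filling symmetric Dedekind cuts one at a time. -/
noncomputable def symmetricTower (B : Subfield Ω) (i : Ordinal.{u}) : Subfield Ω :=
  transfiniteIterate fillSymmetricCut i B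

theorem symmetricTower_zero (B : Subfield Ω) : symmetricTower B 0 = B :=
  transfiniteIterate_bot _ _

theorem symmetricTower_succ (B : Subfield Ω) (i : Ordinal.{u}) :
    symmetricTower B (Order.succ i) = fillSymmetricCut (symmetricTower B i) :=
  transfiniteIterate_succ _ _ _ (not_isMax i)

theorem isSymmetricTower_symmetricTower {B : Subfield Ω} (hB : IsRealClosed B) :
    IsSymmetricTower (symmetricTower B) := by
  have hmono : Monotone (symmetricTower B) := monotone_transfiniteIterate _ _ le_fillSymmetricCut
  have hlim : ∀ i, Order.IsSuccLimit i → ∀ y, y ∈ symmetricTower B i ↔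
      ∃ k : Set.Iio i, y ∈ symmetricTower B k := by
    intro i hi y
    have : Nonempty (Set.Iio i) := ⟨⟨⊥, hi.bot_lt⟩⟩
    rw [symmetricTower, transfiniteIterate_limit _ _ _ hi]
    exact Subfield.mem_iSup_of_directed (hmono.comp (Subtype.mono_coe _)).directed_le
  have hsucc : ∀ i, symmetricTower B (Order.succ i) = symmetricTower B i ∨
      FillsSymmetricCut (symmetricTower B i) (symmetricTower B (Order.succ i)) := fun i => by
    rw [symmetricTower_succ]
    exact fillSymmetricCut_spec _
  refine ⟨hmono, fun i => ?_, hsucc, fun i hi y hy => ?_⟩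
  · induction i using Ordinal.limitRecOn with
    | zero => rwa [symmetricTower_zero]
    | add_one i ih =>
      rcases hsucc i with h | h
      · rw [← Order.succ_eq_add_one, h]; exact ih
      · exact h.2.1
    | limit i hi ih =>
      have : Nonempty (Set.Iio i) := ⟨⟨⊥, hi.bot_lt⟩⟩
      exact IsRealClosed.of_directed_union (T := fun k : Set.Iio i => symmetricTower B k) (hmono.comp (Subtype.mono_coe _)).directed_le
        (fun k => ih k.1 k.2) (hlim i hi)
  · obtain ⟨k, hk⟩ := (hlim i hi y).1 hy
    exact ⟨k, k.2, hk⟩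

end Tower

/-! ### A uniform cardinality bound for the stages. -/

section CardinalBound

/-- The only class outside the value group is that of 0. It cannot occur in an increasing sequence
and occurs at most once in a decreasing one, so it can be skipped. -/
theorem NoLongChain.of_addUnits {ν : Cardinal.{u}} (hν : ℵ₀ ≤ ν) {L : Type u} [Field L]
    [LinearOrder L] [IsStrictOrderedRing L] (h : NoLongChain ν (AddUnits (ArchimedeanClass L))) :
    NoLongChain ν (ArchimedeanClass L) := by
  have hunit : ∀ c : ArchimedeanClass L, c ≠ ⊤ → ∃ g : AddUnits (ArchimedeanClass L), g = c := by
    intro c hc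
    obtain ⟨y, rfl⟩ := ArchimedeanClass.mk_surjective L c
    exact ⟨unitClass y, unitClass_val fun h0 => hc (by rw [h0, ArchimedeanClass.mk_zero])⟩
  constructor
  · intro f hf
    have hne : ∀ i, f i ≠ ⊤ := fun i => by
      obtain ⟨j, hj, -⟩ := SuccOrd.exists_lt_lt hν i i
      exact ((hf hj).trans_le le_top).ne
    choose g hg using fun i => hunit (f i) (hne i)
    refine h.1 g fun i j hij => ?_
    rw [← AddUnits.val_lt_val, hg, hg]
    exact hf hij
  · intro f hf
    obtain ⟨e, he⟩ := SuccOrd.exists_seq (ν := ν) (A := {i : SuccOrd ν // f i ≠ ⊤})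
      (R := fun i j => i < j) (by
        intro s hs
        obtain ⟨b, hb⟩ := SuccOrd.exists_forall_lt hν (s := Subtype.val '' s)
          (Cardinal.mk_image_le.trans hs)
        obtain ⟨b', hb', -⟩ := SuccOrd.exists_lt_lt hν b b
        exact ⟨⟨b', ((hf hb').trans_le le_top).ne⟩, fun x hx => (hb x ⟨x, hx, rfl⟩).trans hb'⟩)
    choose g hg using fun i => hunit (f (e i)) (e i).2
    refine h.2 g fun i j hij => ?_
    rw [← AddUnits.val_lt_val, hg, hg]
    exact hf (he i j hij)

variable {Ω : Type u} [Field Ω] [IsAlgClosed Ω] {T : Ordinal.{u} → Subfield Ω}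

/-- The least stage of a tower containing an element of a given rank class. -/
noncomputable def towerRank (T : Ordinal.{u} → Subfield Ω) (L : Subfield Ω) [LinearOrder L]
    [IsStrictOrderedRing L] (γ : ArchimedeanClass (AddUnits (ArchimedeanClass L))) : Ordinal.{u} :=
  sInf {i | ∃ y : L, (y : Ω) ∈ T i ∧ rankClass y = γ}

variable {j : Ordinal.{u}} [LinearOrder (T j)] [IsStrictOrderedRing (T j)]

theorem towerRank_spec (γ : ArchimedeanClass (AddUnits (ArchimedeanClass (T j)))) :
    ∃ y : T j, (y : Ω) ∈ T (towerRank T (T j) γ) ∧ rankClass y = γ :=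
  csInf_mem (s := {i | ∃ y : T j, (y : Ω) ∈ T i ∧ rankClass y = γ}) (by
    obtain ⟨y, hy⟩ := rankClass_surjective γ
    exact ⟨j, y, y.2, hy⟩)

theorem towerRank_le {i : Ordinal.{u}} {y : T j} (hy : (y : Ω) ∈ T i) :
    towerRank T (T j) (rankClass y) ≤ i :=
  csInf_le' ⟨y, hy, rfl⟩

/-- By continuity a class first appears at a successor stage k + 1, and then the step fills a
symmetric cut of F = T k. The older classes are those of `F`, and `exists_rankClass_eq_of_algOver`
leaves room for one new class. -/
theorem IsSymmetricTower.exists_of_towerRank_ne_zero (hT : IsSymmetricTower T)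
    {γ : ArchimedeanClass (AddUnits (ArchimedeanClass (T j)))} (hγ : towerRank T (T j) γ ≠ 0) :
    ∃ (F : Subfield Ω) (_ : IsRealClosed F) (h : F ≤ T j) (a b : F) (x : T j), b ≠ 0 ∧
      (letI := IsRealClosed.linearOrder F; CountablyBalanced (Subfield.inclusion h) x) ∧
      (∀ δ, towerRank T (T j) δ < towerRank T (T j) γ ↔
        ∃ c, δ = rankClass (Subfield.inclusion h c)) ∧
      ∀ δ, towerRank T (T j) δ = towerRank T (T j) γ →
        δ = rankClass (Subfield.inclusion h b * (x - Subfield.inclusion h a)) := by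
  obtain ⟨y, hy, hyγ⟩ := towerRank_spec γ
  have hmin : ∀ k < towerRank T (T j) γ, ∀ z : T j, (z : Ω) ∈ T k → rankClass z ≠ γ := by
    rintro k hk z hz rfl
    exact (towerRank_le hz).not_gt hk
  have hγj : towerRank T (T j) γ ≤ j := by rw [← hyγ]; exact towerRank_le y.2
  set r := towerRank T (T j) with hr
  rcases Ordinal.zero_or_succ_or_isSuccLimit (r γ) with h0 | ⟨k, hk⟩ | hlim
  · exact absurd h0 hγ
  swap
  · obtain ⟨k, hk, hyk⟩ := hT.limit _ hlim y hy
    exact absurd hyγ (hmin k hk y hyk)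
  have hkγ : k < r γ := by rw [← hk]; exact Order.lt_succ k
  have hstep : FillsSymmetricCut (T k) (T (r γ)) := by
    rw [← hk]
    refine (hT.succ k).resolve_left fun h => ?_
    rw [hk] at h
    exact hmin k hkγ y (h ▸ hy) hyγ
  obtain ⟨hF, hS, hle, C, x, -, hsymm, h1, h2, halg⟩ := hstep
  let := IsRealClosed.linearOrder (T k)
  have : IsStrictOrderedRing (T k) := IsRealClosed.isStrictOrderedRing _
  let := IsRealClosed.linearOrder (T (r γ))
  have : IsStrictOrderedRing (T (r γ)) := IsRealClosed.isStrictOrderedRing _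
  have hSj : T (r γ) ≤ T j := hT.mono hγj
  have hmono := IsRealClosed.strictMono_ringHom (Subfield.inclusion hSj)
  have hl : ∀ a ∈ C.lower, Subfield.inclusion (hle.trans hSj) a < Subfield.inclusion hSj x :=
    fun a ha => hmono (h1 a ha)
  have hu : ∀ b ∈ C.upper, Subfield.inclusion hSj x < Subfield.inclusion (hle.trans hSj) b :=
    fun b hb => hmono (h2 b hb)
  have hx : Subfield.inclusion hSj x ∉ Set.range (Subfield.inclusion (hle.trans hSj)) := by
    rintro ⟨a, ha⟩
    rcases C.mem_or_mem a with h | h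
    · exact (hl a h).ne ha
    · exact (hu a h).ne' ha
  obtain ⟨a, b, hb, hab⟩ := exists_rankClass_eq_of_algOver hx
  have hbelow : ∀ δ, r δ < r γ ↔ ∃ c, δ = rankClass (Subfield.inclusion (hle.trans hSj) c) := by
    intro δ
    constructor
    · intro hδ
      obtain ⟨z, hz, hzδ⟩ := towerRank_spec δ
      rw [← hk, Order.lt_succ_iff] at hδ
      exact ⟨⟨z, hT.mono hδ hz⟩, hzδ.symm⟩
    · rintro ⟨c, rfl⟩
      exact (towerRank_le (i := k) (y := Subfield.inclusion (hle.trans hSj) c) c.2).trans_lt hkγ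
  refine ⟨T k, hF, hle.trans hSj, a, b, Subfield.inclusion hSj x, hb,
    hsymm.countablyBalanced hl hu, hbelow, fun δ hδ => ?_⟩
  obtain ⟨z, hz, hzδ⟩ := towerRank_spec δ
  have hz : (z : Ω) ∈ T (r γ) := hδ ▸ hz
  have halgz : AlgOver (Subfield.inclusion (hle.trans hSj)) (Subfield.inclusion hSj x) z :=
    (algOver_map_iff (Subfield.inclusion hSj)).2 (halg ⟨z, hz⟩)
  rcases hab z halgz with ⟨c, hc⟩ | h
  · exact absurd hδ ((hbelow δ).2 ⟨c, hzδ ▸ hc⟩).ne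
  · exact hzδ ▸ h

/-- No field of a symmetric tower over a small field is large. -/
theorem IsSymmetricTower.mk_le (hT : IsSymmetricTower T) {ν : Cardinal.{u}} (hν : ℵ₁ ≤ ν)
    (h0 : #(T 0) ≤ ν) (j : Ordinal.{u}) : #(T j) ≤ 2 ^ ν := by
  have := hT.isRealClosed j
  let := IsRealClosed.linearOrder (T j)
  have : IsStrictOrderedRing (T j) := IsRealClosed.isStrictOrderedRing _
  have hν0 : ℵ₀ ≤ ν := Cardinal.aleph0_lt_aleph_one.le.trans hν
  refine NoLongChain.mk_le hν0 (.of_archimedeanClass hν0 (.of_addUnits hν0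
    (.of_archimedeanClass hν0 (.of_rank (r := towerRank T (T j)) hν ?_ ?_ ?_))))
  · refine le_trans ?_ h0
    refine Cardinal.mk_le_of_surjective
      (f := fun y : T 0 => (⟨rankClass (Subfield.inclusion (hT.mono zero_le) y), ?_⟩ :
        {γ | towerRank T (T j) γ = 0})) ?_
    · exact nonpos_iff_eq_zero.1 (towerRank_le y.2)
    · rintro ⟨γ, hγ⟩
      obtain ⟨y, hy, hyγ⟩ := towerRank_spec γ
      have hγ : towerRank T (T j) γ = 0 := hγ
      rw [hγ] at hy
      exact ⟨⟨y, hy⟩, Subtype.ext hyγ⟩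
  · intro γ δ hγ hγδ
    obtain ⟨F, _, h, a, b, x, -, -, -, h1⟩ := hT.exists_of_towerRank_ne_zero hγ
    rw [h1 γ rfl, h1 δ hγδ.symm]
  · intro γ hγ
    obtain ⟨F, _, h, a, b, x, hb, hx, hlt, h1⟩ := hT.exists_of_towerRank_ne_zero hγ
    let := IsRealClosed.linearOrder F
    have : IsStrictOrderedRing F := IsRealClosed.isStrictOrderedRing _
    have hγ' := h1 γ rfl
    have hnew : ∀ c, rankClass (Subfield.inclusion h b * (x - Subfield.inclusion h a)) ≠
        rankClass (Subfield.inclusion h c) := fun c hc =>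
      ((hlt γ).2 ⟨c, hγ'.trans hc⟩).false
    have key := hx.rankClass_iff (IsRealClosed.strictMono_ringHom _) hb hnew
    rw [← hγ'] at key
    refine Iff.trans ?_ (key.trans ?_)
    · refine exists_congr fun S => and_congr_right fun _ => and_congr ?_ ?_
      · simp only [hlt]
      · exact ⟨fun H c hc => H _ hc ((hlt _).2 ⟨c, rfl⟩), fun H δ hδ hr => by
          obtain ⟨c, rfl⟩ := (hlt δ).1 hr
          exact H c hδ⟩
    · refine exists_congr fun S => and_congr_right fun _ => and_congr ?_ ?_
      · simp only [hlt]
      · exact ⟨fun H δ hδ hr => by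
          obtain ⟨c, rfl⟩ := (hlt δ).1 hr
          exact H c hδ, fun H c hc => H _ hc ((hlt _).2 ⟨c, rfl⟩)⟩

end CardinalBound

/-! ### Embedding the tower into a symmetrically complete field. -/

section TowerEmbedding

variable {Ω : Type u} [Field Ω] [IsAlgClosed Ω] {M : Type v} [Field M] [LinearOrder M]
  [IsStrictOrderedRing M] [IsRealClosed M]

theorem FillsSymmetricCut.exists_extension (hM : IsSymmetricallyComplete M) {F S : Subfield Ω}
    (h : FillsSymmetricCut F S) (g : F →+* M) :
    ∃ g' : S →+* M, ∀ a, g' (Subfield.inclusion h.lt.le a) = g a := by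
  obtain ⟨hF, hS, hle, C, x, hC, hsymm, h1, h2, halg⟩ := h
  let := IsRealClosed.linearOrder F
  have : IsStrictOrderedRing F := IsRealClosed.isStrictOrderedRing _
  let := IsRealClosed.linearOrder S
  have : IsStrictOrderedRing S := IsRealClosed.isStrictOrderedRing _
  obtain ⟨m, hm1, hm2⟩ := hM.exists_between hC hsymm (IsRealClosed.strictMono_ringHom g)
  refine exists_extension_of_sameCut (x := x) (m := m) ?_ ?_ (fun a => ?_) halg
  · rintro ⟨a, ha⟩
    rcases C.mem_or_mem a with h | h
    · exact (h1 a h).ne ha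
    · exact (h2 a h).ne' ha
  · rintro ⟨a, ha⟩
    rcases C.mem_or_mem a with h | h
    · exact (hm1 a h).ne ha
    · exact (hm2 a h).ne' ha
  · rcases C.mem_or_mem a with h | h
    · exact iff_of_true (h1 a h) (hm1 a h)
    · exact iff_of_false (h2 a h).not_gt (hm2 a h).not_gt

open IntermediateField in
/-- Homomorphisms from the bottom of a symmetric tower into a symmetrically complete real closed
field extend to the whole tower. -/
theorem IsSymmetricTower.exists_extension {T : Ordinal.{u} → Subfield Ω} (hT : IsSymmetricTower T)
    (hM : IsSymmetricallyComplete M) (f : T 0 →+* M) (j : Ordinal.{u}) :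
    ∃ ψ : T j →+* M, ∀ a, ψ (Subfield.inclusion (hT.mono zero_le) a) = f a := by
  algebraize [f]
  -- Zorn's lemma is applied to partial embeddings defined exactly on a stage of the tower.
  let P : Set (Lifts (T 0) Ω M) := {l | ∃ i ≤ j, ∀ y, y ∈ l.carrier ↔ y ∈ T i}
  have hbot : (⊥ : Lifts (T 0) Ω M) ∈ P := by
    refine ⟨0, zero_le, fun y => ?_⟩
    change y ∈ (⊥ : IntermediateField (T 0) Ω) ↔ _
    rw [mem_bot]
    exact ⟨by rintro ⟨a, rfl⟩; exact a.2, fun hy => ⟨⟨y, hy⟩, rfl⟩⟩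
  obtain ⟨l, -, hl⟩ := zorn_le_nonempty₀ P (fun c hcP hc l₀ hl₀ => by
    have : Nonempty c := ⟨⟨l₀, hl₀⟩⟩
    choose k hkj hk using fun l : c => hcP l.2
    have hbdd : BddAbove (Set.range k) := ⟨j, by rintro _ ⟨l, rfl⟩; exact hkj l⟩
    refine ⟨Lifts.union c hc, ⟨⨆ l, k l, ciSup_le hkj, fun y => ?_⟩, fun z hz => Lifts.le_union c hc hz⟩
    have hdir : Directed (· ≤ ·) fun l : c => l.1.carrier :=
      hc.directedOn.directed_val.mono_comp _ fun _ _ h => h.1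
    have hmem : y ∈ (Lifts.union c hc).carrier ↔ ∃ l : c, y ∈ T (k l) := by
      rw [Lifts.carrier_union, ← SetLike.mem_coe, coe_iSup_of_directed hdir, Set.mem_iUnion]
      exact exists_congr fun l => hk l y
    rw [hmem]
    refine ⟨fun ⟨l, hl⟩ => hT.mono (le_ciSup hbdd l) hl, fun hy => ?_⟩
    -- A supremum that is not attained is a limit ordinal, where the tower is continuous, so the
    -- union of the chain is again a stage.
    by_cases hatt : ∃ l, k l = ⨆ l, k l
    · obtain ⟨l, hl⟩ := hatt
      exact ⟨l, hl ▸ hy⟩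
    push Not at hatt
    have hlt : ∀ l, k l < ⨆ l, k l := fun l => lt_of_le_of_ne (le_ciSup hbdd l) (hatt l)
    rcases Ordinal.zero_or_succ_or_isSuccLimit (⨆ l, k l) with h0 | ⟨p, hp⟩ | hlim
    · exact absurd ((hlt ⟨l₀, hl₀⟩).trans_eq h0) not_lt_zero
    · have h1 : ⨆ l, k l ≤ p := ciSup_le fun l => Order.lt_succ_iff.1 (hp ▸ hlt l)
      rw [← hp] at h1
      exact absurd h1 (Order.lt_succ p).not_ge
    · obtain ⟨p, hp, hyp⟩ := hT.limit _ hlim y hy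
      obtain ⟨l, hl⟩ := exists_lt_of_lt_ciSup hp
      exact ⟨l, hT.mono hl.le hyp⟩) ⊥ hbot
  obtain ⟨i, hij, hi⟩ := hl.1
  have hcomm : ∀ (y : T 0) (hy : (y : Ω) ∈ l.carrier), l.emb ⟨y, hy⟩ = f y := fun y hy =>
    l.emb.commutes y
  suffices htop : T j ≤ T i by
    let e : T j →+* l.carrier :=
      { toFun := fun y => ⟨y, (hi y).2 (htop y.2)⟩
        map_one' := rfl
        map_zero' := rfl
        map_add' := fun _ _ => rfl
        map_mul' := fun _ _ => rfl }
    exact ⟨l.emb.toRingHom.comp e, fun a => hcomm a _⟩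
  by_contra hne
  obtain ⟨k, ⟨hkj, hk⟩, hmin⟩ := wellFounded_lt.has_min {k | k ≤ j ∧ ¬ T k ≤ T i} ⟨j, le_rfl, hne⟩
  have hmin : ∀ p < k, T p ≤ T i := fun p hp => by
    by_contra h
    exact hmin p ⟨hp.le.trans hkj, h⟩ hp
  have hik : i < k := by
    by_contra! h
    exact hk (hT.mono h)
  rcases Ordinal.zero_or_succ_or_isSuccLimit k with rfl | ⟨p, rfl⟩ | hlim
  · exact not_lt_zero hik
  · have hpi : T p = T i := le_antisymm (hmin p (Order.lt_succ p)) (hT.mono (Order.lt_succ_iff.1 hik))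
    have hstep : FillsSymmetricCut (T p) (T (Order.succ p)) :=
      (hT.succ p).resolve_left fun h => hk (by rw [h, hpi])
    let e : T p →+* l.carrier :=
      { toFun := fun y => ⟨y, (hi y).2 (hpi ▸ y.2)⟩
        map_one' := rfl
        map_zero' := rfl
        map_add' := fun _ _ => rfl
        map_mul' := fun _ _ => rfl }
    obtain ⟨g, hg⟩ := hstep.exists_extension hM (l.emb.toRingHom.comp e)
    have h0 : T 0 ≤ T (Order.succ p) := hT.mono zero_le
    let E : IntermediateField (T 0) Ω := (T (Order.succ p)).toIntermediateField fun a => h0 a.2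
    let l' : Lifts (T 0) Ω M := ⟨E, { (g : E →+* M) with
      commutes' := fun a => (hg ⟨a, hT.mono zero_le a.2⟩).trans (hcomm a _) }⟩
    have hle : l ≤ l' := ⟨fun y hy => hstep.lt.le (hpi ▸ (hi y).1 hy), fun y =>
      hg ⟨y, hpi ▸ (hi y).1 y.2⟩⟩
    have h1 := (hl.2 (y := l') ⟨_, hkj, fun y => Iff.rfl⟩ hle).1
    exact hk fun y hy => (hi y).1 (h1 hy)
  · refine hk fun y hy => ?_
    obtain ⟨p, hp, hyp⟩ := hT.limit k hlim y hy
    exact hmin p hp hyp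

end TowerEmbedding

/-! ### Termination of the tower and the main theorem. -/

section Main

/-- An algebraically closed extension of arbitrarily large cardinality. -/
theorem exists_isAlgClosed_extension (E : Type u) [Field E] (κ : Cardinal.{u}) :
    ∃ (Ω : Type u) (_ : Field Ω), IsAlgClosed Ω ∧ Nonempty (E →+* Ω) ∧ κ ≤ #Ω := by
  let Q := FractionRing (MvPolynomial κ.out E)
  let Ω := AlgebraicClosure Q
  let g : MvPolynomial κ.out E →+* Ω := (algebraMap Q Ω).comp (algebraMap _ Q)
  have hg : Function.Injective g :=
    (algebraMap Q Ω).injective.comp (IsFractionRing.injective _ _)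
  refine ⟨Ω, inferInstance, inferInstance, ⟨g.comp MvPolynomial.C⟩, ?_⟩
  rw [← Cardinal.mk_out κ]
  exact Cardinal.mk_le_of_injective (hg.comp (MvPolynomial.X_injective (R := E)))

/-- Every symmetric tower of filled cuts becomes stationary at a symmetrically complete field, if
there is enough room. -/
theorem exists_isSymmetricallyComplete_symmetricTower {Ω : Type u} [Field Ω] [IsAlgClosed Ω]
    {B : Subfield Ω} (hB : IsRealClosed B) (hcard : ∀ j, #(symmetricTower B j) < #Ω) :
    ∃ (j : Ordinal.{u}) (_ : IsRealClosed (symmetricTower B j)),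
      letI := IsRealClosed.linearOrder (symmetricTower B j)
      IsSymmetricallyComplete (symmetricTower B j) := by
  have hT := isSymmetricTower_symmetricTower hB
  -- The ordinals do not inject into the set of subfields of Ω. By monotonicity, a repetition at i <
  -- j already makes stages i and i + 1 equal.
  obtain ⟨i, j, hij, hne⟩ : ∃ i j, symmetricTower B i = symmetricTower B j ∧ i ≠ j := by
    have := not_injective_of_ordinal (symmetricTower B)
    simpa [Function.Injective] using this
  wlog hlt : i < j generalizing i j
  · exact this j i hij.symm hne.symm (lt_of_le_of_ne (not_lt.1 hlt) hne.symm)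
  have := hT.isRealClosed i
  refine ⟨i, this, ?_⟩
  by_contra hsc
  obtain ⟨S, hS⟩ := exists_fillsSymmetricCut (hcard i) hsc
  refine not_fillsSymmetricCut_of_eq ?_ S hS
  rw [← symmetricTower_succ]
  exact le_antisymm ((hT.mono (Order.succ_le_of_lt hlt)).trans hij.ge) (hT.mono (Order.le_succ i))

/-- The bound needs no successor of |K|: the real closure at the bottom of the tower has at most |K|
+ ℵ₁ elements, and this is a valid ν. -/
theorem exists_prime_symmetricallyComplete (K : Type u) [Field K] [LinearOrder K]
    [IsStrictOrderedRing K] :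
    ∃ (L : Type u) (_ : Field L) (_ : LinearOrder L) (_ : IsStrictOrderedRing L) (ι : K →+*o L),
      IsRealClosed L ∧ IsSymmetricallyComplete L ∧
      (∀ (M : Type v) [Field M] [LinearOrder M] [IsStrictOrderedRing M],
        IsRealClosed M → IsSymmetricallyComplete M →
          ∀ φ : K →+*o M, ∃ ψ : L →+*o M, ∀ x : K, ψ (ι x) = φ x) ∧
      #L ≤ 2 ^ (#K + ℵ₁) := by
  obtain ⟨E, hE, hsq⟩ := exists_isRealClosed_intermediateField K (AlgebraicClosure K)
  obtain ⟨Ω, _, _, ⟨e⟩, hΩ⟩ := exists_isAlgClosed_extension E (Order.succ (2 ^ (#K + ℵ₁)))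
  let e' : E ≃+* e.fieldRange := RingEquiv.ofBijective e.rangeRestrictField
    ⟨e.rangeRestrictField.injective, by rintro ⟨_, y, rfl⟩; exact ⟨y, rfl⟩⟩
  have hB : IsRealClosed e.fieldRange := .of_ringEquiv e'
  have hT := isSymmetricTower_symmetricTower hB
  have h0 := symmetricTower_zero e.fieldRange
  have hν : ℵ₁ ≤ #K + ℵ₁ := self_le_add_left _ _
  have hcard : ∀ j, #(symmetricTower e.fieldRange j) ≤ 2 ^ (#K + ℵ₁) := by
    refine hT.mk_le hν ?_
    rw [h0, ← Cardinal.mk_congr e'.toEquiv]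
    refine (Algebra.IsAlgebraic.cardinalMk_le_max K E).trans (max_le (self_le_add_right _ _) ?_)
    exact Cardinal.aleph0_lt_aleph_one.le.trans hν
  obtain ⟨j, hj, hsc⟩ := exists_isSymmetricallyComplete_symmetricTower hB fun j =>
    (Order.lt_succ_of_le (hcard j)).trans_le hΩ
  let L := symmetricTower e.fieldRange j
  let := IsRealClosed.linearOrder L
  have : IsStrictOrderedRing L := IsRealClosed.isStrictOrderedRing _
  let r : E →+* symmetricTower e.fieldRange 0 :=
    (Subfield.inclusion h0.ge).comp (e' : E →+* e.fieldRange)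
  let i : E →+* L := (Subfield.inclusion (hT.mono zero_le)).comp r
  have hmono : Monotone (i.comp (algebraMap K E)) := by
    intro a b hab
    have h := ((hsq (b - a) (sub_nonneg.2 hab)).map i).nonneg
    rwa [map_sub, map_sub, sub_nonneg] at h
  refine ⟨L, inferInstance, inferInstance, inferInstance, ⟨i.comp (algebraMap K E), hmono⟩, hj, hsc,
    fun M _ _ _ hM hMsc φ => ?_, hcard j⟩
  let := IsRealClosed.linearOrder E
  have : IsStrictOrderedRing E := IsRealClosed.isStrictOrderedRing _
  obtain ⟨ψ₀, hψ₀⟩ := exists_extension_of_isAlgebraic (R := E) (φ : K →+* M) fun c hc => by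
    have hc' : 0 ≤ c := by
      by_contra! hneg
      have h1 := (hsq (-c) (neg_nonneg.2 hneg.le)).nonneg
      rw [map_neg] at h1
      have h2 : algebraMap K E c = 0 := le_antisymm (neg_nonneg.1 h1) hc
      exact hneg.ne ((map_eq_zero _).1 h2)
    exact map_nonneg φ hc'
  let r' : symmetricTower e.fieldRange 0 →+* E :=
    (e'.symm : e.fieldRange →+* E).comp (Subfield.inclusion h0.le)
  obtain ⟨ψ, hψ⟩ := hT.exists_extension hMsc (ψ₀.comp r') j
  refine ⟨⟨ψ, (IsRealClosed.strictMono_ringHom ψ).monotone⟩, fun x => ?_⟩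
  change ψ (Subfield.inclusion (hT.mono zero_le) (r (algebraMap K E x))) = φ x
  rw [hψ]
  have hr : r' (r (algebraMap K E x)) = algebraMap K E x := e'.symm_apply_apply _
  change ψ₀ (r' (r (algebraMap K E x))) = φ x
  rw [hr, hψ₀]
  rfl

end Main

theorem mainTheorem1 :
    -- in ordered fields, the two forms of symmetric completeness are equivalent
    (∀ (F : Type u) [Field F] [LinearOrder F] [IsStrictOrderedRing F],
      IsSymmetricallyComplete F ↔ HasNestedIntervalProperty F) ∧
    -- existence of a small prime symmetrically complete real closed extension
    (∀ (K : Type u) [Field K] [LinearOrder K] [IsStrictOrderedRing K],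
      ∃ (L : Type u) (_ : Field L) (_ : LinearOrder L) (_ : IsStrictOrderedRing L)
        (ι : K →+*o L),
        IsRealClosed L ∧
        IsSymmetricallyComplete L ∧
        HasNestedIntervalProperty L ∧
        (∀ (M : Type v) [Field M] [LinearOrder M] [IsStrictOrderedRing M],
          IsRealClosed M → IsSymmetricallyComplete M →
            ∀ φ : K →+*o M, ∃ ψ : L →+*o M, ∀ x : K, ψ (ι x) = φ x) ∧
        #L ≤ 2 ^ (Order.succ #K + ℵ₁)) := by
  refine ⟨fun F _ _ _ => isSymmetricallyComplete_iff_hasNestedIntervalProperty, fun K _ _ _ => ?_⟩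
  obtain ⟨L, _, _, _, ι, h1, h2, h3, h4⟩ := exists_prime_symmetricallyComplete.{u, v} K
  refine ⟨L, inferInstance, inferInstance, inferInstance, ι, h1, h2, h2.hasNestedIntervalProperty, h3, h4.trans ?_⟩
  exact Cardinal.power_le_power_left two_ne_zero (add_le_add_left (Order.le_succ _) _)
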